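/- Let $d\in\{2,3\}$ and let $\Omega\subset\mathbb{R}^d$ be a bounded Lipschitz domain (open, connected, non-empty) whose boundary is piecewise polygonal, i.e. contained in finitely many hyperplanes. Let $H_0(\operatorname{div},\Omega)$ be the space of $v\in L^2(\Omega;\mathbb{R}^d)$ with weak divergence in $L^2(\Omega)$ and vanishing normal trace on $\partial\Omega$, with $\|v\|_{H(\operatorname{div},\Omega)}^2=\|v\|_{L^2(\Omega)}^2+\|\operatorname{div}v\|_{L^2(\Omega)}^2$; let $L^2_0(\Omega)$ be the space of $q\in L^2(\Omega)$ with $\int_\Omega q\,dx=0$, and $b(v,q)=(\operatorname{div}v,q)_{L^2(\Omega)}$. Let $C_\Omega$ be the optimal constant in the Poincaré–Wirtinger inequality $\|\varphi\|_{L^2(\Omega)}\le C_\Omega\|\nabla\varphi\|_{L^2(\Omega)}$ for $\varphi\in H^1(\Omega)\cap L^2_0(\Omega)$. For a conforming mesh $\mathcal{T}_H$ of $\overline\Omega$ into finitely many closed simplices (any two distinct elements are disjoint or share exactly a common subsimplex) with $H_T=\operatorname{diam}T$ and $H=\max_{T}H_T$, and for $k\in\mathbb{N}_0$, let $$Q_H^k=\{q\in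 L^2(\Omega): q|_T\in\mathbb{P}_k(T)\ \forall T\in\mathcal{T}_H\},\qquad V_H^k=\{v\in H_0(\operatorname{div},\Omega): v|_T\in[\mathbb{P}_k(T)]^d+x\,\mathbb{P}_k(T)\ \forall T\in\mathcal{T}_H\}.$$ Fix $k\in\mathbb{N}_0$, $\gamma_{\rm qu}>0$ and $\gamma_{\rm sr}\in\mathbb{R}$, and call a mesh admissible if $\min_T H_T\ge\gamma_{\rm qu}H$ and $\max_T H_T/\operatorname{diam}(B_T)\le\gamma_{\rm sr}$, where $B_T$ is the largest ball contained in $T$. Call a map $\pi_H:H_0(\operatorname{div},\Omega)\to V_H^k$ a stable commuting projection with constant $C$ if it is surjective, $\pi_H\circ\pi_H=\pi_H$, $\operatorname{div}(\pi_Hv)=P_H(\operatorname{div}v)$ for all $v\in H_0(\operatorname{div},\Omega)$, where $P_H$ is the $L^2$-orthogonal projection onto $Q_H^k$, and $$\|\pi_Hv\|_{L^2(T)}^2+H^2\|\operatorname{div}\pi_Hv\|_{L^2(T)}^2\le C\big(\|v\|_{L^2(N^1(T))}^2+H^2\|\operatorname{div}v\|_{L^2(N^1(T))}^2\big)$$ for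 all $v\in H_0(\operatorname{div},\Omega)$ and $T\in\mathcal{T}_H$, where $N^1(T)=\bigcup\{K\in\mathcal{T}_H: K\cap T\neq\emptyset\}$. Write $$\beta(\mathcal{T}_H):=\inf_{q_H\in (Q_H^k\cap L^2_0(\Omega))\setminus\{0\}}\ \sup_{v_H\in V_H^k\setminus\{0\}}\frac{b(v_H,q_H)}{\|q_H\|_{L^2(\Omega)}\|v_H\|_{H(\operatorname{div},\Omega)}}\qquad(\inf\emptyset=+\infty).$$ Then: 1. The optimal Poincaré–Wirtinger constant exists and $0<C_\Omega<\infty$. 2. There is a constant $\rho>0$ that depends only on $d,\Omega,k,\gamma_{\rm qu},\gamma_{\rm sr}$, and not on $H$, such that $\beta(\mathcal{T}_H)\ge\rho$ for every admissible mesh $\mathcal{T}_H$. 3. Explicitly: if $\mathcal{T}_H$ is a conforming mesh of $\overline\Omega$ as above, $\pi_H$ is a stable commuting projection (with any constant $C$), and $C_{\pi_H,\rm stab}>0$ is such that $\|\pi_Hv\|_{L^2(\Omega)}^2\le C_{\pi_H,\rm stab}\big(\|v\|_{L^2(\Omega)}^2+\|\operatorname{div}v\|_{L^2(\Omega)}^2\big)$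 for all $v\in H_0(\operatorname{div},\Omega)$, then $$\beta(\mathcal{T}_H)\ \ge\ \big(1+C_{\pi_H,\rm stab}(1+C_\Omega^2)\big)^{-1/2}.$$ 4. For each $C>0$ there is such a global stability constant $C_{\pi_H,\rm stab}>0$, depending only on $C,d,\Omega,k,\gamma_{\rm qu},\gamma_{\rm sr}$, that is valid for all admissible meshes $\mathcal{T}_H$ and all stable commuting projections $\pi_H$ with constant $C$. In particular the explicit inf-sup constant in 3 can be chosen independently of $H$. -/

import Mathlib

open MeasureTheory Set
open scoped ContDiff RealInnerProductSpace

noncomputable section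

namespace RTInfSup

/-- The Euclidean space `ℝ^d`. -/
abbrev E (d : ℕ) : Type := EuclideanSpace ℝ (Fin d)

/-- `L²(Ω)`. -/
abbrev L2 {d : ℕ} (Ω : Set (E d)) : Type := Lp ℝ 2 (volume.restrict Ω)

/-- `L²(Ω, ℝ^d)`. -/
abbrev L2V {d : ℕ} (Ω : Set (E d)) : Type := Lp (E d) 2 (volume.restrict Ω)

/-! ### The domain -/

/-- Bounded Lipschitz domains: bounded, open, connected and non-empty, and near every boundary
point the set is, in a suitable orthonormal frame, the strict epigraph of a Lipschitz function.
Here `e` is the vertical direction, `⟪e, y⟫` the vertical coordinate of `y` and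
`y - ⟪e, y⟫ • e` its horizontal part. -/
structure IsLipschitzDomain {d : ℕ} (Ω : Set (E d)) : Prop where
  isOpen : IsOpen Ω
  isConnected : IsConnected Ω
  isBounded : Bornology.IsBounded Ω
  lipschitz_boundary : ∀ x₀ ∈ frontier Ω, ∃ (e : E d) (K : NNReal) (g : E d → ℝ),
    ‖e‖ = 1 ∧ LipschitzWith K g ∧ ∃ U ∈ nhds x₀, ∀ y ∈ U,
      (y ∈ Ω ↔ g (y - ⟪e, y⟫ • e) < ⟪e, y⟫)

/-- Piecewise polygonal (flat) boundary: it is contained in finitely many hyperplanes. -/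
def HasPolygonalBoundary {d : ℕ} (Ω : Set (E d)) : Prop :=
  ∃ A : Finset (E d × ℝ), (∀ a ∈ A, a.1 ≠ 0) ∧
    ∀ x ∈ frontier Ω, ∃ a ∈ A, ⟪a.1, x⟫ = a.2

/-! ### Function spaces -/

/-- `g` is the weak divergence of `v` in `Ω`. -/
def HasWeakDiv {d : ℕ} (Ω : Set (E d)) (v : L2V Ω) (g : L2 Ω) : Prop :=
  ∀ ψ : E d → ℝ, ContDiff ℝ ∞ ψ → HasCompactSupport ψ → tsupport ψ ⊆ Ω →
    ∫ x in Ω, fderiv ℝ ψ x (v x) = - ∫ x in Ω, g x * ψ x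

/-- `H(div, Ω)`. -/
def Hdiv {d : ℕ} (Ω : Set (E d)) : Set (L2V Ω) := {v | ∃ g : L2 Ω, HasWeakDiv Ω v g}

open Classical in
/-- The weak divergence `div v ∈ L²(Ω)` of `v ∈ H(div, Ω)` (and `0` for other `v`). -/
def weakDiv {d : ℕ} (Ω : Set (E d)) (v : L2V Ω) : L2 Ω :=
  if h : ∃ g : L2 Ω, HasWeakDiv Ω v g then h.choose else 0

/-- The weak divergence is unique, so that `weakDiv` is characterized by `HasWeakDiv`. -/
theorem weakDiv_eq {d : ℕ} {Ω : Set (E d)} (hΩ : IsOpen Ω) {v : L2V Ω} {g : L2 Ω}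
    (h : HasWeakDiv Ω v g) : weakDiv Ω v = g := by
  have hex : ∃ g : L2 Ω, HasWeakDiv Ω v g := ⟨g, h⟩
  have h' : HasWeakDiv Ω v (weakDiv Ω v) := by
    rw [weakDiv, dif_pos hex]
    exact hex.choose_spec
  have hloc : ∀ f : L2 Ω, LocallyIntegrableOn f Ω volume := fun f =>
    locallyIntegrableOn_of_locallyIntegrable_restrict
      ((Lp.memLp f).locallyIntegrable (by norm_num))
  have key : ∀ᵐ x ∂volume, x ∈ Ω → weakDiv Ω v x - g x = 0 := by
    refine hΩ.ae_eq_zero_of_integral_contDiff_smul_eq_zero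
      (f := fun x => weakDiv Ω v x - g x) ((hloc _).sub (hloc _)) ?_
    intro ψ hψ hc hs
    have hzero : ∀ x, x ∉ Ω → ψ x • (weakDiv Ω v x - g x) = 0 := fun x hx => by
      rw [image_eq_zero_of_notMem_tsupport fun hx' => hx (hs hx'), zero_smul]
    rw [← setIntegral_eq_integral_of_forall_compl_eq_zero hzero]
    have hint : ∀ f : L2 Ω, Integrable (fun x => f x * ψ x) (volume.restrict Ω) := fun f => by
      have := ((Lp.memLp f).locallyIntegrable (by norm_num)).integrable_smul_right_of_hasCompactSupport
        hψ.continuous hc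
      simpa using this
    have e1 := h ψ hψ hc hs
    have e2 := h' ψ hψ hc hs
    have : ∫ x in Ω, ψ x • (weakDiv Ω v x - g x)
        = (∫ x in Ω, weakDiv Ω v x * ψ x) - ∫ x in Ω, g x * ψ x := by
      rw [← integral_sub (hint _) (hint _)]
      congr 1
      ext x
      simp only [smul_eq_mul]
      ring
    rw [this]
    linarith
  refine Lp.ext ?_
  filter_upwards [(ae_restrict_iff' hΩ.measurableSet).2 key] with x hx
  linarith

/-- `H₀(div, Ω)`: the fields in `H(div, Ω)` with vanishing normal trace. The normal trace is the
functional `ψ ↦ ∫_Ω v · ∇ψ + ∫_Ω (div v) ψ`; it is tested with restrictions to `Ω` of functions in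
`C_c^∞(ℝ^d)`, which are dense in `H¹(Ω)` for a Lipschitz domain. Equivalently, the extension of `v`
by zero belongs to `H(div, ℝ^d)`, and its divergence is the extension of `div v` by zero. -/
def H0div {d : ℕ} (Ω : Set (E d)) : Set (L2V Ω) :=
  {v | v ∈ Hdiv Ω ∧ ∀ ψ : E d → ℝ, ContDiff ℝ ∞ ψ → HasCompactSupport ψ →
    (∫ x in Ω, fderiv ℝ ψ x (v x)) + ∫ x in Ω, weakDiv Ω v x * ψ x = 0}

/-- The norm of `H(div, Ω)`. -/
def hdivNorm {d : ℕ} (Ω : Set (E d)) (v : L2V Ω) : ℝ :=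
  Real.sqrt (‖v‖ ^ 2 + ‖weakDiv Ω v‖ ^ 2)

/-- `L²₀(Ω)`: square-integrable functions with mean zero. -/
def L20 {d : ℕ} (Ω : Set (E d)) : Set (L2 Ω) := {q | ∫ x in Ω, q x = 0}

/-- The bilinear form `b(v, q) = (div v, q)_{L²(Ω)}`. -/
def b {d : ℕ} (Ω : Set (E d)) (v : L2V Ω) (q : L2 Ω) : ℝ := ⟪weakDiv Ω v, q⟫

/-- `g` is the weak gradient of `φ` in `Ω`; so `φ ∈ H¹(Ω)` means that such a `g` exists. -/
def HasWeakGrad {d : ℕ} (Ω : Set (E d)) (φ : L2 Ω) (g : L2V Ω) : Prop :=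
  ∀ η : E d → ℝ, ContDiff ℝ ∞ η → HasCompactSupport η → tsupport η ⊆ Ω → ∀ i : Fin d,
    ∫ x in Ω, φ x * fderiv ℝ η x (EuclideanSpace.single i 1) = - ∫ x in Ω, g x i * η x

/-- The constants `C ≥ 0` for which `‖φ‖ ≤ C ‖∇φ‖` holds on `H¹(Ω) ∩ L²₀(Ω)`. -/
def poincareWirtingerSet {d : ℕ} (Ω : Set (E d)) : Set ℝ :=
  {C | 0 ≤ C ∧ ∀ (φ : L2 Ω) (g : L2V Ω), HasWeakGrad Ω φ g → φ ∈ L20 Ω → ‖φ‖ ≤ C * ‖g‖}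

/-- The optimal Poincaré–Wirtinger constant `C_Ω`. -/
def poincareWirtingerConst {d : ℕ} (Ω : Set (E d)) : ℝ := sInf (poincareWirtingerSet Ω)

/-! ### Meshes and finite element spaces -/

/-- A conforming simplicial mesh of `Ω`. A cell is given by the set of its `d + 1` affinely
independent vertices; the closed simplex is the convex hull. Two cells are disjoint or meet exactly
in the common subsimplex spanned by their common vertices. -/
structure Mesh {d : ℕ} (Ω : Set (E d)) where
  cells : Finset (Finset (E d))
  card_cell : ∀ T ∈ cells, T.card = d + 1
  indep : ∀ T ∈ cells, AffineIndependent ℝ (fun p : T => (p : E d))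
  cover : ⋃ T ∈ cells, convexHull ℝ (T : Set (E d)) = closure Ω
  conforming : ∀ T ∈ cells, ∀ T' ∈ cells,
    convexHull ℝ (T : Set (E d)) ∩ convexHull ℝ (T' : Set (E d)) =
      convexHull ℝ ((T : Set (E d)) ∩ (T' : Set (E d)))

/-- The closed simplex with the given vertices. -/
def simplex {d : ℕ} (T : Finset (E d)) : Set (E d) := convexHull ℝ (T : Set (E d))

/-- The diameter `H_T`. -/
def cellDiam {d : ℕ} (T : Finset (E d)) : ℝ := Metric.diam (simplex T)

/-- The radius of the largest ball contained in the simplex. -/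
def inradius {d : ℕ} (T : Finset (E d)) : ℝ :=
  sSup {r : ℝ | 0 ≤ r ∧ ∃ x, Metric.closedBall x r ⊆ simplex T}

variable {d : ℕ} {Ω : Set (E d)}

/-- The mesh size `H = max_T H_T`. -/
def Mesh.size (𝒯 : Mesh Ω) : ℝ := ⨆ T : 𝒯.cells, cellDiam T.1

/-- Quasi-uniformity with constant `γ`: `min_T H_T ≥ γ H`. -/
def Mesh.QuasiUniform (𝒯 : Mesh Ω) (γ : ℝ) : Prop := ∀ T ∈ 𝒯.cells, γ * 𝒯.size ≤ cellDiam T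

/-- Shape regularity with constant `γ`: `max_T H_T / diam B_T ≤ γ`, where `B_T` is the largest
ball contained in `T`. -/
def Mesh.ShapeRegular (𝒯 : Mesh Ω) (γ : ℝ) : Prop :=
  ∀ T ∈ 𝒯.cells, cellDiam T / (2 * inradius T) ≤ γ

/-- The element patch `N¹(T)`: the union of all mesh elements meeting `T`. -/
def Mesh.patch (𝒯 : Mesh Ω) (T : Finset (E d)) : Set (E d) :=
  ⋃ K ∈ {K : Finset (E d) | K ∈ 𝒯.cells ∧ (simplex K ∩ simplex T).Nonempty}, simplex K

/-- The value at `x` of a polynomial in `d` variables. -/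
def polyVal (p : MvPolynomial (Fin d) ℝ) (x : E d) : ℝ := MvPolynomial.eval (fun i => x i) p

/-- `Q_H^k`: functions in `L²(Ω)` that are piecewise polynomials of degree at most `k`. -/
def QH (𝒯 : Mesh Ω) (k : ℕ) : Set (L2 Ω) :=
  {q | ∀ T ∈ 𝒯.cells, ∃ p : MvPolynomial (Fin d) ℝ, p.totalDegree ≤ k ∧
    ∀ᵐ x ∂(volume.restrict Ω), x ∈ simplex T → q x = polyVal p x}

/-- The piecewise Raviart–Thomas space: on every `T` the field lies in `[ℙ_k]^d + x ℙ_k`. -/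
def RT (𝒯 : Mesh Ω) (k : ℕ) : Set (L2V Ω) :=
  {v | ∀ T ∈ 𝒯.cells, ∃ (p : Fin d → MvPolynomial (Fin d) ℝ) (r : MvPolynomial (Fin d) ℝ),
    (∀ i, (p i).totalDegree ≤ k) ∧ r.totalDegree ≤ k ∧
    ∀ᵐ x ∂(volume.restrict Ω), x ∈ simplex T →
      ∀ i, v x i = polyVal (p i) x + x i * polyVal r x}

/-- `V_H^k`: the `H(div)`-conforming Raviart–Thomas space with vanishing normal trace. -/
def VH (𝒯 : Mesh Ω) (k : ℕ) : Set (L2V Ω) := RT 𝒯 k ∩ H0div Ω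

/-- The inf-sup constant of `b` on the pair `(V_H^k, Q_H^k ∩ L²₀(Ω))`, with values in the extended
reals, so that an infimum over the empty set is `∞` and a supremum over it is `-∞`. -/
def infSup (𝒯 : Mesh Ω) (k : ℕ) : EReal :=
  ⨅ q ∈ (QH 𝒯 k ∩ L20 Ω) \ {0}, ⨆ v ∈ VH 𝒯 k \ {0},
    ((b Ω v q / (‖q‖ * hdivNorm Ω v) : ℝ) : EReal)

/-! ### Stable commuting quasi-interpolation -/

/-- `p` is the `L²`-orthogonal projection of `f` onto `K`. -/
def IsL2Projection (K : Set (L2 Ω)) (f p : L2 Ω) : Prop := p ∈ K ∧ ∀ r ∈ K, ⟪f - p, r⟫ = 0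

/-- `‖f‖²_{L²(S ∩ Ω)}`. -/
def normSqOn {F : Type} [NormedAddCommGroup F] (S : Set (E d))
    (f : Lp F 2 (volume.restrict Ω)) : ℝ := ∫ x in S ∩ Ω, ‖f x‖ ^ 2

/-- `π : H₀(div, Ω) → V_H^k` is a projection onto `V_H^k` that is locally stable with constant
`C` and commutes with the `L²`-projection onto `Q_H^k`. -/
structure IsStableCommutingProjection (𝒯 : Mesh Ω) (k : ℕ) (C : ℝ)
    (π : H0div Ω → H0div Ω) : Prop where
  maps_to : ∀ v, (π v : L2V Ω) ∈ VH 𝒯 k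
  stable : ∀ v : H0div Ω, ∀ T ∈ 𝒯.cells,
    normSqOn (simplex T) (π v : L2V Ω)
        + 𝒯.size ^ 2 * normSqOn (simplex T) (weakDiv Ω (π v : L2V Ω)) ≤
      C * (normSqOn (𝒯.patch T) (v : L2V Ω)
        + 𝒯.size ^ 2 * normSqOn (𝒯.patch T) (weakDiv Ω (v : L2V Ω)))
  surjective : ∀ w : H0div Ω, (w : L2V Ω) ∈ VH 𝒯 k → ∃ v, π v = w
  idempotent : ∀ v, π (π v) = π v
  commutes : ∀ v : H0div Ω,
    IsL2Projection (QH 𝒯 k) (weakDiv Ω (v : L2V Ω)) (weakDiv Ω (π v : L2V Ω))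

/-- Global stability of `π` with constant `C`: `‖π v‖² ≤ C (‖v‖² + ‖div v‖²)`. -/
def IsGloballyStable (C : ℝ) (π : H0div Ω → H0div Ω) : Prop :=
  ∀ v : H0div Ω, ‖(π v : L2V Ω)‖ ^ 2 ≤ C * (‖(v : L2V Ω)‖ ^ 2 + ‖weakDiv Ω (v : L2V Ω)‖ ^ 2)

end RTInfSup

end

/-! # Inf-sup stability of the Raviart–Thomas pair -/

noncomputable section


namespace RTInfSup

/-! ### A dual existence lemma -/

/-! If every mean-zero `q` in the discrete space is the divergence of some `v` in `VH` with `‖v‖² ≤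
c ‖q‖²`, then testing with this `v` bounds the inf-sup constant below by `(1 + c)^(-1/2)`
(`le_infSup`). So the task is to build bounded right inverses of the divergence, and each global one
comes from a Poincaré inequality by duality (`exists_inner_eq_of_abs_le`): a functional bounded by
the norm of a gradient is represented by a field, or by a family of fluxes, with the same bound.

With a commuting projection at hand, the continuous problem suffices. The functional `φ ↦ ⟪q, φ⟫` on
`H¹(Ω)` is bounded by `C_Ω ‖q‖ ‖∇φ‖`, so it is represented by a field whose negative has divergence
`q` and vanishing normal trace (`exists_H0div_of_mem_L20`). Applying `π` keeps the divergence, since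
`q` is already discrete. Global stability of `π` follows by summing the local bounds, because a
volume comparison limits how many cells meet a given cell.

The uniform bound over admissible meshes presupposes no projection; a discrete right inverse is
built directly (`exists_field`). The cell means of `q` are produced by lowest-order fields with
fluxes through the interior faces, and these fluxes come by duality from a Poincaré inequality for
piecewise constants. What remains of `q` has mean zero on each cell and is the divergence of a field
with zero normal trace on that cell (`exists_local_field`); in barycentric coordinates this is
polynomial algebra, with constants that do not depend on the shape of the simplex.

Both Poincaré inequalities come from one nonlocal estimate (`linked_self`): the integral of `|f x -
f y|²` over `Ω × Ω` is at most a constant times `m^(d+2)` times the same quantity restricted to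
shifts of length at most `R / m`, uniformly in `m`. On a convex set this is subdivision of a segment
into `m` equal steps. The hyperplanes that carry the boundary cut `Ω` into finitely many convex
pieces up to a null set, and connectedness links the pieces through chains of balls. Taking `m = 1`
and weak gradients gives the Poincaré–Wirtinger inequality; taking `m` of order `R / H` and
piecewise constants gives the discrete one, where a short generic segment changes cells only through
common faces. -/

/-- If a linear functional `ℓ` is bounded by `C ‖A x‖`, then `ℓ = ⟪y, A ·⟫` with `‖y‖ ≤ C`. -/
theorem exists_inner_eq_of_abs_le {X Y : Type*} [AddCommGroup X] [Module ℝ X]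
    [NormedAddCommGroup Y] [InnerProductSpace ℝ Y] [CompleteSpace Y]
    (A : X →ₗ[ℝ] Y) (l : X →ₗ[ℝ] ℝ) {C : ℝ} (hC : 0 ≤ C) (h : ∀ x, |l x| ≤ C * ‖A x‖) :
    ∃ y : Y, ‖y‖ ≤ C ∧ ∀ x, ⟪y, A x⟫ = l x := by
  have hker : LinearMap.ker A ≤ LinearMap.ker l := fun x hx => by
    have := h x
    rw [LinearMap.mem_ker.1 hx, norm_zero, mul_zero] at this
    exact LinearMap.mem_ker.2 (abs_nonpos_iff.1 this)
  let f₀ : LinearMap.range A →ₗ[ℝ] ℝ :=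
    ((LinearMap.ker A).liftQ l hker).comp A.quotKerEquivRange.symm.toLinearMap
  have hf₀ : ∀ x, f₀ ⟨A x, LinearMap.mem_range_self A x⟩ = l x := fun x => by
    have : A.quotKerEquivRange.symm ⟨A x, LinearMap.mem_range_self A x⟩
        = (LinearMap.ker A).mkQ x := LinearMap.quotKerEquivRange_symm_apply_image A x _
    simp only [f₀, LinearMap.comp_apply, LinearEquiv.coe_coe, this]
    simp
  have hb : ∀ z, ‖f₀ z‖ ≤ C * ‖z‖ := by
    rintro ⟨z, x, rfl⟩
    rw [hf₀]
    exact h x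
  -- The range of `A` need not be closed, so Hahn–Banach extends the functional to `Y` before Riesz
  -- representation is applied.
  obtain ⟨g, hg, hgn⟩ := exists_extension_norm_eq (LinearMap.range A) (f₀.mkContinuous C hb)
  refine ⟨(InnerProductSpace.toDual ℝ Y).symm g, ?_, fun x => ?_⟩
  · rw [LinearIsometryEquiv.norm_map, hgn]
    exact LinearMap.mkContinuous_norm_le _ hC _
  · rw [InnerProductSpace.toDual_symm_apply]
    have := hg ⟨A x, LinearMap.mem_range_self A x⟩
    simp only [LinearMap.mkContinuous_apply] at this
    rw [this, hf₀]

/-! ### A nonlocal Poincaré inequality -/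

variable {d : ℕ}

/-- The integral of `|f x - f y|²` over `A × B`. -/
noncomputable def oscInt (f : E d → ℝ) (A B : Set (E d)) : ENNReal :=
  ∫⁻ x in A, ∫⁻ y in B, ‖f x - f y‖ₑ ^ 2

/-- The integral of `|f (x + h) - f x|²` over all segments `[x, x + h] ⊆ Ω` with `‖h‖ ≤ δ`. -/
noncomputable def shiftInt (Ω : Set (E d)) (δ : ℝ) (f : E d → ℝ) : ENNReal :=
  ∫⁻ h in Metric.closedBall (0 : E d) δ, ∫⁻ x in {x | segment ℝ x (x + h) ⊆ Ω},
    ‖f (x + h) - f x‖ₑ ^ 2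

theorem enorm_sub_rev' (a b : ℝ) : ‖a - b‖ₑ = ‖b - a‖ₑ := by
  rw [← enorm_neg, neg_sub]

theorem measurable_oscInt_inner {f : E d → ℝ} (hf : Measurable f) (B : Set (E d)) :
    Measurable fun x => ∫⁻ y in B, ‖f x - f y‖ₑ ^ 2 := by
  apply Measurable.lintegral_prod_right'
    (f := fun p : E d × E d => ‖f p.1 - f p.2‖ₑ ^ 2)
  fun_prop

theorem oscInt_mono (f : E d → ℝ) {A A' B B' : Set (E d)} (hA : A ⊆ A') (hB : B ⊆ B') :
    oscInt f A B ≤ oscInt f A' B' :=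
  (lintegral_mono_set hA).trans (lintegral_mono fun _ => lintegral_mono_set hB)

theorem oscInt_comm {f : E d → ℝ} (hf : Measurable f) (A B : Set (E d)) :
    oscInt f A B = oscInt f B A := by
  unfold oscInt
  rw [lintegral_lintegral_swap]
  · exact lintegral_congr fun y => lintegral_congr fun x => by rw [enorm_sub_rev']
  · apply Measurable.aemeasurable
    change Measurable fun p : E d × E d => ‖f p.1 - f p.2‖ₑ ^ 2
    fun_prop

theorem enorm_sub_sq_le (a b c : ℝ) :
    ‖a - c‖ₑ ^ 2 ≤ 2 * (‖a - b‖ₑ ^ 2 + ‖b - c‖ₑ ^ 2) := by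
  have h1 : ∀ t : ℝ, ‖t‖ₑ ^ 2 = ENNReal.ofReal (t ^ 2) := fun t => by
    rw [Real.enorm_eq_ofReal_abs, ← ENNReal.ofReal_pow (abs_nonneg _), sq_abs]
  rw [h1, h1, h1, ← ENNReal.ofReal_add (by positivity) (by positivity),
    show (2 : ENNReal) = ENNReal.ofReal 2 by norm_num, ← ENNReal.ofReal_mul (by norm_num)]
  apply ENNReal.ofReal_le_ofReal
  nlinarith [sq_nonneg (a - b - (b - c))]

/-- An averaged triangle inequality: insert an intermediate point `z ∈ B` between `x` and `y` and
integrate over `z`. -/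
theorem volume_mul_oscInt_le {f : E d → ℝ} (hf : Measurable f) (A B C : Set (E d)) :
    volume B * oscInt f A C ≤ 2 * (volume C * oscInt f A B + volume A * oscInt f B C) := by
  have m1 : Measurable fun p : E d × E d => ‖f p.1 - f p.2‖ₑ ^ 2 := by fun_prop
  calc volume B * oscInt f A C = ∫⁻ x in A, ∫⁻ y in C, ∫⁻ _z in B, ‖f x - f y‖ₑ ^ 2 := by
        rw [oscInt, ← lintegral_const_mul]
        · congr 1; ext x
          rw [← lintegral_const_mul]
          · congr 1; ext y
            simp [mul_comm]
          · fun_prop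
        · exact measurable_oscInt_inner hf C
    _ ≤ ∫⁻ x in A, ∫⁻ y in C, ∫⁻ z in B, 2 * (‖f x - f z‖ₑ ^ 2 + ‖f z - f y‖ₑ ^ 2) := by
        gcongr
        exact enorm_sub_sq_le _ _ _
    _ = ∫⁻ x in A, (2 * (volume C * ∫⁻ z in B, ‖f x - f z‖ₑ ^ 2) + 2 * oscInt f B C) := by
        congr 1; ext x
        have : ∀ y, ∫⁻ z in B, 2 * (‖f x - f z‖ₑ ^ 2 + ‖f z - f y‖ₑ ^ 2)
            = 2 * (∫⁻ z in B, ‖f x - f z‖ₑ ^ 2) + 2 * ∫⁻ z in B, ‖f z - f y‖ₑ ^ 2 := fun y => by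
          rw [lintegral_const_mul _ (by fun_prop), lintegral_add_left (by fun_prop), mul_add]
        simp_rw [this]
        rw [lintegral_add_left (by fun_prop), lintegral_const, lintegral_const_mul,
          oscInt_comm hf B C]
        · congr 1
          · simp only [MeasurableSet.univ, Measure.restrict_apply, univ_inter]; ring
          · rw [oscInt]
            congr 1
            exact lintegral_congr fun y => lintegral_congr fun x => by rw [enorm_sub_rev']
        · simp_rw [← enorm_neg (f _ - f _), neg_sub]
          simpa [neg_sub] using measurable_oscInt_inner hf B
    _ = 2 * (volume C * oscInt f A B + volume A * oscInt f B C) := by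
        rw [lintegral_add_right _ measurable_const, lintegral_const_mul, lintegral_const_mul,
          lintegral_const]
        · simp only [MeasurableSet.univ, Measure.restrict_apply, univ_inter, oscInt]; ring
        · exact measurable_oscInt_inner hf B
        · exact (measurable_oscInt_inner hf B).const_mul _

/-- By compactness of `[0, 1]`, a segment inside `Ω` stays inside under small perturbations. This
makes the domains of integration in `shiftInt` measurable. -/
theorem isOpen_setOf_segment_subset {Ω : Set (E d)} (hΩ : IsOpen Ω) :
    IsOpen {p : E d × E d | segment ℝ p.1 (p.1 + p.2) ⊆ Ω} := by
  have h : {p : E d × E d | segment ℝ p.1 (p.1 + p.2) ⊆ Ω}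
      = {p | ∀ t ∈ Icc (0 : ℝ) 1, p.1 + t • p.2 ∈ Ω} := by
    ext p
    simp only [mem_ofPred_eq, segment_eq_image', image_subset_iff, add_sub_cancel_left]
    rfl
  rw [h]
  rw [isOpen_iff_eventually]
  intro p hp
  refine isCompact_Icc.eventually_forall_of_forall_eventually (x₀ := p) fun t ht => ?_
  have hc : Continuous fun z : (E d × E d) × ℝ => z.1.1 + z.2 • z.1.2 := by fun_prop
  exact (hΩ.preimage hc).mem_nhds (hp t ht)

theorem isOpen_setOf_segment_subset_right {Ω : Set (E d)} (hΩ : IsOpen Ω) (h : E d) :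
    IsOpen {x : E d | segment ℝ x (x + h) ⊆ Ω} :=
  (isOpen_setOf_segment_subset hΩ).preimage (f := fun x => (x, h)) (by fun_prop)

end RTInfSup


/-! ### Oscillation over convex sets: subdividing a shift -/

namespace RTInfSup
variable {d : ℕ}

theorem enorm_sq_eq_ofReal (t : ℝ) : ‖t‖ₑ ^ 2 = ENNReal.ofReal (t ^ 2) := by
  rw [Real.enorm_eq_ofReal_abs, ← ENNReal.ofReal_pow (abs_nonneg _), sq_abs]

theorem enorm_sq_telescope_le (u : ℕ → ℝ) (m : ℕ) :
    ‖u m - u 0‖ₑ ^ 2 ≤ m * ∑ i ∈ Finset.range m, ‖u (i + 1) - u i‖ₑ ^ 2 := by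
  simp_rw [enorm_sq_eq_ofReal]
  rw [← ENNReal.ofReal_sum_of_nonneg (fun _ _ => by positivity), ← ENNReal.ofReal_natCast,
    ← ENNReal.ofReal_mul (by positivity)]
  apply ENNReal.ofReal_le_ofReal
  rw [← Finset.sum_range_sub]
  simpa using sq_sum_le_card_mul_sum_sq (s := Finset.range m) (f := fun i => u (i + 1) - u i)

theorem lintegral_comp_inv_smul (g : E d → ENNReal) {m : ℕ} (hm : 0 < m) :
    ∫⁻ h, g ((m : ℝ)⁻¹ • h) = (m : ENNReal) ^ d * ∫⁻ h, g h := by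
  have hm' : ((m : ℝ)⁻¹) ≠ 0 := by positivity
  have e : MeasurableEmbedding fun h : E d => (m : ℝ)⁻¹ • h :=
    (Homeomorph.smulOfNeZero _ hm').measurableEmbedding
  rw [← e.lintegral_map, Measure.map_addHaar_smul volume hm', lintegral_smul_measure]
  congr 1
  rw [finrank_euclideanSpace_fin, inv_pow, inv_inv, abs_of_nonneg (by positivity),
    ENNReal.ofReal_pow (by positivity), ENNReal.ofReal_natCast]

/-- Substituting `y = x + h` turns the oscillation into an integral over shifts `h`. Each shift is
split into `m` steps of `h / m`, which stay in `U` by convexity. Cauchy–Schwarz and the number of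
steps give one factor `m` each, and rescaling `h` gives `m ^ d`. -/
theorem oscInt_convex_le {Ω U : Set (E d)} (hU : IsOpen U) (hc : Convex ℝ U) (hUΩ : U ⊆ Ω)
    {R : ℝ} (hR : ∀ x ∈ Ω, ∀ y ∈ Ω, dist x y ≤ R) {f : E d → ℝ} (hf : Measurable f)
    {m : ℕ} (hm : 0 < m) :
    oscInt f U U ≤ (m : ENNReal) ^ (d + 2) * shiftInt Ω (R / m) f := by
  set S : E d → Set (E d) := fun h => {x | x ∈ U ∧ x + h ∈ U} with hS
  have hSm : ∀ h, MeasurableSet (S h) := fun h =>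
    (hU.inter (hU.preimage (f := fun x => x + h) (by fun_prop))).measurableSet
  set g : E d → ENNReal := fun h => ∫⁻ x in S h, ‖f (x + h) - f x‖ₑ ^ 2 with hg
  have h1 : oscInt f U U = ∫⁻ h, g h := by
    have hin : ∀ x h, (S h).indicator (fun x => ‖f (x + h) - f x‖ₑ ^ 2) x
        = U.indicator (fun x => U.indicator (fun y => ‖f y - f x‖ₑ ^ 2) (x + h)) x := by
      intro x h
      by_cases hx : x ∈ U <;> by_cases hy : x + h ∈ U <;> simp [hS, hx, hy, indicator]
    have : ∀ h, g h = ∫⁻ x, U.indicator (fun x => U.indicator (fun y => ‖f y - f x‖ₑ ^ 2) (x + h)) x := by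
      intro h
      rw [hg]
      simp only
      rw [← lintegral_indicator (hSm h)]
      exact lintegral_congr fun x => hin x h
    simp_rw [this]
    rw [lintegral_lintegral_swap]
    · unfold oscInt
      rw [← lintegral_indicator hU.measurableSet]
      refine lintegral_congr fun x => ?_
      by_cases hx : x ∈ U
      · simp only [hx, indicator_of_mem]
        rw [lintegral_add_left_eq_self (fun y => U.indicator (fun y => ‖f y - f x‖ₑ ^ 2) y),
          lintegral_indicator hU.measurableSet]
        exact lintegral_congr fun y => by rw [enorm_sub_rev']
      · simp [hx]
    · apply Measurable.aemeasurable
      have : (Function.uncurry fun (h x : E d) =>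
          U.indicator (fun x => U.indicator (fun y => ‖f y - f x‖ₑ ^ 2) (x + h)) x)
          = ({p : E d × E d | p.2 ∈ U ∧ p.2 + p.1 ∈ U}).indicator
            (fun p => ‖f (p.2 + p.1) - f p.2‖ₑ ^ 2) := by
        ext ⟨h, x⟩
        by_cases hx : x ∈ U <;> by_cases hy : x + h ∈ U <;> simp [hx, hy, indicator]
      rw [this]
      refine Measurable.indicator (by fun_prop) ?_
      exact ((hU.preimage (f := fun p : E d × E d => p.2) (by fun_prop)).inter
        (hU.preimage (f := fun p : E d × E d => p.2 + p.1) (by fun_prop))).measurableSet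
  have h2 : ∀ h, g h ≤ (m : ENNReal) ^ 2 * g ((m : ℝ)⁻¹ • h) := by
    intro h
    set k := (m : ℝ)⁻¹ • h with hk
    have hmk : (m : ℝ) • k = h := by
      rw [hk, smul_smul, mul_inv_cancel₀ (by positivity), one_smul]
    have hmem : ∀ x ∈ S h, ∀ i ≤ m, x + (i : ℝ) • k ∈ U := by
      intro x hx i hi
      have hi1 : (i : ℝ) / m ≤ 1 := by
        rw [div_le_one (by positivity)]; exact_mod_cast hi
      have := hc.add_smul_mem hx.1 hx.2 (t := (i : ℝ) / m) ⟨by positivity, hi1⟩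
      rwa [hk, smul_smul, ← div_eq_mul_inv]
    calc g h = ∫⁻ x in S h, ‖f (x + h) - f x‖ₑ ^ 2 := rfl
      _ ≤ ∫⁻ x in S h, m * ∑ i ∈ Finset.range m,
            ‖f (x + ((i + 1 : ℕ) : ℝ) • k) - f (x + (i : ℝ) • k)‖ₑ ^ 2 := by
          refine lintegral_mono fun x => ?_
          have := enorm_sq_telescope_le (fun i => f (x + (i : ℝ) • k)) m
          simpa [hmk] using this
      _ = m * ∑ i ∈ Finset.range m, ∫⁻ x in S h,
            ‖f (x + ((i + 1 : ℕ) : ℝ) • k) - f (x + (i : ℝ) • k)‖ₑ ^ 2 := by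
          rw [lintegral_const_mul _ (by fun_prop), lintegral_finsetSum _ (fun i _ => by fun_prop)]
      _ ≤ m * ∑ i ∈ Finset.range m, g k := by
          gcongr with i hi
          have hi' := Finset.mem_range.1 hi
          rw [hg]
          simp only
          -- The translation by `i • k` carries `S h` into `S k`, so each of the `m` steps
          -- contributes at most `g k`.
          rw [← lintegral_indicator (hSm k), ← lintegral_indicator (hSm h),
            ← lintegral_add_right_eq_self ((S k).indicator _) ((i : ℝ) • k)]
          refine lintegral_mono fun x => ?_
          by_cases hx : x ∈ S h
          · have e : x + (i : ℝ) • k + k = x + ((i + 1 : ℕ) : ℝ) • k := by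
              push_cast; rw [add_smul, one_smul, add_assoc]
            have : x + (i : ℝ) • k ∈ S k :=
              ⟨hmem x hx i hi'.le, by rw [e]; exact hmem x hx (i + 1) hi'⟩
            rw [indicator_of_mem hx, indicator_of_mem this, e]
          · rw [indicator_of_notMem hx]; exact zero_le
      _ = (m : ENNReal) ^ 2 * g k := by
          rw [Finset.sum_const, Finset.card_range, nsmul_eq_mul, sq, mul_assoc]
  -- Two points of `Ω` are at distance at most `R`, so longer shifts do not contribute.
  have h3 : ∀ h, h ∉ Metric.closedBall (0 : E d) R → g h = 0 := by
    intro h hh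
    have : S h = ∅ := by
      rw [eq_empty_iff_forall_notMem]
      rintro x ⟨hx, hy⟩
      apply hh
      have := hR _ (hUΩ hy) _ (hUΩ hx)
      simpa [dist_eq_norm] using this
    simp [hg, this]
  set B := Metric.closedBall (0 : E d) (R / m) with hB
  calc oscInt f U U = ∫⁻ h, g h := h1
    _ ≤ ∫⁻ h, (m : ENNReal) ^ 2 * B.indicator g ((m : ℝ)⁻¹ • h) := by
        refine lintegral_mono fun h => ?_
        by_cases hh : h ∈ Metric.closedBall (0 : E d) R
        · have : (m : ℝ)⁻¹ • h ∈ B := by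
            simp only [hB, mem_closedBall_zero_iff] at hh ⊢
            rw [norm_smul, norm_inv, Real.norm_natCast, div_eq_inv_mul]
            gcongr
          simp only [indicator_of_mem this]
          exact h2 h
        · rw [h3 h hh]; exact zero_le
    _ = (m : ENNReal) ^ 2 * ((m : ENNReal) ^ d * ∫⁻ h in B, g h) := by
        rw [lintegral_const_mul', lintegral_comp_inv_smul _ hm, lintegral_indicator]
        · exact measurableSet_closedBall
        · finiteness
    _ ≤ (m : ENNReal) ^ (d + 2) * shiftInt Ω (R / m) f := by
        rw [← mul_assoc, ← pow_add, add_comm 2 d]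
        unfold shiftInt
        gcongr with h
        refine lintegral_mono_set fun x hx => ?_
        exact (hc.segment_subset hx.1 hx.2).trans hUΩ

end RTInfSup


/-! ### Chaining oscillation bounds through a connected domain -/

namespace RTInfSup
variable {d : ℕ}

/-- The oscillation over `A × B` is controlled by the rescaled short shifts inside `Ω`, uniformly
in the scale `R / m`. -/
def Linked (Ω : Set (E d)) (R : ℝ) (A B : Set (E d)) : Prop :=
  ∃ K : ENNReal, K ≠ ⊤ ∧ ∀ m : ℕ, 0 < m → ∀ f : E d → ℝ, Measurable f →
    oscInt f A B ≤ K * ((m : ENNReal) ^ (d + 2) * shiftInt Ω (R / m) f)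

namespace Linked
variable {Ω A B C A' B' : Set (E d)} {R : ℝ}

theorem mono (h : Linked Ω R A' B') (hA : A ⊆ A') (hB : B ⊆ B') : Linked Ω R A B := by
  obtain ⟨K, hK, h⟩ := h
  exact ⟨K, hK, fun m hm f hf => (oscInt_mono f hA hB).trans (h m hm f hf)⟩

theorem symm (h : Linked Ω R A B) : Linked Ω R B A := by
  obtain ⟨K, hK, h⟩ := h
  exact ⟨K, hK, fun m hm f hf => (oscInt_comm hf B A).trans_le (h m hm f hf)⟩

/-- Divide `volume_mul_oscInt_le` by the measure of `B`; hence the intermediate set must have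
positive finite measure. The new constant does not involve `m`. -/
theorem trans (h : Linked Ω R A B) (h' : Linked Ω R B C) (hB0 : volume B ≠ 0)
    (hB : volume B ≠ ⊤) (hA : volume A ≠ ⊤) (hC : volume C ≠ ⊤) : Linked Ω R A C := by
  obtain ⟨K, hK, h⟩ := h
  obtain ⟨K', hK', h'⟩ := h'
  refine ⟨(volume B)⁻¹ * (2 * (volume C * K + volume A * K')), ?_, fun m hm f hf => ?_⟩
  · have := ENNReal.inv_ne_top.2 hB0
    finiteness
  · set J := (m : ENNReal) ^ (d + 2) * shiftInt Ω (R / m) f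
    calc oscInt f A C = (volume B)⁻¹ * (volume B * oscInt f A C) := by
          rw [← mul_assoc, ENNReal.inv_mul_cancel hB0 hB, one_mul]
      _ ≤ (volume B)⁻¹ * (2 * (volume C * (K * J) + volume A * (K' * J))) := by
          refine mul_le_mul' le_rfl ((volume_mul_oscInt_le hf A B C).trans ?_)
          gcongr
          · exact h m hm f hf
          · exact h' m hm f hf
      _ = _ := by ring

theorem of_convex {U : Set (E d)} (hU : IsOpen U) (hc : Convex ℝ U) (hUΩ : U ⊆ Ω)
    (hR : ∀ x ∈ Ω, ∀ y ∈ Ω, dist x y ≤ R) : Linked Ω R U U :=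
  ⟨1, by simp, fun m hm f hf => by
    rw [one_mul]; exact oscInt_convex_le hU hc hUΩ hR hf hm⟩

/-- "All open convex subsets of `Ω` around `x` and around `y` are linked" is a relation between
points that is symmetric, transitive (through a ball around the middle point) and true for nearby
points. On a preconnected set it therefore holds for all pairs. -/
theorem of_isConnected (hΩ : IsOpen Ω) (hcon : IsPreconnected Ω) (hb : Bornology.IsBounded Ω)
    (hR : ∀ x ∈ Ω, ∀ y ∈ Ω, dist x y ≤ R) {U V : Set (E d)}
    (hU : IsOpen U) (hUc : Convex ℝ U) (hUΩ : U ⊆ Ω) (hUn : U.Nonempty)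
    (hV : IsOpen V) (hVc : Convex ℝ V) (hVΩ : V ⊆ Ω) (hVn : V.Nonempty) : Linked Ω R U V := by
  have fin : ∀ S ⊆ Ω, volume S ≠ ⊤ := fun S hS => (hb.subset hS).measure_lt_top.ne
  obtain ⟨x, hx⟩ := hUn
  obtain ⟨y, hy⟩ := hVn
  suffices H : ∀ U V : Set (E d), IsOpen U → Convex ℝ U → U ⊆ Ω → x ∈ U → IsOpen V → Convex ℝ V →
      V ⊆ Ω → y ∈ V → Linked Ω R U V from H U V hU hUc hUΩ hx hV hVc hVΩ hy
  refine hcon.induction₂ (fun x y => ∀ U V : Set (E d), IsOpen U → Convex ℝ U → U ⊆ Ω → x ∈ U →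
    IsOpen V → Convex ℝ V → V ⊆ Ω → y ∈ V → Linked Ω R U V) ?_ ?_ ?_ (hUΩ hx) (hVΩ hy)
  · intro x hx
    obtain ⟨ε, hε, hball⟩ := Metric.isOpen_iff.1 hΩ x hx
    refine Filter.Eventually.filter_mono nhdsWithin_le_nhds ?_
    filter_upwards [Metric.ball_mem_nhds x hε] with y hy U V hU hUc hUΩ hxU hV hVc hVΩ hyV
    set B := Metric.ball x ε
    have hB : Linked Ω R B B := of_convex Metric.isOpen_ball (convex_ball x ε) hball hR
    have hU' : Linked Ω R U U := of_convex hU hUc hUΩ hR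
    have hV' : Linked Ω R V V := of_convex hV hVc hVΩ hR
    have h1 : volume (U ∩ B) ≠ 0 :=
      ((hU.inter Metric.isOpen_ball).measure_pos volume ⟨x, hxU, Metric.mem_ball_self hε⟩).ne'
    have h2 : volume (V ∩ B) ≠ 0 :=
      ((hV.inter Metric.isOpen_ball).measure_pos volume ⟨y, hyV, hy⟩).ne'
    have e1 : U ∩ B ⊆ Ω := inter_subset_left.trans hUΩ
    have e2 : V ∩ B ⊆ Ω := inter_subset_left.trans hVΩ
    -- The chain is `U`, `U ∩ B`, `V ∩ B`, `V`; consecutive sets lie in a common convex set, and the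
    -- two middle ones are open and nonempty.
    refine ((hU'.mono le_rfl inter_subset_left).trans
      (hB.mono inter_subset_right inter_subset_right) h1 (fin _ e1) (fin _ hUΩ) (fin _ e2)).trans
      (hV'.mono inter_subset_left le_rfl) h2 (fin _ e2) (fin _ hUΩ) (fin _ hVΩ)
  · intro x y z _ hy _ hxy hyz U V hU hUc hUΩ hxU hV hVc hVΩ hzV
    obtain ⟨ε, hε, hball⟩ := Metric.isOpen_iff.1 hΩ y hy
    refine (hxy U (Metric.ball y ε) hU hUc hUΩ hxU Metric.isOpen_ball (convex_ball y ε) hball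
      (Metric.mem_ball_self hε)).trans
      (hyz (Metric.ball y ε) V Metric.isOpen_ball (convex_ball y ε) hball
      (Metric.mem_ball_self hε) hV hVc hVΩ hzV)
      (Metric.measure_ball_pos volume y hε).ne' (fin _ hball) (fin _ hUΩ) (fin _ hVΩ)
  · intro x y _ _ h U V hU hUc hUΩ hxU hV hVc hVΩ hyV
    exact (h V U hV hVc hVΩ hyV hU hUc hUΩ hxU).symm

theorem biUnion {ι : Type*} (s t : Finset ι) (D : ι → Set (E d)) 
    (h : ∀ i ∈ s, ∀ j ∈ t, Linked Ω R (D i) (D j)) :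
    Linked Ω R (⋃ i ∈ s, D i) (⋃ j ∈ t, D j) := by
  choose! K hK h using h
  refine ⟨∑ i ∈ s, ∑ j ∈ t, K i j, ?_, fun m hm f hf => ?_⟩
  · exact (ENNReal.sum_lt_top.2 fun i hi => ENNReal.sum_lt_top.2 fun j hj => (hK i hi j hj).lt_top).ne
  have sub : ∀ (r : Finset ι) (F : E d → ENNReal), ∫⁻ x in ⋃ i ∈ r, D i, F x
      ≤ ∑ i ∈ r, ∫⁻ x in D i, F x := fun r F => by
    have := lintegral_iUnion_le (fun i : r => D i) F (μ := volume)
    rw [iUnion_subtype] at this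
    refine this.trans_eq ?_
    rw [tsum_fintype]
    exact Finset.sum_coe_sort r (fun i => ∫⁻ x in D i, F x)
  calc oscInt f _ _ ≤ ∑ i ∈ s, ∫⁻ x in D i, ∫⁻ y in ⋃ j ∈ t, D j, ‖f x - f y‖ₑ ^ 2 := sub _ _
    _ ≤ ∑ i ∈ s, ∫⁻ x in D i, ∑ j ∈ t, ∫⁻ y in D j, ‖f x - f y‖ₑ ^ 2 := by
        gcongr with i hi x
        exact sub _ _
    _ = ∑ i ∈ s, ∑ j ∈ t, oscInt f (D i) (D j) := by
        refine Finset.sum_congr rfl fun i hi => ?_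
        rw [lintegral_finsetSum _ fun j _ => measurable_oscInt_inner hf _]
        rfl
    _ ≤ _ := by
        rw [Finset.sum_mul]
        gcongr with i hi
        rw [Finset.sum_mul]
        gcongr with j hj
        exact h i hi j hj m hm f hf

theorem congr_ae (h : Linked Ω R A B) (hA : A =ᵐ[volume] A') (hB : B =ᵐ[volume] B') :
    Linked Ω R A' B' := by
  obtain ⟨K, hK, h⟩ := h
  refine ⟨K, hK, fun m hm f hf => le_of_eq_of_le ?_ (h m hm f hf)⟩
  unfold oscInt
  rw [Measure.restrict_congr_set hA, Measure.restrict_congr_set hB]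

end Linked

/-- The level set of a non-zero linear functional is a null set. -/
theorem volume_hyperplane {a : E d} (ha : a ≠ 0) (c : ℝ) : volume {x : E d | ⟪a, x⟫ = c} = 0 := by
  let S : AffineSubspace ℝ (E d) := (AffineSubspace.mk' c ⊥).comap (innerₛₗ ℝ a).toAffineMap
  have hS : (S : Set (E d)) = {x | ⟪a, x⟫ = c} := by
    ext x
    simp [S, AffineSubspace.mem_mk', sub_eq_zero]
  rw [← hS]
  refine Measure.addHaar_affineSubspace volume S fun h => ?_
  have h0 : (((c + 1) / ⟪a, a⟫) • a) ∈ (S : Set (E d)) := by rw [h]; trivial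
  have haa : ⟪a, a⟫ ≠ 0 := fun h => ha (inner_self_eq_zero.1 h)
  rw [hS] at h0
  simp only [mem_ofPred_eq, inner_smul_right] at h0
  rw [div_mul_cancel₀ _ haa] at h0
  linarith

theorem HasPolygonalBoundary.volume_frontier {Ω : Set (E d)} (h : HasPolygonalBoundary Ω) :
    volume (frontier Ω) = 0 := by
  obtain ⟨A, hA, h⟩ := h
  refine measure_mono_null (t := ⋃ a ∈ A, {x : E d | ⟪a.1, x⟫ = a.2}) (fun x hx => ?_)
    ((measure_biUnion_null_iff A.countable_toSet).2 fun a ha => volume_hyperplane (hA a ha) _)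
  simpa using h x hx

/-- The finitely many hyperplanes containing the boundary divide space into open convex cells. Those
that meet `Ω` lie in `Ω` and fill it up to a null set, and they are linked pairwise by
connectedness. -/
theorem linked_self {Ω : Set (E d)} (hΩ : IsOpen Ω) (hcon : IsPreconnected Ω)
    (hb : Bornology.IsBounded Ω) (hpoly : HasPolygonalBoundary Ω) {R : ℝ}
    (hR : ∀ x ∈ Ω, ∀ y ∈ Ω, dist x y ≤ R) : Linked Ω R Ω Ω := by
  classical
  obtain ⟨A, hA, h⟩ := hpoly
  -- A cell is given by its sign pattern: `t` collects the hyperplanes on whose positive side it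
  -- lies.
  set D : Finset (E d × ℝ) → Set (E d) := fun t =>
    {x | ∀ a ∈ A, (a ∈ t → a.2 < ⟪a.1, x⟫) ∧ (a ∉ t → ⟪a.1, x⟫ < a.2)} with hD
  have hDe : ∀ t, D t = ⋂ a ∈ A, ({x | a ∈ t → a.2 < ⟪a.1, x⟫} ∩ {x | a ∉ t → ⟪a.1, x⟫ < a.2}) := by
    intro t; ext x; simp [hD]
  have hDo : ∀ t, IsOpen (D t) := fun t => by
    rw [hDe]
    refine isOpen_biInter_finset fun a _ => IsOpen.inter ?_ ?_ <;> by_cases hat : a ∈ t <;>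
      simp only [hat, not_true, not_false_iff, forall_true_left, IsEmpty.forall_iff, ofPred_true,
        isOpen_univ]
    · exact isOpen_lt (by fun_prop) (by fun_prop)
    · exact isOpen_lt (by fun_prop) (by fun_prop)
  have hlin : ∀ a : E d, IsLinearMap ℝ (fun x : E d => ⟪a, x⟫) := fun a =>
    ⟨fun x y => inner_add_right _ _ _, fun c x => inner_smul_right _ _ _⟩
  have hDc : ∀ t, Convex ℝ (D t) := fun t => by
    rw [hDe]
    refine convex_iInter₂ fun a _ => Convex.inter ?_ ?_ <;> by_cases hat : a ∈ t <;>
      simp only [hat, not_true, not_false_iff, forall_true_left, IsEmpty.forall_iff, ofPred_true,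
        convex_univ]
    · exact convex_halfSpace_gt (hlin a.1) _
    · exact convex_halfSpace_lt (hlin a.1) _
  -- A cell is connected and misses the frontier of `Ω`, so it cannot leave `Ω`.
  have hDΩ : ∀ t, (D t ∩ Ω).Nonempty → D t ⊆ Ω := fun t ht => by
    refine (hDc t).isPreconnected.subset_of_closure_inter_subset hΩ ht ?_
    rintro x ⟨hx, hxD⟩
    by_contra hxΩ
    obtain ⟨a, ha, hax⟩ := h x ⟨hx, by rwa [hΩ.interior_eq]⟩
    by_cases hat : a ∈ t
    · exact ((hxD a ha).1 hat).ne' hax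
    · exact ((hxD a ha).2 hat).ne hax
  set s := A.powerset.filter fun t => (D t ∩ Ω).Nonempty with hs
  have hsub : ⋃ t ∈ s, D t ⊆ Ω := iUnion₂_subset fun t ht => hDΩ t (Finset.mem_filter.1 ht).2
  have key : Linked Ω R (⋃ t ∈ s, D t) (⋃ t ∈ s, D t) :=
    Linked.biUnion s s D fun i hi j hj => by
      have hi' := (Finset.mem_filter.1 hi).2
      have hj' := (Finset.mem_filter.1 hj).2
      exact Linked.of_isConnected hΩ hcon hb hR (hDo i) (hDc i) (hDΩ i hi') (hi'.mono inter_subset_left)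
        (hDo j) (hDc j) (hDΩ j hj') (hj'.mono inter_subset_left)
  have hae : (⋃ t ∈ s, D t) =ᵐ[volume] Ω := by
    refine Filter.EventuallyLE.antisymm (LE.le.eventuallyLE hsub) ?_
    have hnull : volume (⋃ a ∈ A, {x : E d | ⟪a.1, x⟫ = a.2}) = 0 :=
      (measure_biUnion_null_iff A.countable_toSet).2 fun a ha => volume_hyperplane (hA a ha) _
    filter_upwards [measure_eq_zero_iff_ae_notMem.1 hnull] with x hx hxΩ
    simp only [mem_iUnion, mem_ofPred_eq, not_exists] at hx
    have hxD : x ∈ D (A.filter fun a => a.2 < ⟪a.1, x⟫) := by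
      intro a ha
      refine ⟨fun h => (Finset.mem_filter.1 h).2, fun h => ?_⟩
      have : ¬ a.2 < ⟪a.1, x⟫ := fun h' => h (Finset.mem_filter.2 ⟨ha, h'⟩)
      exact lt_of_le_of_ne (not_lt.1 this) (hx a ha)
    refine mem_iUnion₂.2 ⟨_, Finset.mem_filter.2 ⟨?_, ⟨x, hxD, hxΩ⟩⟩, hxD⟩
    exact Finset.mem_powerset.2 (Finset.filter_subset _ _)
  exact key.congr_ae hae hae

/-- For mean-zero functions the `L²`-norm is bounded by the oscillation. -/
theorem volume_mul_lintegral_sq_le_oscInt {Ω : Set (E d)} (hfin : volume Ω ≠ ⊤) {f : E d → ℝ}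
    (hf : MemLp f 2 (volume.restrict Ω)) (h0 : ∫ x in Ω, f x = 0) :
    volume Ω * ∫⁻ x in Ω, ‖f x‖ₑ ^ 2 ≤ oscInt f Ω Ω := by
  have : IsFiniteMeasure (volume.restrict Ω) := ⟨by simpa using hfin.lt_top⟩
  have hi : Integrable f (volume.restrict Ω) := hf.integrable (by norm_num)
  have hi2 : Integrable (fun x => f x ^ 2) (volume.restrict Ω) := hf.integrable_sq
  rw [oscInt, ← lintegral_const_mul' _ _ hfin]
  refine lintegral_mono fun x => ?_
  have e : ∀ y, (f x - f y) ^ 2 = f x ^ 2 - 2 * f x * f y + f y ^ 2 := fun y => by ring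
  have hie : Integrable (fun y => (f x - f y) ^ 2) (volume.restrict Ω) := by
    simp_rw [e]
    exact ((integrable_const _).sub (hi.const_mul _)).add hi2
  simp_rw [enorm_sq_eq_ofReal]
  rw [← ofReal_integral_eq_lintegral_ofReal hie (Filter.Eventually.of_forall fun y => sq_nonneg _),
    ← ENNReal.ofReal_toReal hfin, ← ENNReal.ofReal_mul ENNReal.toReal_nonneg]
  apply ENNReal.ofReal_le_ofReal
  -- Integrating over `y` gives `|Ω| f(x)² + ∫ f²`: the cross term vanishes since `f` has mean zero,
  -- and the last term is dropped.
  simp_rw [e]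
  rw [integral_add (f := fun y => f x ^ 2 - 2 * f x * f y)
      ((integrable_const _).sub (hi.const_mul _)) hi2, integral_sub (integrable_const _) (hi.const_mul _), integral_const_mul, h0]
  simp only [integral_const, smul_eq_mul, mul_zero, sub_zero, Measure.restrict_apply_univ,
    Measure.real]
  have : 0 ≤ ∫ y in Ω, f y ^ 2 := integral_nonneg fun y => sq_nonneg _
  linarith

end RTInfSup


namespace RTInfSup
variable {d : ℕ}

/-! ### `L²` preliminaries -/

theorem lintegral_enorm_sq_eq {α F : Type*} [MeasurableSpace α] {μ : Measure α}
    [NormedAddCommGroup F] (f : Lp F 2 μ) : ∫⁻ x, ‖f x‖ₑ ^ 2 ∂μ = ENNReal.ofReal (‖f‖ ^ 2) := by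
  have h := eLpNorm_eq_lintegral_rpow_enorm_toReal (μ := μ) (f := f) two_ne_zero ENNReal.ofNat_ne_top
  have h2 : eLpNorm f 2 μ ^ 2 = ∫⁻ x, ‖f x‖ₑ ^ 2 ∂μ := by
    rw [h, ← ENNReal.rpow_natCast, ← ENNReal.rpow_mul]
    simp
  rw [← h2, Lp.norm_def, ENNReal.ofReal_pow ENNReal.toReal_nonneg,
    ENNReal.ofReal_toReal (Lp.eLpNorm_ne_top f)]

theorem integrable_norm_sq {α F : Type*} [MeasurableSpace α] {μ : Measure α}
    [NormedAddCommGroup F] (f : Lp F 2 μ) : Integrable (fun x => ‖f x‖ ^ 2) μ :=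
  (Lp.memLp f).integrable_norm_pow two_ne_zero

theorem integral_norm_sq_eq {α F : Type*} [MeasurableSpace α] {μ : Measure α}
    [NormedAddCommGroup F] (f : Lp F 2 μ) : ∫ x, ‖f x‖ ^ 2 ∂μ = ‖f‖ ^ 2 := by
  have h := ofReal_integral_eq_lintegral_ofReal (integrable_norm_sq f)
    (Filter.Eventually.of_forall fun x => sq_nonneg _)
  have h2 := lintegral_enorm_sq_eq f
  simp_rw [← ofReal_norm, ← ENNReal.ofReal_pow (norm_nonneg _)] at h2
  rw [h2] at h
  exact (ENNReal.ofReal_eq_ofReal_iff (integral_nonneg fun x => sq_nonneg _) (sq_nonneg _)).1 h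

theorem isFiniteMeasure_restrict {Ω : Set (E d)} (hb : Bornology.IsBounded Ω) :
    IsFiniteMeasure ((volume : Measure (E d)).restrict Ω) :=
  ⟨by simpa using hb.measure_lt_top⟩

theorem fderiv_eq_inner_gradient (ψ : E d → ℝ) (x h : E d) : fderiv ℝ ψ x h = ⟪gradient ψ x, h⟫ := by
  rw [gradient, InnerProductSpace.toDual_symm_apply]

theorem continuous_gradient {ψ : E d → ℝ} (hψ : ContDiff ℝ ∞ ψ) : Continuous (gradient ψ) :=
  (InnerProductSpace.toDual ℝ (E d)).symm.continuous.comp (hψ.continuous_fderiv (by simp))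

theorem memLp_of_continuous {Ω : Set (E d)} (hb : Bornology.IsBounded Ω) {F : Type*}
    [NormedAddCommGroup F] {f : E d → F} (hf : Continuous f) :
    MemLp f 2 (volume.restrict Ω) := by
  have := isFiniteMeasure_restrict hb
  obtain ⟨C, hC⟩ := (hb.isCompact_closure).exists_bound_of_continuousOn hf.continuousOn
  refine MemLp.of_bound hf.aestronglyMeasurable C ?_
  have : ∀ᵐ x ∂(volume.restrict (closure Ω)), ‖f x‖ ≤ C :=
    (ae_restrict_iff' isClosed_closure.measurableSet).2 (Filter.Eventually.of_forall hC)
  exact ae_mono (Measure.restrict_mono subset_closure le_rfl) this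

theorem memLp_of_hasCompactSupport {F : Type*} [NormedAddCommGroup F] (S : Set (E d))
    {f : E d → F} (hf : Continuous f) (hc : HasCompactSupport f) :
    MemLp f 2 (volume.restrict S) :=
  (hf.memLp_of_hasCompactSupport hc (μ := volume)).restrict S

theorem integrable_mul_of_memLp {μ : Measure (E d)} {f g : E d → ℝ} (hf : MemLp f 2 μ)
    (hg : MemLp g 2 μ) : Integrable (fun x => f x * g x) μ := hf.integrable_mul hg

/-! ### Shifts of Sobolev functions -/

theorem HasWeakGrad.integral_mul_fderiv {Ω : Set (E d)} {φ : L2 Ω} {g : L2V Ω}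
    (h : HasWeakGrad Ω φ g) {η : E d → ℝ} (hη : ContDiff ℝ ∞ η) (hc : HasCompactSupport η)
    (hs : tsupport η ⊆ Ω) (v : E d) :
    ∫ x in Ω, φ x * fderiv ℝ η x v = - ∫ x in Ω, ⟪g x, v⟫ * η x := by
  have hv : v = ∑ i, v i • EuclideanSpace.single i (1 : ℝ) := by
    ext j; simp [Finset.sum_apply, Pi.single_apply]
  have hD : ∀ i, MemLp (fun x => fderiv ℝ η x (EuclideanSpace.single i (1 : ℝ))) 2
      (volume.restrict Ω) := fun i =>
    memLp_of_hasCompactSupport Ω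
      ((hη.continuous_fderiv (by simp)).clm_apply continuous_const)
      (hc.fderiv_apply ℝ _)
  have hη2 : MemLp η 2 (volume.restrict Ω) := memLp_of_hasCompactSupport Ω hη.continuous hc
  have e1 : ∀ x, φ x * fderiv ℝ η x v
      = ∑ i, v i * (φ x * fderiv ℝ η x (EuclideanSpace.single i 1)) := fun x => by
    conv_lhs => rw [hv]
    simp only [map_sum, map_smul, Finset.mul_sum, smul_eq_mul]
    exact Finset.sum_congr rfl fun i _ => by ring
  have e2 : ∀ x, ⟪g x, v⟫ * η x = ∑ i, v i * (g x i * η x) := fun x => by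
    rw [PiLp.inner_apply, Finset.sum_mul]
    exact Finset.sum_congr rfl fun i _ => by simp; ring
  have hgi : ∀ i, MemLp (fun x => g x i) 2 (volume.restrict Ω) := fun i =>
    (Lp.memLp g).continuousLinearMap_comp (EuclideanSpace.proj i : E d →L[ℝ] ℝ)
  simp_rw [e1, e2]
  rw [integral_finsetSum _ fun i _ => (integrable_mul_of_memLp (Lp.memLp φ) (hD i)).const_mul _,
    integral_finsetSum _ fun i _ => (integrable_mul_of_memLp (hgi i) hη2).const_mul _,
    ← Finset.sum_neg_distrib]
  refine Finset.sum_congr rfl fun i _ => ?_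
  rw [integral_const_mul, integral_const_mul, h η hη hc hs i, mul_neg]

theorem abs_integral_mul_le {S : Set (E d)} {f g : E d → ℝ} (hf : MemLp f 2 (volume.restrict S))
    (hg : MemLp g 2 (volume.restrict S)) :
    |∫ x in S, f x * g x| ≤ ‖hf.toLp f‖ * ‖hg.toLp g‖ := by
  have h := abs_real_inner_le_norm (hf.toLp f) (hg.toLp g)
  rw [L2.inner_def] at h
  refine le_of_eq_of_le ?_ h
  congr 1
  refine integral_congr_ae ?_
  filter_upwards [hf.coeFn_toLp, hg.coeFn_toLp] with x h1 h2
  rw [h1, h2]; simp [mul_comm]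

/-- The estimate `‖φ(· + h) - φ‖ ≤ ‖h‖ ‖∇φ‖` in dual form. The derivative in `s` of `∫ φ ψ(· - s h)`
falls on the smooth `ψ`; the weak gradient turns it into `∫ ⟪g, h⟫ ψ(· - s h)`, which Cauchy–Schwarz
bounds, and the mean value inequality on `[0, 1]` concludes. -/
theorem HasWeakGrad.abs_integral_shift_le {Ω : Set (E d)} (hb : Bornology.IsBounded Ω)
    {φ : L2 Ω} {g : L2V Ω}
    (hφ : HasWeakGrad Ω φ g) (h : E d) {ψ : E d → ℝ} (hψ : ContDiff ℝ ∞ ψ)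
    (hc : HasCompactSupport ψ) (hs : tsupport ψ ⊆ {x | segment ℝ x (x + h) ⊆ Ω})
    (hψ2 : MemLp ψ 2 volume) :
    |(∫ x in Ω, φ x * ψ (x - h)) - ∫ x in Ω, φ x * ψ x| ≤ ‖h‖ * ‖g‖ * ‖hψ2.toLp ψ‖ := by
  have := isFiniteMeasure_restrict hb
  have hφi : Integrable φ (volume.restrict Ω) := (Lp.memLp φ).integrable (by norm_num)
  have trC : ∀ s : ℝ, ContDiff ℝ ∞ fun x => ψ (x - s • h) := fun s =>
    hψ.comp (contDiff_id.sub contDiff_const)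
  have trS : ∀ s : ℝ, HasCompactSupport fun x => ψ (x - s • h) := fun s =>
    hc.comp_homeomorph (Homeomorph.subRight (s • h))
  have trM : ∀ s : ℝ, MemLp (fun x => ψ (x - s • h)) 2 (volume.restrict Ω) := fun s =>
    memLp_of_hasCompactSupport Ω (trC s).continuous (trS s)
  have hDc : Continuous fun x => fderiv ℝ ψ x h :=
    (hψ.continuous_fderiv (by simp)).clm_apply continuous_const
  obtain ⟨M, hM⟩ := hDc.bounded_above_of_compact_support (hc.fderiv_apply ℝ h)
  have hder : ∀ s x, HasDerivAt (fun s : ℝ => φ x * ψ (x - s • h))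
      (φ x * -(fderiv ℝ ψ (x - s • h) h)) s := fun s x => by
    refine HasDerivAt.const_mul _ ?_
    have h1 : HasDerivAt (fun s : ℝ => x - s • h) (-h) s := by
      simpa using ((hasDerivAt_id s).smul_const h).const_sub x
    have h2 := ((hψ.differentiable (by simp)) (x - s • h)).hasFDerivAt
    have h3 := h2.comp_hasDerivAt s h1
    rw [map_neg] at h3
    exact h3
  have hF : ∀ s : ℝ, HasDerivAt (fun s => ∫ x in Ω, φ x * ψ (x - s • h))
      (∫ x in Ω, φ x * -(fderiv ℝ ψ (x - s • h) h)) s := fun s => by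
    refine (hasDerivAt_integral_of_dominated_loc_of_deriv_le (s := univ) (x₀ := s)
      (F := fun s x => φ x * ψ (x - s • h)) (F' := fun s x => φ x * -(fderiv ℝ ψ (x - s • h) h))
      (bound := fun x => ‖φ x‖ * M) Filter.univ_mem ?_ ?_ ?_ ?_ ?_ ?_).2
    · exact Filter.Eventually.of_forall fun s =>
        (Lp.aestronglyMeasurable φ).mul (trC s).continuous.aestronglyMeasurable
    · exact (Lp.memLp φ).integrable_mul (trM s)
    · refine (Lp.aestronglyMeasurable φ).mul (Continuous.aestronglyMeasurable ?_)
      exact (hDc.comp (continuous_id.sub continuous_const)).neg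
    · refine Filter.Eventually.of_forall fun x s _ => ?_
      rw [norm_mul, norm_neg]
      gcongr
      exact hM _
    · exact hφi.norm.mul_const M
    · exact Filter.Eventually.of_forall fun x s _ => hder s x
  have hval : ∀ s ∈ Icc (0 : ℝ) 1, ∫ x in Ω, φ x * -(fderiv ℝ ψ (x - s • h) h)
      = ∫ x in Ω, ⟪g x, h⟫ * ψ (x - s • h) := fun s hs' => by
    -- Every point of the translated support lies on a segment `[y, y + h]` with `y` in the support
    -- of `ψ`, and such segments are contained in `Ω`.
    have hsupp : tsupport (fun x => ψ (x - s • h)) ⊆ Ω := by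
      have := tsupport_comp_eq_preimage ψ (Homeomorph.subRight (s • h))
      change tsupport (ψ ∘ Homeomorph.subRight (s • h)) ⊆ Ω
      rw [this]
      intro x hx
      have hx' := hs hx
      refine hx' ?_
      rw [segment_eq_image']
      exact ⟨s, hs', by simp⟩
    have h3 := hφ.integral_mul_fderiv (trC s) (trS s) hsupp h
    have h4 : ∀ x, fderiv ℝ (fun x => ψ (x - s • h)) x h = fderiv ℝ ψ (x - s • h) h := fun x => by
      rw [fderiv_comp_sub]
    simp_rw [h4] at h3
    simp_rw [mul_neg]
    rw [integral_neg, h3, neg_neg]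
  have hg2 : MemLp (fun x => ⟪g x, h⟫) 2 (volume.restrict Ω) := (Lp.memLp g).inner_const h
  have hgn : ‖hg2.toLp _‖ ≤ ‖h‖ * ‖g‖ := by
    refine Lp.norm_le_mul_norm_of_ae_le_mul (c := ‖h‖) (f := hg2.toLp _) (g := g) ?_
    filter_upwards [hg2.coeFn_toLp] with x hx
    rw [hx, mul_comm]
    exact norm_inner_le_norm _ _
  have hbound : ∀ s ∈ Ico (0 : ℝ) 1, ‖∫ x in Ω, φ x * -(fderiv ℝ ψ (x - s • h) h)‖
      ≤ ‖h‖ * ‖g‖ * ‖hψ2.toLp ψ‖ := fun s hs' => by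
    rw [hval s ⟨hs'.1, hs'.2.le⟩, Real.norm_eq_abs]
    refine (abs_integral_mul_le hg2 (trM s)).trans ?_
    gcongr
    rw [Lp.norm_toLp, Lp.norm_toLp]
    refine ENNReal.toReal_mono hψ2.2.ne ?_
    refine (eLpNorm_mono_measure _ Measure.restrict_le_self).trans_eq ?_
    exact eLpNorm_comp_measurePreserving (g := ψ) hψ2.1 (measurePreserving_sub_right volume (s • h))
  have := norm_image_sub_le_of_norm_deriv_le_segment_01'
    (f := fun s => ∫ x in Ω, φ x * ψ (x - s • h)) (fun s _ => (hF s).hasDerivWithinAt) hbound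
  simpa using this

end RTInfSup


/-! ### From shift estimates to the Poincaré–Wirtinger inequality -/

namespace RTInfSup
variable {d : ℕ}

/-- Duality: the difference quotient `u` is tested against `C_c^∞(U)`, where the previous bound
applies, and density extends the bound to all of `L²(U)`. -/
theorem HasWeakGrad.lintegral_shift_le {Ω : Set (E d)} (hΩ : IsOpen Ω)
    (hb : Bornology.IsBounded Ω) {φ : L2 Ω} {g : L2V Ω} (hφ : HasWeakGrad Ω φ g) (h : E d) :
    ∫⁻ x in {x | segment ℝ x (x + h) ⊆ Ω}, ‖φ (x + h) - φ x‖ₑ ^ 2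
      ≤ ENNReal.ofReal ((‖h‖ * ‖g‖) ^ 2) := by
  set U : Set (E d) := {x | segment ℝ x (x + h) ⊆ Ω} with hU
  have hUo : IsOpen U := isOpen_setOf_segment_subset_right hΩ h
  have hUΩ : U ⊆ Ω := fun x hx => hx (left_mem_segment ℝ _ _)
  have hUΩ' : U ⊆ (fun x => x + h) ⁻¹' Ω := fun x hx => hx (right_mem_segment ℝ _ _)
  have mp := (measurePreserving_add_right (volume : Measure (E d)) h).restrict_preimage
    hΩ.measurableSet
  have hu1 : MemLp (fun x => φ (x + h)) 2 (volume.restrict U) :=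
    ((Lp.memLp φ).comp_measurePreserving mp).mono_measure (Measure.restrict_mono hUΩ' le_rfl)
  have hu2 : MemLp φ 2 (volume.restrict U) :=
    (Lp.memLp φ).mono_measure (Measure.restrict_mono hUΩ le_rfl)
  have hu : MemLp (fun x => φ (x + h) - φ x) 2 (volume.restrict U) := hu1.sub hu2
  set u : L2 U := hu.toLp _ with hudef
  have hucoe : u =ᵐ[volume.restrict U] fun x => φ (x + h) - φ x := hu.coeFn_toLp
  set S : Submodule ℝ (L2 U) :=
    { carrier := {w | ∃ ψ : E d → ℝ, ContDiff ℝ ∞ ψ ∧ HasCompactSupport ψ ∧ tsupport ψ ⊆ U ∧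
        w =ᵐ[volume.restrict U] ψ}
      add_mem' := by
        rintro w w' ⟨ψ, h1, h2, h3, h4⟩ ⟨ψ', h1', h2', h3', h4'⟩
        refine ⟨ψ + ψ', h1.add h1', h2.add h2', (tsupport_add ψ ψ').trans (union_subset h3 h3'), ?_⟩
        filter_upwards [Lp.coeFn_add w w', h4, h4'] with x e1 e2 e3
        rw [e1, Pi.add_apply, e2, e3, Pi.add_apply]
      zero_mem' := ⟨0, contDiff_const, HasCompactSupport.zero, by simp [tsupport], by
        filter_upwards [Lp.coeFn_zero ℝ 2 (volume.restrict U)] with x hx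
        rw [hx]⟩
      smul_mem' := by
        rintro c w ⟨ψ, h1, h2, h3, h4⟩
        refine ⟨fun x => c * ψ x, contDiff_const.mul h1, h2.mul_left,
          (closure_mono fun x hx => ?_).trans h3, ?_⟩
        · exact right_ne_zero_of_mul hx
        · filter_upwards [Lp.coeFn_smul c w, h4] with x e1 e2
          rw [e1, Pi.smul_apply, e2, smul_eq_mul] } with hS
  have hbound : ∀ w ∈ S, |⟪u, w⟫| ≤ ‖h‖ * ‖g‖ * ‖w‖ := by
    rintro w ⟨ψ, h1, h2, h3, h4⟩
    have hψ2 : MemLp ψ 2 volume := h1.continuous.memLp_of_hasCompactSupport h2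
    have hz : ∀ x, x ∉ U → ψ x = 0 := fun x hx =>
      image_eq_zero_of_notMem_tsupport fun hx' => hx (h3 hx')
    have key := hφ.abs_integral_shift_le hb h h1 h2 h3 hψ2
    have i1 : ∫ x in Ω, φ x * ψ x = ∫ x in U, φ x * ψ x :=
      (setIntegral_eq_of_subset_of_forall_sdiff_eq_zero hΩ.measurableSet hUΩ
        fun x hx => by rw [hz x hx.2, mul_zero])
    have i2 : ∫ x in Ω, φ x * ψ (x - h) = ∫ x in U, φ (x + h) * ψ x := by
      rw [← (measurePreserving_add_right (volume : Measure (E d)) h).setIntegral_preimage_emb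
        (Homeomorph.addRight h).measurableEmbedding]
      simp only [add_sub_cancel_right]
      exact (setIntegral_eq_of_subset_of_forall_sdiff_eq_zero
        (hΩ.preimage (by fun_prop)).measurableSet hUΩ' fun x hx => by rw [hz x hx.2, mul_zero])
    have hψU : MemLp ψ 2 (volume.restrict U) := hψ2.restrict U
    have i3 : ⟪u, w⟫ = (∫ x in Ω, φ x * ψ (x - h)) - ∫ x in Ω, φ x * ψ x := by
      rw [i1, i2, ← integral_sub (integrable_mul_of_memLp hu1 hψU)
        (integrable_mul_of_memLp hu2 hψU), L2.inner_def]
      refine integral_congr_ae ?_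
      filter_upwards [hucoe, h4] with x e1 e2
      rw [e1, e2]
      simp only [RCLike.inner_apply, conj_trivial]
      ring
    have i4 : ‖hψ2.toLp ψ‖ = ‖w‖ := by
      rw [Lp.norm_toLp, Lp.norm_def, eLpNorm_congr_ae h4, eLpNorm_restrict_eq_of_support_subset]
      exact fun x hx => by_contra fun hx' => hx (hz x hx')
    rw [i3, ← i4]
    exact key
  -- A function orthogonal to all test functions vanishes almost everywhere, so the orthogonal
  -- complement of `S` is trivial.
  have hdense : S.topologicalClosure = ⊤ := by
    rw [Submodule.topologicalClosure_eq_top_iff, Submodule.eq_bot_iff]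
    intro v hv
    have hloc : LocallyIntegrableOn v U volume :=
      locallyIntegrableOn_of_locallyIntegrable_restrict
        ((Lp.memLp v).locallyIntegrable (by norm_num))
    have := hUo.ae_eq_zero_of_integral_contDiff_smul_eq_zero hloc fun ψ h1 h2 h3 => by
      have hψU : MemLp ψ 2 (volume.restrict U) := memLp_of_hasCompactSupport U h1.continuous h2
      have h0 := (Submodule.mem_orthogonal _ _).1 hv (hψU.toLp ψ) ⟨ψ, h1, h2, h3, hψU.coeFn_toLp⟩
      rw [L2.inner_def] at h0
      rw [← setIntegral_eq_integral_of_forall_compl_eq_zero (s := U) fun x hx => by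
        rw [image_eq_zero_of_notMem_tsupport fun hx' => hx (h3 hx'), zero_smul], ← h0]
      refine integral_congr_ae ?_
      filter_upwards [hψU.coeFn_toLp] with x hx
      rw [hx]; simp [mul_comm]
    refine Lp.ext ?_
    filter_upwards [(ae_restrict_iff' hUo.measurableSet).2 this,
      Lp.coeFn_zero ℝ 2 (volume.restrict U)] with x e1 e2
    rw [e1, e2]; rfl
  have hall : ∀ w : L2 U, |⟪u, w⟫| ≤ ‖h‖ * ‖g‖ * ‖w‖ := by
    have hcl : IsClosed {w : L2 U | |⟪u, w⟫| ≤ ‖h‖ * ‖g‖ * ‖w‖} :=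
      isClosed_le (by fun_prop) (by fun_prop)
    have hsub : (S.topologicalClosure : Set (L2 U)) ⊆ {w : L2 U | |⟪u, w⟫| ≤ ‖h‖ * ‖g‖ * ‖w‖} :=
      closure_minimal hbound hcl
    rw [hdense] at hsub
    exact fun w => hsub trivial
  have hn : ‖u‖ ≤ ‖h‖ * ‖g‖ := by
    -- Testing with `u` itself gives `‖u‖² ≤ ‖h‖ ‖g‖ ‖u‖`.
    have := hall u
    rw [real_inner_self_eq_norm_mul_norm, abs_of_nonneg (by positivity)] at this
    rcases (norm_nonneg u).eq_or_lt with h0 | h0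
    · rw [← h0]; positivity
    · exact le_of_mul_le_mul_right this h0
  calc ∫⁻ x in U, ‖φ (x + h) - φ x‖ₑ ^ 2 = ∫⁻ x in U, ‖u x‖ₑ ^ 2 := by
        refine lintegral_congr_ae ?_
        filter_upwards [hucoe] with x hx
        rw [hx]
    _ = ENNReal.ofReal (‖u‖ ^ 2) := lintegral_enorm_sq_eq u
    _ ≤ _ := ENNReal.ofReal_le_ofReal (by gcongr)

theorem HasWeakGrad.shiftInt_le {Ω : Set (E d)} (hΩ : IsOpen Ω)
    (hb : Bornology.IsBounded Ω) {φ : L2 Ω} {g : L2V Ω} (hφ : HasWeakGrad Ω φ g) (R : ℝ) :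
    shiftInt Ω R φ ≤ ENNReal.ofReal ((R * ‖g‖) ^ 2) * volume (Metric.closedBall (0 : E d) R) := by
  rw [shiftInt, ← setLIntegral_const]
  refine setLIntegral_mono measurable_const fun h hh => (hφ.lintegral_shift_le hΩ hb h).trans ?_
  have : ‖h‖ ≤ R := by simpa using hh
  gcongr

theorem exists_dist_le {Ω : Set (E d)} (hb : Bornology.IsBounded Ω) :
    ∃ R : ℝ, 0 < R ∧ ∀ x ∈ Ω, ∀ y ∈ Ω, dist x y ≤ R := by
  obtain ⟨C, hC⟩ := Metric.isBounded_iff.1 hb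
  exact ⟨max C 1, by positivity, fun x hx y hy => (hC hx hy).trans (le_max_left _ _)⟩

/-- The nonlocal estimate at the coarsest scale `m = 1`: for mean-zero `φ` the oscillation dominates
`|Ω| ‖φ‖²`, and the shifts of length at most `R` are bounded by `R ‖g‖`. -/
theorem poincareWirtingerSet_nonempty {Ω : Set (E d)} (hΩ : IsLipschitzDomain Ω)
    (hpoly : HasPolygonalBoundary Ω) : (poincareWirtingerSet Ω).Nonempty := by
  obtain ⟨R, hR0, hR⟩ := exists_dist_le hΩ.isBounded
  obtain ⟨K, hK, h⟩ := linked_self hΩ.isOpen hΩ.isConnected.isPreconnected hΩ.isBounded hpoly hR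
  have hfin : volume Ω ≠ ⊤ := hΩ.isBounded.measure_lt_top.ne
  have hpos : volume Ω ≠ 0 := (hΩ.isOpen.measure_pos volume hΩ.isConnected.nonempty).ne'
  have hball : volume (Metric.closedBall (0 : E d) R) ≠ ⊤ := Metric.isBounded_closedBall.measure_lt_top.ne
  set c : ENNReal := (volume Ω)⁻¹ * (K * volume (Metric.closedBall (0 : E d) R)) with hc
  have hcfin : c ≠ ⊤ := by
    have := ENNReal.inv_ne_top.2 hpos
    finiteness
  refine ⟨Real.sqrt c.toReal * R, by positivity, fun φ g hφ h0 => ?_⟩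
  have h1 := volume_mul_lintegral_sq_le_oscInt hfin (Lp.memLp φ) h0
  have h2 := h 1 one_pos φ (Lp.stronglyMeasurable φ).measurable
  have h3 := hφ.shiftInt_le hΩ.isOpen hΩ.isBounded R
  rw [lintegral_enorm_sq_eq] at h1
  have h4 : ENNReal.ofReal (‖φ‖ ^ 2) ≤ c * ENNReal.ofReal ((R * ‖g‖) ^ 2) := by
    calc ENNReal.ofReal (‖φ‖ ^ 2) = (volume Ω)⁻¹ * (volume Ω * ENNReal.ofReal (‖φ‖ ^ 2)) := by
          rw [← mul_assoc, ENNReal.inv_mul_cancel hpos hfin, one_mul]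
      _ ≤ (volume Ω)⁻¹ * (K * (ENNReal.ofReal ((R * ‖g‖) ^ 2)
            * volume (Metric.closedBall (0 : E d) R))) := by
          refine mul_le_mul' le_rfl (h1.trans (h2.trans ?_))
          simp only [Nat.cast_one, one_pow, one_mul, div_one]
          exact mul_le_mul' le_rfl h3
      _ = _ := by rw [hc]; ring
  rw [← ENNReal.ofReal_toReal hcfin, ← ENNReal.ofReal_mul ENNReal.toReal_nonneg,
    ENNReal.ofReal_le_ofReal_iff (by positivity)] at h4
  refine abs_le_of_sq_le_sq' (b := Real.sqrt c.toReal * R * ‖g‖) ?_ (by positivity) |>.2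
  rw [mul_assoc, mul_pow, Real.sq_sqrt ENNReal.toReal_nonneg]
  exact h4

end RTInfSup


namespace RTInfSup
variable {d : ℕ}

/-! ### The optimal Poincaré–Wirtinger constant -/

theorem hasWeakGrad_toLp {Ω : Set (E d)} (hb : Bornology.IsBounded Ω)
    {ψ : E d → ℝ} (hψ : ContDiff ℝ ∞ ψ) :
    HasWeakGrad Ω ((memLp_of_continuous hb hψ.continuous).toLp ψ)
      ((memLp_of_continuous hb (continuous_gradient hψ)).toLp (gradient ψ)) := by
  intro η hη hc hs i
  have hz : ∀ x, x ∉ Ω → η x = 0 := fun x hx =>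
    image_eq_zero_of_notMem_tsupport fun hx' => hx (hs hx')
  have hz' : ∀ x, x ∉ Ω → fderiv ℝ η x (EuclideanSpace.single i 1) = 0 := fun x hx => by
    rw [image_eq_zero_of_notMem_tsupport (f := fderiv ℝ η)
      fun hx' => hx (hs (tsupport_fderiv_subset ℝ hx'))]
    rfl
  have hDη : Continuous fun x => fderiv ℝ η x (EuclideanSpace.single i (1 : ℝ)) :=
    (hη.continuous_fderiv (by simp)).clm_apply continuous_const
  have hDψ : Continuous fun x => fderiv ℝ ψ x (EuclideanSpace.single i (1 : ℝ)) :=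
    (hψ.continuous_fderiv (by simp)).clm_apply continuous_const
  have e1 : ∫ x in Ω, ((memLp_of_continuous hb hψ.continuous).toLp ψ) x
        * fderiv ℝ η x (EuclideanSpace.single i 1)
      = ∫ x, ψ x * fderiv ℝ η x (EuclideanSpace.single i 1) := by
    rw [← setIntegral_eq_integral_of_forall_compl_eq_zero (s := Ω) (μ := volume)
      (f := fun x => ψ x * fderiv ℝ η x (EuclideanSpace.single i 1)) fun x hx => by
        rw [hz' x hx, mul_zero]]
    refine integral_congr_ae ?_
    filter_upwards [(memLp_of_continuous hb hψ.continuous).coeFn_toLp] with x hx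
    rw [hx]
  have e2 : ∫ x in Ω, ((memLp_of_continuous hb (continuous_gradient hψ)).toLp (gradient ψ)) x i
        * η x = ∫ x, fderiv ℝ ψ x (EuclideanSpace.single i 1) * η x := by
    rw [← setIntegral_eq_integral_of_forall_compl_eq_zero (s := Ω) (μ := volume)
      (f := fun x => fderiv ℝ ψ x (EuclideanSpace.single i 1) * η x) fun x hx => by
        rw [hz x hx, mul_zero]]
    refine integral_congr_ae ?_
    filter_upwards [(memLp_of_continuous hb (continuous_gradient hψ)).coeFn_toLp] with x hx
    rw [hx, fderiv_eq_inner_gradient, EuclideanSpace.inner_single_right]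
    simp
  rw [e1, e2]
  refine integral_mul_fderiv_eq_neg_fderiv_mul_of_integrable ?_ ?_ ?_ ?_ ?_
  · exact (hDψ.mul hη.continuous).integrable_of_hasCompactSupport hc.mul_left
  · exact (hψ.continuous.mul hDη).integrable_of_hasCompactSupport (hc.fderiv_apply ℝ _).mul_left
  · exact (hψ.continuous.mul hη.continuous).integrable_of_hasCompactSupport hc.mul_left
  · exact fun x _ => (hψ.differentiable (by simp)) x
  · exact fun x _ => (hη.differentiable (by simp)) x

/-- Each pair `(φ, g)` imposes a closed condition on the constant, so the infimum is attained once
the set is nonempty. -/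
theorem isClosed_poincareWirtingerSet (Ω : Set (E d)) : IsClosed (poincareWirtingerSet Ω) := by
  have : poincareWirtingerSet Ω = Ici 0 ∩ ⋂ (φ : L2 Ω) (g : L2V Ω) (_ : HasWeakGrad Ω φ g)
      (_ : φ ∈ L20 Ω), {C : ℝ | ‖φ‖ ≤ C * ‖g‖} := by
    ext C
    simp [poincareWirtingerSet]
  rw [this]
  refine isClosed_Ici.inter ?_
  exact isClosed_iInter fun φ => isClosed_iInter fun g => isClosed_iInter fun _ =>
    isClosed_iInter fun _ => isClosed_le continuous_const (by fun_prop)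

theorem isLeast_poincareWirtingerConst {Ω : Set (E d)} (hΩ : IsLipschitzDomain Ω)
    (hpoly : HasPolygonalBoundary Ω) :
    IsLeast (poincareWirtingerSet Ω) (poincareWirtingerConst Ω) :=
  (isClosed_poincareWirtingerSet Ω).isLeast_csInf (poincareWirtingerSet_nonempty hΩ hpoly)
    ⟨0, fun _ h => h.1⟩

/-- A zero constant would force every mean-zero `H¹` function to vanish. A coordinate minus its mean
does not, because its zero set is a hyperplane and hence null. -/
theorem poincareWirtingerConst_pos {Ω : Set (E d)} (hd : 0 < d) (hΩ : IsLipschitzDomain Ω)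
    (hpoly : HasPolygonalBoundary Ω) : 0 < poincareWirtingerConst Ω := by
  have hC := (isLeast_poincareWirtingerConst hΩ hpoly).1
  refine lt_of_le_of_ne hC.1 fun h0 => ?_
  rw [← h0] at hC
  have hb := hΩ.isBounded
  have := isFiniteMeasure_restrict hb
  let e : E d := EuclideanSpace.single ⟨0, hd⟩ 1
  have he : e ≠ 0 := by simp [e]
  have hvol : volume.real Ω ≠ 0 :=
    (ENNReal.toReal_pos (hΩ.isOpen.measure_pos volume hΩ.isConnected.nonempty).ne'
      hb.measure_lt_top.ne).ne'
  set c : ℝ := (∫ x in Ω, ⟪e, x⟫) / volume.real Ω with hc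
  have hψ : ContDiff ℝ ∞ fun x : E d => ⟪e, x⟫ - c :=
    (contDiff_const.inner ℝ contDiff_id).sub contDiff_const
  have hM := memLp_of_continuous hb hψ.continuous
  have hmem : hM.toLp _ ∈ L20 Ω := by
    change ∫ x in Ω, (hM.toLp _) x = 0
    rw [integral_congr_ae hM.coeFn_toLp, integral_sub _ (integrable_const _), integral_const]
    · simp only [smul_eq_mul, measureReal_restrict_apply_univ]
      rw [hc, mul_div_cancel₀ _ hvol, sub_self]
    · have hψ' : Continuous fun x : E d => ⟪e, x⟫ := by fun_prop
      exact (memLp_of_continuous hb hψ').integrable (by norm_num)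
  have h1 := hC.2 _ _ (hasWeakGrad_toLp hb hψ) hmem
  rw [zero_mul, norm_le_zero_iff] at h1
  have h2 : ∀ᵐ x ∂(volume.restrict Ω), ⟪e, x⟫ = c := by
    have h3 := hM.coeFn_toLp
    rw [h1] at h3
    filter_upwards [h3, Lp.coeFn_zero ℝ 2 (volume.restrict Ω)] with x e1 e2
    rw [e2] at e1
    simpa [sub_eq_zero] using e1.symm
  have h3 : ∀ᵐ x ∂(volume.restrict Ω), ⟪e, x⟫ ≠ c :=
    ae_restrict_of_ae (measure_eq_zero_iff_ae_notMem.1 (volume_hyperplane he c))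
  have h4 : ∀ᵐ x ∂(volume.restrict Ω), False := by
    filter_upwards [h2, h3] with x e1 e2 using e2 e1
  rw [Filter.eventually_false_iff_eq_bot, ae_eq_bot, Measure.restrict_eq_zero] at h4
  exact (hΩ.isOpen.measure_pos volume hΩ.isConnected.nonempty).ne' h4

/-! ### Solving the divergence equation -/

/-- The test functions are not required to vanish on the boundary, so one identity encodes both the
divergence and the zero normal trace. -/
theorem mem_H0div_of_forall {Ω : Set (E d)} (hΩ : IsOpen Ω) {v : L2V Ω} {q : L2 Ω}
    (h : ∀ ψ : E d → ℝ, ContDiff ℝ ∞ ψ → HasCompactSupport ψ →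
      ∫ x in Ω, fderiv ℝ ψ x (v x) = - ∫ x in Ω, q x * ψ x) :
    v ∈ H0div Ω ∧ weakDiv Ω v = q := by
  have hd : HasWeakDiv Ω v q := fun ψ h1 h2 _ => h ψ h1 h2
  have hw := weakDiv_eq hΩ hd
  refine ⟨⟨⟨q, hd⟩, fun ψ h1 h2 => ?_⟩, hw⟩
  rw [hw, h ψ h1 h2, neg_add_cancel]

/-- `H¹(Ω)`, as the space of pairs of a function and its weak gradient. -/
def weakGradGraph (Ω : Set (E d)) : Submodule ℝ (L2 Ω × L2V Ω) where
  carrier := {p | HasWeakGrad Ω p.1 p.2}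
  add_mem' := by
    rintro ⟨φ, g⟩ ⟨φ', g'⟩ h h' η hη hc hs i
    have hD : MemLp (fun x => fderiv ℝ η x (EuclideanSpace.single i (1 : ℝ))) 2
      (volume.restrict Ω) := memLp_of_hasCompactSupport Ω
        ((hη.continuous_fderiv (by simp)).clm_apply continuous_const) (hc.fderiv_apply ℝ _)
    have hη2 : MemLp η 2 (volume.restrict Ω) := memLp_of_hasCompactSupport Ω hη.continuous hc
    have hgi : ∀ g : L2V Ω, MemLp (fun x => g x i) 2 (volume.restrict Ω) := fun g =>
      (Lp.memLp g).continuousLinearMap_comp (EuclideanSpace.proj i : E d →L[ℝ] ℝ)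
    have e1 : ∫ x in Ω, (φ + φ') x * fderiv ℝ η x (EuclideanSpace.single i 1)
        = (∫ x in Ω, φ x * fderiv ℝ η x (EuclideanSpace.single i 1))
          + ∫ x in Ω, φ' x * fderiv ℝ η x (EuclideanSpace.single i 1) := by
      rw [← integral_add (integrable_mul_of_memLp (Lp.memLp φ) hD)
        (integrable_mul_of_memLp (Lp.memLp φ') hD)]
      refine integral_congr_ae ?_
      filter_upwards [Lp.coeFn_add φ φ'] with x hx
      rw [hx, Pi.add_apply, add_mul]
    have e2 : ∫ x in Ω, (g + g') x i * η x
        = (∫ x in Ω, g x i * η x) + ∫ x in Ω, g' x i * η x := by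
      rw [← integral_add (integrable_mul_of_memLp (hgi g) hη2)
        (integrable_mul_of_memLp (hgi g') hη2)]
      refine integral_congr_ae ?_
      filter_upwards [Lp.coeFn_add g g'] with x hx
      rw [hx, Pi.add_apply, PiLp.add_apply, add_mul]
    simp only [Prod.mk_add_mk]
    rw [e1, e2, h η hη hc hs i, h' η hη hc hs i, neg_add]
  zero_mem' := by
    intro η hη hc hs i
    have e1 : ∫ x in Ω, (0 : L2 Ω) x * fderiv ℝ η x (EuclideanSpace.single i 1) = 0 := by
      refine integral_eq_zero_of_ae ?_
      filter_upwards [Lp.coeFn_zero ℝ 2 (volume.restrict Ω)] with x hx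
      rw [hx]; simp
    have e2 : ∫ x in Ω, (0 : L2V Ω) x i * η x = 0 := by
      refine integral_eq_zero_of_ae ?_
      filter_upwards [Lp.coeFn_zero (E d) 2 (volume.restrict Ω)] with x hx
      rw [hx]; simp
    simp only [Prod.fst_zero, Prod.snd_zero]
    rw [e1, e2, neg_zero]
  smul_mem' := by
    rintro c ⟨φ, g⟩ h η hη hc hs i
    have e1 : ∫ x in Ω, (c • φ) x * fderiv ℝ η x (EuclideanSpace.single i 1)
        = c * ∫ x in Ω, φ x * fderiv ℝ η x (EuclideanSpace.single i 1) := by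
      rw [← integral_const_mul]
      refine integral_congr_ae ?_
      filter_upwards [Lp.coeFn_smul c φ] with x hx
      rw [hx, Pi.smul_apply, smul_eq_mul, mul_assoc]
    have e2 : ∫ x in Ω, (c • g) x i * η x = c * ∫ x in Ω, g x i * η x := by
      rw [← integral_const_mul]
      refine integral_congr_ae ?_
      filter_upwards [Lp.coeFn_smul c g] with x hx
      rw [hx, Pi.smul_apply, PiLp.smul_apply, smul_eq_mul, mul_assoc]
    simp only [Prod.smul_mk]
    rw [e1, e2, h η hη hc hs i, mul_neg]

/-- The Neumann problem: mean-zero functions are divergences of fields in `H₀(div, Ω)`, with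
the Poincaré–Wirtinger constant as bound. -/
theorem exists_H0div_of_mem_L20 {Ω : Set (E d)} (hΩ : IsOpen Ω) (hn : Ω.Nonempty)
    (hb : Bornology.IsBounded Ω) {C : ℝ} (hC : C ∈ poincareWirtingerSet Ω) {q : L2 Ω}
    (hq : q ∈ L20 Ω) : ∃ v ∈ H0div Ω, weakDiv Ω v = q ∧ ‖v‖ ≤ C * ‖q‖ := by
  have := isFiniteMeasure_restrict hb
  have hvol : volume.real Ω ≠ 0 :=
    (ENNReal.toReal_pos (hΩ.measure_pos volume hn).ne' hb.measure_lt_top.ne).ne'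
  let A : weakGradGraph Ω →ₗ[ℝ] L2V Ω := (LinearMap.snd ℝ _ _).comp (weakGradGraph Ω).subtype
  let l : weakGradGraph Ω →ₗ[ℝ] ℝ :=
    ((innerₛₗ ℝ q).comp (LinearMap.fst ℝ _ _)).comp (weakGradGraph Ω).subtype
  have hl : ∀ p, |l p| ≤ C * ‖q‖ * ‖A p‖ := by
    rintro ⟨⟨φ, g⟩, hφ⟩
    change |⟪q, φ⟫| ≤ C * ‖q‖ * ‖g‖
    -- Subtracting the mean of `φ` changes neither its gradient nor its pairing with the mean-zero
    -- `q`, and makes Poincaré–Wirtinger applicable.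
    set c : ℝ := (∫ x in Ω, φ x) / volume.real Ω with hc
    have hcψ : ContDiff ℝ ∞ fun _ : E d => c := contDiff_const
    set κ : L2 Ω := (memLp_of_continuous hb hcψ.continuous).toLp (fun _ : E d => c) with hκ
    have hκe : κ =ᵐ[volume.restrict Ω] fun _ => c := MemLp.coeFn_toLp _
    have hκg : HasWeakGrad Ω κ 0 := by
      have h1 := hasWeakGrad_toLp hb hcψ
      convert h1 using 1
      symm
      rw [Lp.eq_zero_iff_ae_eq_zero]
      filter_upwards [(memLp_of_continuous hb (continuous_gradient hcψ)).coeFn_toLp] with x hx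
      rw [hx, gradient_fun_const]; rfl
    have hmem : HasWeakGrad Ω (φ - κ) g := by
      have := (weakGradGraph Ω).sub_mem hφ (show ((κ, 0) : L2 Ω × L2V Ω) ∈ weakGradGraph Ω from hκg)
      rw [Prod.mk_sub_mk, sub_zero] at this
      exact this
    have hφi : Integrable φ (volume.restrict Ω) := (Lp.memLp φ).integrable (by norm_num)
    have hmean : φ - κ ∈ L20 Ω := by
      change ∫ x in Ω, (φ - κ) x = 0
      have : ∫ x in Ω, (φ - κ) x = ∫ x in Ω, (φ x - c) := by
        refine integral_congr_ae ?_
        filter_upwards [Lp.coeFn_sub φ κ, hκe] with x e1 e2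
        rw [e1, Pi.sub_apply, e2]
      rw [this, integral_sub hφi (integrable_const _), integral_const]
      simp only [smul_eq_mul, measureReal_restrict_apply_univ]
      rw [hc, mul_div_cancel₀ _ hvol, sub_self]
    have hqκ : ⟪q, κ⟫ = 0 := by
      rw [L2.inner_def]
      have : ∫ x in Ω, ⟪q x, κ x⟫ = ∫ x in Ω, c * q x := by
        refine integral_congr_ae ?_
        filter_upwards [hκe] with x e
        rw [e]; simp
      rw [this, integral_const_mul, show ∫ x in Ω, q x = 0 from hq, mul_zero]
    calc |⟪q, φ⟫| = |⟪q, φ - κ⟫| := by rw [inner_sub_right, hqκ, sub_zero]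
      _ ≤ ‖q‖ * ‖φ - κ‖ := abs_real_inner_le_norm _ _
      _ ≤ ‖q‖ * (C * ‖g‖) := by gcongr; exact hC.2 _ _ hmem hmean
      _ = _ := by ring
  obtain ⟨y, hy, hyA⟩ := exists_inner_eq_of_abs_le A l (mul_nonneg hC.1 (norm_nonneg q)) hl
  -- Restricting the representation to smooth `ψ` gives `∫ y · ∇ψ = ∫ q ψ`; the sign in the weak
  -- divergence calls for `-y`.
  have key := mem_H0div_of_forall (v := -y) (q := q) hΩ fun ψ h1 h2 => by
    have h3 := hyA ⟨(_, _), hasWeakGrad_toLp hb h1⟩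
    change ⟪y, (memLp_of_continuous hb (continuous_gradient h1)).toLp (gradient ψ)⟫
      = ⟪q, (memLp_of_continuous hb h1.continuous).toLp ψ⟫ at h3
    rw [L2.inner_def, L2.inner_def] at h3
    have e1 : ∫ x in Ω, q x * ψ x
        = ∫ x in Ω, ⟪q x, ((memLp_of_continuous hb h1.continuous).toLp ψ) x⟫ := by
      refine integral_congr_ae ?_
      filter_upwards [(memLp_of_continuous hb h1.continuous).coeFn_toLp] with x e
      rw [e]; simp [mul_comm]
    rw [e1, ← h3, ← integral_neg]
    refine integral_congr_ae ?_
    filter_upwards [(memLp_of_continuous hb (continuous_gradient h1)).coeFn_toLp, Lp.coeFn_neg y]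
      with x e2 e3
    rw [e2, e3, Pi.neg_apply, map_neg, fderiv_eq_inner_gradient, real_inner_comm]
  exact ⟨-y, key.1, key.2, by rwa [norm_neg]⟩

variable {Ω : Set (E d)}

theorem weakDiv_zero (hΩ : IsOpen Ω) : weakDiv Ω (0 : L2V Ω) = 0 := by
  refine weakDiv_eq hΩ fun ψ _ _ _ => ?_
  rw [integral_eq_zero_of_ae, integral_eq_zero_of_ae, neg_zero]
  · filter_upwards [Lp.coeFn_zero ℝ 2 (volume.restrict Ω)] with x hx
    rw [hx]; simp
  · filter_upwards [Lp.coeFn_zero (E d) 2 (volume.restrict Ω)] with x hx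
    rw [hx]; simp

/-- A bounded right inverse of the discrete divergence gives inf-sup stability. -/
theorem le_infSup (hΩ : IsOpen Ω) (𝒯 : Mesh Ω) (k : ℕ) {c : ℝ} (hc : 0 ≤ c)
    (h : ∀ q ∈ QH 𝒯 k ∩ L20 Ω, ∃ v ∈ VH 𝒯 k, weakDiv Ω v = q ∧ ‖v‖ ^ 2 ≤ c * ‖q‖ ^ 2) :
    (((1 + c) ^ (-(1 / 2 : ℝ)) : ℝ) : EReal) ≤ infSup 𝒯 k := by
  refine le_iInf₂ fun q hq => ?_
  have hq0 : q ≠ 0 := fun h0 => hq.2 h0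
  obtain ⟨v, hv, hdiv, hn⟩ := h q hq.1
  have hv0 : v ≠ 0 := by
    rintro rfl
    rw [weakDiv_zero hΩ] at hdiv
    exact hq0 hdiv.symm
  refine le_iSup₂_of_le v ⟨hv, hv0⟩ ?_
  -- Since `div v = q`, the numerator is `‖q‖²` and the `H(div)` norm is at most `√(1 + c) ‖q‖`.
  rw [EReal.coe_le_coe_iff, b, hdivNorm, hdiv, real_inner_self_eq_norm_sq]
  have hqn : 0 < ‖q‖ := norm_pos_iff.2 hq0
  have h1 : Real.sqrt (‖v‖ ^ 2 + ‖q‖ ^ 2) ≤ Real.sqrt (1 + c) * ‖q‖ := by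
    rw [Real.sqrt_le_left (by positivity), mul_pow, Real.sq_sqrt (by positivity)]
    linarith
  have h2 : 0 < Real.sqrt (‖v‖ ^ 2 + ‖q‖ ^ 2) := Real.sqrt_pos.2 (by positivity)
  have h3 : 0 < Real.sqrt (1 + c) := Real.sqrt_pos.2 (by positivity)
  rw [Real.rpow_neg (by positivity), ← Real.sqrt_eq_rpow, le_div_iff₀ (by positivity),
    inv_mul_le_iff₀ h3]
  calc ‖q‖ * Real.sqrt (‖v‖ ^ 2 + ‖q‖ ^ 2) ≤ ‖q‖ * (Real.sqrt (1 + c) * ‖q‖) := by gcongr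
    _ = _ := by ring

/-- The error is orthogonal to `q` and to `p`, hence to itself. As `K` is only a set, orthogonality
is used for `q` and `p` separately. -/
theorem IsL2Projection.eq_self {K : Set (L2 Ω)} {q p : L2 Ω} (h : IsL2Projection K q p)
    (hq : q ∈ K) : p = q := by
  have h1 := h.2 q hq
  have h2 := h.2 p h.1
  have : ⟪q - p, q - p⟫ = 0 := by rw [inner_sub_right, h1, h2, sub_zero]
  exact (sub_eq_zero.1 (inner_self_eq_zero.1 this)).symm

/-- The explicit inf-sup bound for a commuting projection. -/
theorem le_infSup_of_projection (hΩ : IsLipschitzDomain Ω) (hpoly : HasPolygonalBoundary Ω)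
    {𝒯 : Mesh Ω} {k : ℕ} {C : ℝ} {π : H0div Ω → H0div Ω}
    (hπ : IsStableCommutingProjection 𝒯 k C π) {Cstab : ℝ} (h0 : 0 < Cstab)
    (hs : IsGloballyStable Cstab π) :
    (((1 + Cstab * (1 + poincareWirtingerConst Ω ^ 2)) ^ (-(1 / 2 : ℝ)) : ℝ) : EReal)
      ≤ infSup 𝒯 k := by
  have hC := (isLeast_poincareWirtingerConst hΩ hpoly).1
  refine le_infSup hΩ.isOpen 𝒯 k (by positivity) fun q hq => ?_
  obtain ⟨v, hv, hdiv, hn⟩ := exists_H0div_of_mem_L20 hΩ.isOpen hΩ.isConnected.nonempty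
    hΩ.isBounded hC hq.2
  refine ⟨π ⟨v, hv⟩, hπ.maps_to _, ?_, ?_⟩
  -- As `div v = q` already lies in the discrete space, its projection is `q` itself.
  · have := hπ.commutes ⟨v, hv⟩
    simp only [hdiv] at this
    exact this.eq_self hq.1
  · refine (hs ⟨v, hv⟩).trans ?_
    simp only [hdiv]
    have : ‖v‖ ^ 2 ≤ (poincareWirtingerConst Ω * ‖q‖) ^ 2 := by gcongr
    rw [mul_assoc]
    gcongr
    nlinarith

end RTInfSup


namespace RTInfSup
variable {d : ℕ} {Ω : Set (E d)}

/-! ### Geometry of simplicial meshes -/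

theorem isCompact_simplex (T : Finset (E d)) : IsCompact (simplex T) :=
  T.finite_toSet.isCompact_convexHull ℝ

theorem measurableSet_simplex (T : Finset (E d)) : MeasurableSet (simplex T) :=
  (isCompact_simplex T).isClosed.measurableSet

theorem volume_simplex_ne_top (T : Finset (E d)) : volume (simplex T) ≠ ⊤ :=
  (isCompact_simplex T).measure_lt_top.ne

theorem subset_simplex (T : Finset (E d)) : (T : Set (E d)) ⊆ simplex T := subset_convexHull ℝ _

/-- At most `d` points span a proper affine subspace. -/
theorem affineSpan_ne_top_of_card_le {S : Finset (E d)} (hS : S.card ≤ d) :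
    affineSpan ℝ (S : Set (E d)) ≠ ⊤ := by
  intro h
  rcases S.eq_empty_or_nonempty with rfl | hn
  · rw [Finset.coe_empty, AffineSubspace.span_empty] at h
    exact bot_ne_top h
  · obtain ⟨n, hn'⟩ := Nat.exists_eq_succ_of_ne_zero hn.card_pos.ne'
    have h1 := finrank_vectorSpan_range_le ℝ (fun p : S => (p : E d)) (n := n) (by simpa using hn')
    have h2 : range (fun p : S => (p : E d)) = S := by simp
    rw [h2, ← direction_affineSpan, h, AffineSubspace.direction_top, finrank_top,
      finrank_euclideanSpace_fin] at h1
    omega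

theorem volume_affineSpan_eq_zero {S : Finset (E d)} (hS : S.card ≤ d) :
    volume (affineSpan ℝ (S : Set (E d)) : Set (E d)) = 0 :=
  Measure.addHaar_affineSubspace volume _ (affineSpan_ne_top_of_card_le hS)

theorem volume_simplex_eq_zero {S : Finset (E d)} (hS : S.card ≤ d) : volume (simplex S) = 0 :=
  measure_mono_null (convexHull_subset_affineSpan _) (volume_affineSpan_eq_zero hS)

theorem pow_mul_le_volume_of_closedBall_subset {S : Set (E d)} (hS : volume S ≠ ⊤) {x : E d} {r : ℝ}
    (hr : 0 ≤ r) (h : Metric.closedBall x r ⊆ S) :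
    r ^ d * volume.real (Metric.ball (0 : E d) 1) ≤ volume.real S := by
  have h1 := Measure.addHaar_closedBall volume x hr
  rw [finrank_euclideanSpace_fin] at h1
  have h2 : volume.real (Metric.closedBall x r) ≤ volume.real S := measureReal_mono h hS
  rwa [Measure.real, h1, ENNReal.toReal_mul, ENNReal.toReal_ofReal (by positivity)] at h2

theorem volume_real_closedBall (x : E d) {r : ℝ} (hr : 0 ≤ r) :
    volume.real (Metric.closedBall x r) = r ^ d * volume.real (Metric.ball (0 : E d) 1) := by
  rw [Measure.real, Measure.addHaar_closedBall volume x hr, finrank_euclideanSpace_fin,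
    ENNReal.toReal_mul, ENNReal.toReal_ofReal (by positivity), Measure.real]

theorem volume_real_ball_pos : 0 < volume.real (Metric.ball (0 : E d) 1) :=
  ENNReal.toReal_pos (Metric.measure_ball_pos volume _ one_pos).ne' measure_ball_lt_top.ne

namespace Mesh
variable (𝒯 : Mesh Ω)

/-- The affine basis formed by the vertices of a cell. -/
noncomputable def basis {T : Finset (E d)} (hT : T ∈ 𝒯.cells) : AffineBasis T ℝ (E d) where
  toFun p := p
  ind' := 𝒯.indep T hT
  tot' := by
    rw [(𝒯.indep T hT).affineSpan_eq_top_iff_card_eq_finrank_add_one]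
    simpa using 𝒯.card_cell T hT

variable {𝒯}

theorem range_basis {T : Finset (E d)} (hT : T ∈ 𝒯.cells) : range (𝒯.basis hT) = T := by
  change range (fun p : T => (p : E d)) = T
  simp

theorem interior_simplex_nonempty {T : Finset (E d)} (hT : T ∈ 𝒯.cells) :
    (interior (simplex T)).Nonempty := by
  rw [simplex, interior_convexHull_nonempty_iff_affineSpan_eq_top, ← range_basis hT]
  exact (𝒯.basis hT).tot

theorem volume_simplex_pos {T : Finset (E d)} (hT : T ∈ 𝒯.cells) :
    0 < volume.real (simplex T) :=
  ENNReal.toReal_pos (Measure.measure_pos_of_nonempty_interior _ (interior_simplex_nonempty hT)).ne'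
    (volume_simplex_ne_top T)

theorem card_inter_le [DecidableEq (E d)] {T T' : Finset (E d)} (hT : T ∈ 𝒯.cells)
    (hT' : T' ∈ 𝒯.cells) (h : T ≠ T') : (T ∩ T').card ≤ d := by
  have h1 := 𝒯.card_cell T hT
  have h2 := 𝒯.card_cell T' hT'
  by_contra hlt
  have h3 : T ∩ T' = T := Finset.eq_of_subset_of_card_le Finset.inter_subset_left (by omega)
  have h4 : T ∩ T' = T' := Finset.eq_of_subset_of_card_le Finset.inter_subset_right (by omega)
  exact h (h3.symm.trans h4)

theorem simplex_inter [DecidableEq (E d)] {T T' : Finset (E d)} (hT : T ∈ 𝒯.cells)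
    (hT' : T' ∈ 𝒯.cells) : simplex T ∩ simplex T' = simplex (T ∩ T') := by
  rw [simplex, simplex, 𝒯.conforming T hT T' hT', simplex, Finset.coe_inter]

/-- Distinct cells share at most `d` vertices, so by conformity their intersection lies in a proper
affine subspace. -/
theorem aedisjoint {T T' : Finset (E d)} (hT : T ∈ 𝒯.cells) (hT' : T' ∈ 𝒯.cells) (h : T ≠ T') :
    AEDisjoint volume (simplex T) (simplex T') := by
  classical
  rw [AEDisjoint, simplex_inter hT hT']
  exact volume_simplex_eq_zero (card_inter_le hT hT' h)

theorem simplex_subset {T : Finset (E d)} (hT : T ∈ 𝒯.cells) : simplex T ⊆ closure Ω := by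
  rw [← 𝒯.cover]
  exact subset_biUnion_of_mem (u := fun T : Finset (E d) => convexHull ℝ (T : Set (E d))) hT

theorem restrict_eq_sum (h0 : volume (frontier Ω) = 0) :
    volume.restrict Ω = ∑ T ∈ 𝒯.cells, volume.restrict (simplex T) := by
  have h1 : volume.restrict Ω = volume.restrict (closure Ω) :=
    (Measure.restrict_congr_set (closure_ae_eq_of_null_frontier h0)).symm
  rw [h1, ← 𝒯.cover]
  have h2 : ⋃ T ∈ 𝒯.cells, convexHull ℝ (T : Set (E d)) = ⋃ T : 𝒯.cells, simplex T.1 := by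
    rw [iUnion_subtype]; rfl
  rw [h2, Measure.restrict_iUnion_ae, Measure.sum_fintype]
  · exact Finset.sum_coe_sort 𝒯.cells (fun T => volume.restrict (simplex T))
  · intro T T' h
    exact aedisjoint T.2 T'.2 fun h' => h (Subtype.ext h')
  · exact fun T => (measurableSet_simplex _).nullMeasurableSet

theorem simplex_inter_ae_eq (h0 : volume (frontier Ω) = 0) {T : Finset (E d)} (hT : T ∈ 𝒯.cells) :
    (simplex T ∩ Ω : Set (E d)) =ᵐ[volume] simplex T := by
  refine Filter.EventuallyLE.antisymm (LE.le.eventuallyLE inter_subset_left) ?_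
  filter_upwards [closure_ae_eq_of_null_frontier h0] with x hx hxT
  exact ⟨hxT, hx.mp (simplex_subset hT hxT)⟩

theorem integral_eq_sum (h0 : volume (frontier Ω) = 0) {F : Type*} [NormedAddCommGroup F]
    [NormedSpace ℝ F] {f : E d → F} (hf : Integrable f (volume.restrict Ω)) :
    ∫ x in Ω, f x = ∑ T ∈ 𝒯.cells, ∫ x in simplex T, f x := by
  rw [restrict_eq_sum (𝒯 := 𝒯) h0] at hf ⊢
  exact integral_finsetSum_measure (integrable_finsetSum_measure.1 hf)

theorem cellDiam_le_size {T : Finset (E d)} (hT : T ∈ 𝒯.cells) : cellDiam T ≤ 𝒯.size :=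
  le_ciSup (f := fun T : 𝒯.cells => cellDiam T.1) (finite_range _).bddAbove ⟨T, hT⟩

theorem dist_le_size {T : Finset (E d)} (hT : T ∈ 𝒯.cells) {x y : E d} (hx : x ∈ simplex T)
    (hy : y ∈ simplex T) : dist x y ≤ 𝒯.size :=
  (Metric.dist_le_diam_of_mem (isCompact_simplex T).isBounded hx hy).trans (cellDiam_le_size hT)

theorem cells_nonempty (hn : Ω.Nonempty) : 𝒯.cells.Nonempty := by
  obtain ⟨x, hx⟩ := hn
  have := subset_closure hx
  rw [← 𝒯.cover, mem_iUnion₂] at this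
  obtain ⟨T, hT, -⟩ := this
  exact ⟨T, hT⟩

theorem cell_nonempty {T : Finset (E d)} (hT : T ∈ 𝒯.cells) : T.Nonempty :=
  Finset.card_pos.1 (by rw [𝒯.card_cell T hT]; omega)

theorem cellDiam_pos (hd : 0 < d) {T : Finset (E d)} (hT : T ∈ 𝒯.cells) : 0 < cellDiam T := by
  obtain ⟨a, ha, b, hb, hab⟩ := Finset.one_lt_card.1 (by rw [𝒯.card_cell T hT]; omega : 1 < T.card)
  exact (dist_pos.2 hab).trans_le (Metric.dist_le_diam_of_mem (isCompact_simplex T).isBounded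
    (subset_simplex T ha) (subset_simplex T hb))

theorem size_pos (hd : 0 < d) (hn : Ω.Nonempty) : 0 < 𝒯.size := by
  obtain ⟨T, hT⟩ := cells_nonempty (𝒯 := 𝒯) hn
  exact (cellDiam_pos hd hT).trans_le (cellDiam_le_size hT)

theorem size_le (hb : Bornology.IsBounded Ω) {R : ℝ} (hR0 : 0 ≤ R) (hR : ∀ x ∈ Ω, ∀ y ∈ Ω, dist x y ≤ R) : 𝒯.size ≤ R := by
  refine Real.iSup_le (fun T => Metric.diam_le_of_forall_dist_le hR0 fun x hx y hy => ?_) hR0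
  calc dist x y ≤ Metric.diam (closure Ω) := Metric.dist_le_diam_of_mem hb.closure
        (simplex_subset T.2 hx) (simplex_subset T.2 hy)
    _ = Metric.diam Ω := Metric.diam_closure Ω
    _ ≤ R := Metric.diam_le_of_forall_dist_le hR0 hR

/-- Half the supremum is enough for volume bounds and avoids showing that the supremum is attained.
The set of radii is bounded because a ball of radius `r` contains two points at distance `r`. -/
theorem exists_closedBall_subset (hd : 0 < d) {T : Finset (E d)} (hT : T ∈ 𝒯.cells) :
    0 < inradius T ∧ ∃ x, ∃ r, inradius T / 2 ≤ r ∧ 0 ≤ r ∧ Metric.closedBall x r ⊆ simplex T := by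
  set S : Set ℝ := {r : ℝ | 0 ≤ r ∧ ∃ x, Metric.closedBall x r ⊆ simplex T} with hS
  have hbdd : BddAbove S := by
    refine ⟨cellDiam T, ?_⟩
    rintro r ⟨hr, x, hx⟩
    let e : E d := EuclideanSpace.single ⟨0, hd⟩ 1
    have he : ‖r • e‖ = r := by
      simp [e, norm_smul, hr]
    have h1 : x + r • e ∈ Metric.closedBall x r := by simp [he]
    have h2 : x ∈ Metric.closedBall x r := Metric.mem_closedBall_self hr
    have h3 := Metric.dist_le_diam_of_mem (isCompact_simplex T).isBounded (hx h1) (hx h2)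
    rwa [dist_eq_norm, add_sub_cancel_left, he] at h3
  obtain ⟨x, hx⟩ := interior_simplex_nonempty hT
  obtain ⟨ε, hε, hball⟩ := Metric.isOpen_iff.1 isOpen_interior x hx
  have hmem : ε / 2 ∈ S := ⟨by positivity, x, (Metric.closedBall_subset_ball (by linarith)).trans
    (hball.trans interior_subset)⟩
  have hpos : 0 < inradius T := lt_of_lt_of_le (by positivity) (le_csSup hbdd hmem)
  obtain ⟨r, ⟨hr0, y, hy⟩, hr⟩ := exists_lt_of_lt_csSup ⟨_, hmem⟩ (half_lt_self hpos)
  exact ⟨hpos, y, r, hr.le, hr0, hy⟩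

/-- The lower bound for the volume of a cell of an admissible mesh of size one. -/
noncomputable def volConst (d : ℕ) (γqu γsr : ℝ) : ℝ :=
  (γqu / (4 * max γsr 1)) ^ d * volume.real (Metric.ball (0 : E d) 1)

theorem volConst_pos {γqu γsr : ℝ} (h : 0 < γqu) : 0 < volConst d γqu γsr := by
  have : 0 < max γsr 1 := by positivity
  have := volume_real_ball_pos (d := d)
  unfold volConst
  positivity

theorem volConst_mul_le (hd : 0 < d) (hn : Ω.Nonempty) {γqu γsr : ℝ} (hγ : 0 < γqu)
    (hqu : 𝒯.QuasiUniform γqu) (hsr : 𝒯.ShapeRegular γsr) {T : Finset (E d)} (hT : T ∈ 𝒯.cells) :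
    volConst d γqu γsr * 𝒯.size ^ d ≤ volume.real (simplex T) := by
  obtain ⟨hpos, x, r, hr, hr0, hball⟩ := exists_closedBall_subset hd hT
  refine le_trans ?_ (pow_mul_le_volume_of_closedBall_subset (volume_simplex_ne_top T) hr0 hball)
  have hM : 0 < max γsr 1 := by positivity
  have h1 : cellDiam T / (2 * inradius T) ≤ max γsr 1 := (hsr T hT).trans (le_max_left _ _)
  rw [div_le_iff₀ (by positivity)] at h1
  have h2 := hqu T hT
  -- The factor `4` combines `r ≥ inradius T / 2` with `cellDiam T ≤ 2 * inradius T * max γsr 1`.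
  -- The maximum with `1` keeps the denominator positive for every real `γsr`.
  have h3 : γqu / (4 * max γsr 1) * 𝒯.size ≤ r := by
    rw [div_mul_eq_mul_div, div_le_iff₀ (by positivity)]
    nlinarith
  have h4 := (size_pos (𝒯 := 𝒯) hd hn).le
  have h5 := (volume_real_ball_pos (d := d)).le
  calc volConst d γqu γsr * 𝒯.size ^ d
      = (γqu / (4 * max γsr 1) * 𝒯.size) ^ d * volume.real (Metric.ball (0 : E d) 1) := by
        rw [volConst, mul_pow]; ring
    _ ≤ _ := by gcongr

open Classical in
/-- The cells that meet a set. -/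
noncomputable def meeting (𝒯 : Mesh Ω) (S : Set (E d)) : Finset (Finset (E d)) :=
  𝒯.cells.filter fun K => (simplex K ∩ S).Nonempty

theorem mem_meeting {S : Set (E d)} {K : Finset (E d)} :
    K ∈ 𝒯.meeting S ↔ K ∈ 𝒯.cells ∧ (simplex K ∩ S).Nonempty := by simp [meeting]

/-- The bound for the number of cells that meet a ball of radius `𝒯.size`. -/
noncomputable def cardConst (d : ℕ) (γqu γsr : ℝ) : ℝ :=
  2 ^ d * volume.real (Metric.ball (0 : E d) 1) / volConst d γqu γsr

theorem cardConst_pos {γqu γsr : ℝ} (h : 0 < γqu) : 0 < cardConst d γqu γsr := by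
  have := volume_real_ball_pos (d := d)
  have := volConst_pos (d := d) (γsr := γsr) h
  unfold cardConst
  positivity

theorem simplex_subset_of_meeting {S : Set (E d)} {x : E d}
    (hS : S ⊆ Metric.closedBall x 𝒯.size) {K : Finset (E d)} (hK : K ∈ 𝒯.meeting S) :
    simplex K ⊆ Metric.closedBall x (2 * 𝒯.size) := fun y hy => by
  obtain ⟨hK, z, hzK, hzS⟩ := mem_meeting.1 hK
  have h1 := dist_le_size hK hy hzK
  have h2 : dist z x ≤ 𝒯.size := hS hzS
  have h3 := dist_triangle y z x
  rw [Metric.mem_closedBall]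
  linarith

/-- Packing: these cells lie in a ball of radius `2 * 𝒯.size`, overlap in null sets only, and each
has volume at least `volConst * 𝒯.size ^ d`. -/
theorem card_meeting_le (hd : 0 < d) (hn : Ω.Nonempty) {γqu γsr : ℝ} (hγ : 0 < γqu)
    (hqu : 𝒯.QuasiUniform γqu) (hsr : 𝒯.ShapeRegular γsr) {S : Set (E d)} {x : E d}
    (hS : S ⊆ Metric.closedBall x 𝒯.size) :
    ((𝒯.meeting S).card : ℝ) ≤ cardConst d γqu γsr := by
  have hH := size_pos (𝒯 := 𝒯) hd hn
  have hc := volConst_pos (d := d) (γsr := γsr) hγ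
  rw [cardConst, le_div_iff₀ hc]
  refine le_of_mul_le_mul_right ?_ (pow_pos hH d)
  calc ((𝒯.meeting S).card : ℝ) * volConst d γqu γsr * 𝒯.size ^ d
      = ∑ K ∈ 𝒯.meeting S, volConst d γqu γsr * 𝒯.size ^ d := by
        rw [Finset.sum_const, nsmul_eq_mul, mul_assoc]
    _ ≤ ∑ K ∈ 𝒯.meeting S, volume.real (simplex K) :=
        Finset.sum_le_sum fun K hK => volConst_mul_le hd hn hγ hqu hsr (mem_meeting.1 hK).1
    _ = volume.real (⋃ K ∈ 𝒯.meeting S, simplex K) := by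
        rw [Measure.real, measure_biUnion_finset₀, ENNReal.toReal_sum]
        · rfl
        · exact fun K _ => volume_simplex_ne_top K
        · exact fun K hK K' hK' h => aedisjoint (mem_meeting.1 hK).1 (mem_meeting.1 hK').1 h
        · exact fun K _ => (measurableSet_simplex K).nullMeasurableSet
    _ ≤ volume.real (Metric.closedBall x (2 * 𝒯.size)) :=
        measureReal_mono (iUnion₂_subset fun K hK => simplex_subset_of_meeting hS hK)
          Metric.isBounded_closedBall.measure_lt_top.ne
    _ = _ := by
        rw [volume_real_closedBall x (by positivity), mul_pow]; ring

theorem simplex_subset_closedBall {T : Finset (E d)} (hT : T ∈ 𝒯.cells) :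
    ∃ x, simplex T ⊆ Metric.closedBall x 𝒯.size := by
  obtain ⟨x, hx⟩ := cell_nonempty hT
  exact ⟨x, fun y hy => dist_le_size hT hy (subset_simplex T hx)⟩

theorem patch_eq (T : Finset (E d)) : 𝒯.patch T = ⋃ K ∈ 𝒯.meeting (simplex T), simplex K := by
  unfold patch
  ext x
  simp [mem_meeting]

end Mesh

/-! ### Global stability -/

theorem setIntegral_biUnion_le {ι : Type*} (s : Finset ι) {D : ι → Set (E d)} {f : E d → ℝ}
    (hf : 0 ≤ f) (hi : ∀ i ∈ s, IntegrableOn f (D i)) :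
    ∫ x in ⋃ i ∈ s, D i, f x ≤ ∑ i ∈ s, ∫ x in D i, f x := by
  rw [← integral_finsetSum_measure hi]
  refine integral_mono_measure ?_ (Filter.Eventually.of_forall hf)
    (integrable_finsetSum_measure.2 hi)
  refine Measure.le_iff.2 fun A hA => ?_
  rw [Measure.restrict_apply hA, inter_iUnion₂, Measure.finsetSum_apply]
  refine (measure_biUnion_finset_le s _).trans (Finset.sum_le_sum fun i _ => ?_)
  rw [Measure.restrict_apply hA]

theorem normSqOn_nonneg {F : Type} [NormedAddCommGroup F] (S : Set (E d))
    (f : Lp F 2 (volume.restrict Ω)) : 0 ≤ normSqOn S f :=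
  integral_nonneg fun _ => sq_nonneg _

theorem Mesh.sum_normSqOn {F : Type} [NormedAddCommGroup F] (𝒯 : Mesh Ω)
    (h0 : volume (frontier Ω) = 0) (f : Lp F 2 (volume.restrict Ω)) :
    ∑ T ∈ 𝒯.cells, normSqOn (simplex T) f = ‖f‖ ^ 2 := by
  rw [← integral_norm_sq_eq, Mesh.integral_eq_sum (𝒯 := 𝒯) h0 (integrable_norm_sq f)]
  refine Finset.sum_congr rfl fun T hT => ?_
  rw [normSqOn, Measure.restrict_congr_set (Mesh.simplex_inter_ae_eq h0 hT)]

/-- Finite overlap: after exchanging the sums, a cell `K` is counted once for each cell that meets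
it. -/
theorem Mesh.sum_normSqOn_patch_le {F : Type} [NormedAddCommGroup F] {𝒯 : Mesh Ω} (hd : 0 < d)
    (hn : Ω.Nonempty) (h0 : volume (frontier Ω) = 0) {γqu γsr : ℝ} (hγ : 0 < γqu)
    (hqu : 𝒯.QuasiUniform γqu) (hsr : 𝒯.ShapeRegular γsr) (f : Lp F 2 (volume.restrict Ω)) :
    ∑ T ∈ 𝒯.cells, normSqOn (𝒯.patch T) f ≤ cardConst d γqu γsr * ‖f‖ ^ 2 := by
  calc ∑ T ∈ 𝒯.cells, normSqOn (𝒯.patch T) f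
      ≤ ∑ T ∈ 𝒯.cells, ∑ K ∈ 𝒯.meeting (simplex T), normSqOn (simplex K) f := by
        refine Finset.sum_le_sum fun T hT => ?_
        rw [normSqOn, Mesh.patch_eq, iUnion₂_inter]
        refine setIntegral_biUnion_le _ (fun x => sq_nonneg _) fun K _ => ?_
        exact (integrable_norm_sq f).mono_measure (Measure.restrict_mono inter_subset_right le_rfl)
    _ = ∑ K ∈ 𝒯.cells, ∑ T ∈ 𝒯.meeting (simplex K), normSqOn (simplex K) f := by
        refine Finset.sum_comm' fun T K => ?_
        simp only [Mesh.mem_meeting, inter_comm (simplex T)]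
        tauto
    _ ≤ ∑ K ∈ 𝒯.cells, cardConst d γqu γsr * normSqOn (simplex K) f := by
        refine Finset.sum_le_sum fun K hK => ?_
        rw [Finset.sum_const, nsmul_eq_mul]
        obtain ⟨x, hx⟩ := Mesh.simplex_subset_closedBall hK
        exact mul_le_mul_of_nonneg_right (Mesh.card_meeting_le hd hn hγ hqu hsr hx)
          (normSqOn_nonneg _ _)
    _ = _ := by rw [← Finset.mul_sum, Mesh.sum_normSqOn 𝒯 h0]

/-- The local bounds are summed over the cells. Overlap costs the factor `cardConst`, and the mesh
size is at most `R`, which removes the weight of the divergence. -/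
theorem exists_isGloballyStable (hd : 0 < d) (hΩ : IsLipschitzDomain Ω)
    (hpoly : HasPolygonalBoundary Ω) (k : ℕ) {γqu : ℝ} (γsr : ℝ) (hγ : 0 < γqu) {C : ℝ}
    (hC : 0 < C) : ∃ Cstab : ℝ, 0 < Cstab ∧
      ∀ (𝒯 : Mesh Ω) (π : H0div Ω → H0div Ω), 𝒯.QuasiUniform γqu → 𝒯.ShapeRegular γsr →
        IsStableCommutingProjection 𝒯 k C π → IsGloballyStable Cstab π := by
  obtain ⟨R, hR0, hR⟩ := exists_dist_le hΩ.isBounded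
  have hN := Mesh.cardConst_pos (d := d) (γsr := γsr) hγ
  have h0 := hpoly.volume_frontier
  have hn := hΩ.isConnected.nonempty
  refine ⟨C * (Mesh.cardConst d γqu γsr * (1 + R ^ 2)), by positivity,
    fun 𝒯 π hqu hsr hπ v => ?_⟩
  set N := Mesh.cardConst d γqu γsr
  have hH : 𝒯.size ^ 2 ≤ R ^ 2 := by
    have := (Mesh.size_pos (𝒯 := 𝒯) hd hn).le
    have := Mesh.size_le (𝒯 := 𝒯) hΩ.isBounded hR0.le hR
    gcongr
  calc ‖(π v : L2V Ω)‖ ^ 2 = ∑ T ∈ 𝒯.cells, normSqOn (simplex T) (π v : L2V Ω) :=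
        (Mesh.sum_normSqOn 𝒯 h0 _).symm
    _ ≤ ∑ T ∈ 𝒯.cells, C * (normSqOn (𝒯.patch T) (v : L2V Ω)
          + 𝒯.size ^ 2 * normSqOn (𝒯.patch T) (weakDiv Ω (v : L2V Ω))) := by
        refine Finset.sum_le_sum fun T hT => le_trans ?_ (hπ.stable v T hT)
        exact le_add_of_nonneg_right (mul_nonneg (sq_nonneg _) (normSqOn_nonneg _ _))
    _ = C * (∑ T ∈ 𝒯.cells, normSqOn (𝒯.patch T) (v : L2V Ω)
          + 𝒯.size ^ 2 * ∑ T ∈ 𝒯.cells, normSqOn (𝒯.patch T) (weakDiv Ω (v : L2V Ω))) := by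
        rw [← Finset.mul_sum, Finset.sum_add_distrib, Finset.mul_sum]
    _ ≤ C * (N * ‖(v : L2V Ω)‖ ^ 2 + R ^ 2 * (N * ‖weakDiv Ω (v : L2V Ω)‖ ^ 2)) := by
        have h1 := Mesh.sum_normSqOn_patch_le hd hn h0 hγ hqu hsr (v : L2V Ω)
        have h2 := Mesh.sum_normSqOn_patch_le hd hn h0 hγ hqu hsr (weakDiv Ω (v : L2V Ω))
        have h3 : 0 ≤ ∑ T ∈ 𝒯.cells, normSqOn (𝒯.patch T) (weakDiv Ω (v : L2V Ω)) :=
          Finset.sum_nonneg fun T _ => normSqOn_nonneg _ _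
        gcongr
    _ ≤ C * (N * (1 + R ^ 2)) * (‖(v : L2V Ω)‖ ^ 2 + ‖weakDiv Ω (v : L2V Ω)‖ ^ 2) := by
        rw [mul_assoc]
        refine mul_le_mul_of_nonneg_left ?_ hC.le
        have : 0 ≤ N * (R ^ 2 * ‖(v : L2V Ω)‖ ^ 2 + ‖weakDiv Ω (v : L2V Ω)‖ ^ 2) := by positivity
        nlinarith

end RTInfSup


namespace RTInfSup
variable {d : ℕ} {ι : Type*}

/-! ### Barycentric coordinates and integrals over simplices -/

theorem integrableOn_of_continuous {F : Type*} [NormedAddCommGroup F] {K : Set (E d)}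
    (hK : IsCompact K) {f : E d → F} (hf : Continuous f) : IntegrableOn f K :=
  hf.continuousOn.integrableOn_compact hK

/-- The closed simplex spanned by an affine basis. -/
def hull (b : AffineBasis ι ℝ (E d)) : Set (E d) := convexHull ℝ (range b)

theorem mem_hull {b : AffineBasis ι ℝ (E d)} {x : E d} : x ∈ hull b ↔ ∀ j, 0 ≤ b.coord j x := by
  rw [hull, b.convexHull_eq_nonneg_coord]; rfl

/-- The linear part of a barycentric coordinate. -/
noncomputable def coordDeriv (b : AffineBasis ι ℝ (E d)) (j : ι) : E d →L[ℝ] ℝ :=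
  LinearMap.toContinuousLinearMap (b.coord j).linear

theorem coordDeriv_sub (b : AffineBasis ι ℝ (E d)) (j : ι) (x y : E d) :
    coordDeriv b j (x - y) = b.coord j x - b.coord j y := by
  change (b.coord j).linear (x - y) = _
  rw [← vsub_eq_sub, AffineMap.linearMap_vsub, vsub_eq_sub]

variable [Fintype ι]

theorem isCompact_hull (b : AffineBasis ι ℝ (E d)) : IsCompact (hull b) :=
  (finite_range b).isCompact_convexHull ℝ

theorem measurableSet_hull (b : AffineBasis ι ℝ (E d)) : MeasurableSet (hull b) :=
  (isCompact_hull b).isClosed.measurableSet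

theorem volume_hull_pos (b : AffineBasis ι ℝ (E d)) : 0 < volume.real (hull b) := by
  refine ENNReal.toReal_pos (Measure.measure_pos_of_nonempty_interior _ ?_).ne'
    (isCompact_hull b).measure_lt_top.ne
  rw [hull, interior_convexHull_nonempty_iff_affineSpan_eq_top]
  exact b.tot

theorem hasFDerivAt_coord (b : AffineBasis ι ℝ (E d)) (j : ι) (x : E d) :
    HasFDerivAt (b.coord j) (coordDeriv b j) x := by
  have h : (b.coord j : E d → ℝ) = fun y => coordDeriv b j y + b.coord j 0 := by
    ext y
    have := coordDeriv_sub b j y 0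
    rw [sub_zero] at this
    rw [this]; ring
  rw [h]
  exact (coordDeriv b j).hasFDerivAt.add_const _

theorem contDiff_coord (b : AffineBasis ι ℝ (E d)) (j : ι) : ContDiff ℝ ∞ (b.coord j) := by
  have h : (b.coord j : E d → ℝ) = fun y => coordDeriv b j y + b.coord j 0 := by
    ext y
    have := coordDeriv_sub b j y 0
    rw [sub_zero] at this
    rw [this]; ring
  rw [h]
  exact (coordDeriv b j).contDiff.add contDiff_const

theorem continuous_coord (b : AffineBasis ι ℝ (E d)) (j : ι) : Continuous (b.coord j) :=
  (contDiff_coord b j).continuous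

theorem coord_sum_smul (b : AffineBasis ι ℝ (E d)) {w : ι → ℝ} (hw : ∑ j, w j = 1) (i : ι) :
    b.coord i (∑ j, w j • b j) = w i := by
  rw [← Finset.affineCombination_eq_linear_combination Finset.univ b w hw]
  exact b.coord_apply_combination_of_mem (Finset.mem_univ i) hw

/-- The affine map that sends one affine basis to another. -/
noncomputable def baryMap (b b' : AffineBasis ι ℝ (E d)) (x : E d) : E d :=
  ∑ j, b.coord j x • b' j

theorem coord_baryMap (b b' : AffineBasis ι ℝ (E d)) (x : E d) (i : ι) :
    b'.coord i (baryMap b b' x) = b.coord i x :=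
  coord_sum_smul b' (b.sum_coord_apply_eq_one x) i

theorem baryMap_baryMap (b b' : AffineBasis ι ℝ (E d)) (x : E d) :
    baryMap b' b (baryMap b b' x) = x := by
  conv_rhs => rw [← b.linear_combination_coord_eq_self x]
  unfold baryMap
  exact Finset.sum_congr rfl fun j _ => by rw [← coord_baryMap b b' x j]; rfl

theorem baryMap_image_hull (b b' : AffineBasis ι ℝ (E d)) : baryMap b b' '' hull b = hull b' := by
  ext y
  constructor
  · rintro ⟨x, hx, rfl⟩
    exact mem_hull.2 fun j => by rw [coord_baryMap]; exact mem_hull.1 hx j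
  · intro hy
    refine ⟨baryMap b' b y, mem_hull.2 fun j => ?_, baryMap_baryMap b' b y⟩
    rw [coord_baryMap]; exact mem_hull.1 hy j

/-- The derivative of `baryMap`. -/
noncomputable def baryDeriv (b b' : AffineBasis ι ℝ (E d)) : E d →L[ℝ] E d :=
  ∑ j, (coordDeriv b j).smulRight (b' j)

theorem hasFDerivAt_baryMap (b b' : AffineBasis ι ℝ (E d)) (x : E d) :
    HasFDerivAt (baryMap b b') (baryDeriv b b') x :=
  HasFDerivAt.fun_sum fun j _ => (hasFDerivAt_coord b j x).smul_const (b' j)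

theorem baryDeriv_sub (b b' : AffineBasis ι ℝ (E d)) (x y : E d) :
    baryDeriv b b' (x - y) = baryMap b b' x - baryMap b b' y := by
  simp only [baryDeriv, baryMap, sum_apply, ContinuousLinearMap.smulRight_apply,
    coordDeriv_sub, sub_smul, Finset.sum_sub_distrib]

theorem contDiff_baryMap (b b' : AffineBasis ι ℝ (E d)) : ContDiff ℝ ∞ (baryMap b b') :=
  ContDiff.sum fun j _ => (contDiff_coord b j).smul contDiff_const

theorem integral_hull_eq (b b' : AffineBasis ι ℝ (E d)) (F : E d → ℝ) :
    ∫ x in hull b', F x = |(baryDeriv b b').det| * ∫ x in hull b, F (baryMap b b' x) := by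
  rw [← baryMap_image_hull b b', integral_image_eq_integral_abs_det_fderiv_smul volume
    (measurableSet_hull b) (fun x _ => (hasFDerivAt_baryMap b b' x).hasFDerivWithinAt)
    (Function.LeftInverse.injective (baryMap_baryMap b b')).injOn]
  simp only [smul_eq_mul]
  rw [integral_const_mul]

/-- Averages over simplices are invariant under affine maps. -/
theorem average_hull_eq (b b' : AffineBasis ι ℝ (E d)) (F : E d → ℝ) :
    ⨍ x in hull b', F x = ⨍ x in hull b, F (baryMap b b' x) := by
  have h1 := integral_hull_eq b b' (fun _ => 1)
  simp only [integral_const, smul_eq_mul, mul_one, measureReal_restrict_apply_univ] at h1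
  have hp := volume_hull_pos b
  have hp' := volume_hull_pos b'
  rw [setAverage_eq, setAverage_eq, integral_hull_eq b b', h1, smul_eq_mul, smul_eq_mul]
  have : |(baryDeriv b b').det| ≠ 0 := fun h => by rw [h, zero_mul] at h1; exact hp'.ne' h1
  field_simp

/-! ### The divergence theorem for fields pointing away from a vertex -/

section Cone
variable (b : AffineBasis ι ℝ (E d)) (i : ι)

/-- The dilation with centre `b i` and factor `s`. -/
noncomputable def dilate (s : ℝ) (x : E d) : E d := b i + s • (x - b i)

theorem coord_dilate (s : ℝ) (x : E d) (j : ι) :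
    b.coord j (dilate b i s x) = b.coord j (b i) + s * (b.coord j x - b.coord j (b i)) := by
  have := coordDeriv_sub b j (dilate b i s x) (b i)
  rw [dilate, add_sub_cancel_left, map_smul, coordDeriv_sub, smul_eq_mul] at this
  rw [dilate]; linarith

variable {b i}

theorem integral_dilate {s : ℝ} (hs : 0 < s) (F : E d → ℝ) :
    s ^ d * ∫ x in hull b, F (dilate b i s x) = ∫ x in dilate b i s '' hull b, F x := by
  have hd : ∀ x, HasFDerivAt (dilate b i s) (s • ContinuousLinearMap.id ℝ (E d)) x := fun x =>
    (((hasFDerivAt_id x).sub_const (b i)).const_smul s).const_add (b i)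
  have hinj : Function.Injective (dilate b i s) := fun x y h => by
    simpa [dilate, hs.ne'] using h
  rw [integral_image_eq_integral_abs_det_fderiv_smul volume (measurableSet_hull b)
    (fun x _ => (hd x).hasFDerivWithinAt) hinj.injOn]
  have : (s • ContinuousLinearMap.id ℝ (E d)).det = s ^ d := by
    change LinearMap.det (s • LinearMap.id) = s ^ d
    rw [LinearMap.det_smul, LinearMap.det_id, finrank_euclideanSpace_fin, mul_one]
  simp only [this, smul_eq_mul, abs_of_pos (pow_pos hs d)]
  rw [integral_const_mul]

theorem dilate_image_subset {s : ℝ} (hs : 0 < s) (hs1 : s ≤ 1) :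
    dilate b i s '' hull b ⊆ hull b := by
  rintro _ ⟨x, hx, rfl⟩
  refine mem_hull.2 fun j => ?_
  rw [coord_dilate]
  have h1 := mem_hull.1 hx j
  have h2 : 0 ≤ b.coord j (b i) := by
    classical
    rw [b.coord_apply]; split_ifs <;> norm_num
  nlinarith

/-- Undoing the dilation keeps the coordinates `j ≠ i` nonnegative, and coordinate `i` stays
nonnegative as soon as it was at least `1 - s`. -/
theorem coord_lt_of_notMem {s : ℝ} (hs : 0 < s) {x : E d} (hx : x ∈ hull b)
    (hx' : x ∉ dilate b i s '' hull b) : b.coord i x < 1 - s := by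
  by_contra h
  push Not at h
  refine hx' ⟨dilate b i s⁻¹ x, mem_hull.2 fun j => ?_, ?_⟩
  · rw [coord_dilate]
    have h1 := mem_hull.1 hx j
    have hsi : 0 < s⁻¹ := by positivity
    rcases eq_or_ne j i with rfl | hj
    · rw [b.coord_apply_eq]
      have : s⁻¹ * (b.coord j x - 1) = s⁻¹ * (b.coord j x - (1 - s)) - 1 := by field_simp; ring
      rw [this]
      have := mul_nonneg hsi.le (sub_nonneg.2 h)
      linarith
    · rw [b.coord_apply_ne hj]
      simp only [sub_zero, zero_add]
      positivity
  · simp only [dilate, add_sub_cancel_left, smul_smul, mul_inv_cancel₀ hs.ne', one_smul]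
    abel

/-- The integrand is the divergence of `η(x) (x - b i)`. This field is tangential to the faces
through `b i`, and the bound on `η` makes it vanish on the opposite face, so its total flux is zero.
The proof needs no surface integrals: `g s` is the integral of `η` over the copy of the simplex
dilated by `s`, and `g' 1` is the integral in question. The shell left out has volume `O(1 - s)`,
and there `η = O(1 - s)`; so `g s - g 1 = O((1 - s)²)` and `g' 1 = 0`. -/
theorem integral_cone_eq_zero {η : E d → ℝ} (hη : ContDiff ℝ ∞ η) {C : ℝ} 
    (hC : ∀ x ∈ hull b, |η x| ≤ C * b.coord i x) :
    ∫ x in hull b, (d * η x + fderiv ℝ η x (x - b i)) = 0 := by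
  set K := hull b with hK
  have hKc : IsCompact K := isCompact_hull b
  have hKfin : volume K ≠ ⊤ := hKc.measure_lt_top.ne
  have : IsFiniteMeasure (volume.restrict K) := ⟨by simpa using hKfin.lt_top⟩
  have hC0 : 0 ≤ C := by
    have h1 : b i ∈ K := subset_convexHull ℝ _ (mem_range_self i)
    have h2 := hC _ h1
    rw [b.coord_apply_eq, mul_one] at h2
    exact (abs_nonneg _).trans h2
  set g : ℝ → ℝ := fun s => s ^ d * ∫ x in K, η (dilate b i s x) with hg
  have hcont : ∀ s, Continuous (dilate b i s) := fun s => by unfold dilate; fun_prop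
  have hηd : Differentiable ℝ η := hη.differentiable (by simp)
  have hDη : Continuous (fderiv ℝ η) := hη.continuous_fderiv (by simp)
  have hd1 : ∀ x, dilate b i 1 x = x := fun x => by simp [dilate]
  -- the derivative of `g` at `1`
  have hder : HasDerivAt g (∫ x in K, (d * η x + fderiv ℝ η x (x - b i))) 1 := by
    have hF : Continuous fun p : ℝ × E d => fderiv ℝ η (dilate b i p.1 p.2) (p.2 - b i) := by
      refine (hDη.comp ?_).clm_apply (by fun_prop)
      unfold dilate; fun_prop
    obtain ⟨M, hM⟩ := (isCompact_Icc (a := (0 : ℝ)) (b := 2)).prod hKc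
      |>.exists_bound_of_continuousOn hF.continuousOn
    have h1 := (hasDerivAt_integral_of_dominated_loc_of_deriv_le (μ := volume.restrict K)
      (s := Ioo (0 : ℝ) 2) (x₀ := (1 : ℝ)) (F := fun s x => η (dilate b i s x))
      (F' := fun s x => fderiv ℝ η (dilate b i s x) (x - b i)) (bound := fun _ => M)
      (Ioo_mem_nhds (by norm_num) (by norm_num)) ?_ ?_ ?_ ?_ ?_ ?_).2
    · have h2 := (hasDerivAt_pow d (1 : ℝ)).mul h1
      have e : ∫ x in K, (d * η x + fderiv ℝ η x (x - b i))
          = (d * 1 ^ (d - 1)) * (∫ x in K, η (dilate b i 1 x))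
            + 1 ^ d * ∫ x in K, fderiv ℝ η (dilate b i 1 x) (x - b i) := by
        simp only [hd1, one_pow, mul_one, one_mul]
        rw [integral_add, integral_const_mul]
        · exact integrableOn_of_continuous hKc (continuous_const.mul hη.continuous)
        · refine integrableOn_of_continuous hKc ?_
          exact hDη.clm_apply (by fun_prop)
      rw [e]
      exact h2
    · exact Filter.Eventually.of_forall fun s =>
        (hη.continuous.comp (hcont s)).aestronglyMeasurable
    · exact integrableOn_of_continuous hKc (hη.continuous.comp (hcont 1))
    · exact (hF.comp (by fun_prop : Continuous fun x : E d => ((1 : ℝ), x))).aestronglyMeasurable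
    · refine (ae_restrict_iff' hKc.isClosed.measurableSet).2 (Filter.Eventually.of_forall
        fun x hx s hs => hM (s, x) ⟨⟨hs.1.le, hs.2.le⟩, hx⟩)
    · exact integrable_const M
    · refine Filter.Eventually.of_forall fun x s _ => ?_
      have h3 : HasDerivAt (fun s => dilate b i s x) (x - b i) s := by
        simpa [dilate] using ((hasDerivAt_id s).smul_const (x - b i)).const_add (b i)
      exact (hηd _).hasFDerivAt.comp_hasDerivAt s h3
  -- `g` is constant at `1` to second order, from the left
  have hest : ∀ s ∈ Ioo (0 : ℝ) 1, |g s - g 1| ≤ C * volume.real K * d * (s - 1) ^ 2 := by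
    intro s hs
    have hsub := dilate_image_subset (b := b) (i := i) hs.1 hs.2.le
    have hmeas : MeasurableSet (dilate b i s '' K) :=
      ((hKc.image (hcont s)).isClosed).measurableSet
    have hint : IntegrableOn η K := integrableOn_of_continuous hKc hη.continuous
    have e1 : g s = ∫ x in dilate b i s '' K, η x := integral_dilate hs.1 η
    have e2 : g 1 = ∫ x in K, η x := by simp [hg, hd1]
    have e3 : g 1 - g s = ∫ x in K \ dilate b i s '' K, η x := by
      rw [e1, e2, setIntegral_sdiff hmeas hint hsub]
    have e4 : volume.real (K \ dilate b i s '' K) = (1 - s ^ d) * volume.real K := by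
      have h5 := integral_dilate (b := b) (i := i) hs.1 (fun _ => 1)
      simp only [integral_const, smul_eq_mul, mul_one, measureReal_restrict_apply_univ] at h5
      rw [measureReal_sdiff hsub hmeas hKfin, ← h5]
      ring
    have e5 : ‖∫ x in K \ dilate b i s '' K, η x‖
        ≤ C * (1 - s) * volume.real (K \ dilate b i s '' K) := by
      refine norm_setIntegral_le_of_norm_le_const
        ((measure_mono sdiff_subset).trans_lt hKfin.lt_top) fun x hx => ?_
      refine (hC x hx.1).trans ?_
      gcongr
      exact (coord_lt_of_notMem hs.1 hx.1 hx.2).le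
    -- Bernoulli's inequality: the relative volume of the shell is at most `d * (1 - s)`.
    have e6 : 1 - s ^ d ≤ d * (1 - s) := by
      have := one_add_mul_le_pow (a := s - 1) (by linarith [hs.1]) d
      rw [add_sub_cancel] at this
      linarith
    rw [abs_sub_comm, e3, ← Real.norm_eq_abs]
    refine e5.trans ?_
    rw [e4]
    have h7 : 0 ≤ 1 - s := by linarith [hs.2]
    have h8 := (volume_hull_pos b).le
    calc C * (1 - s) * ((1 - s ^ d) * volume.real K)
        ≤ C * (1 - s) * ((d * (1 - s)) * volume.real K) := by gcongr
      _ = _ := by ring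
  have hzero : HasDerivWithinAt g 0 (Iic 1) 1 := by
    have hO : (fun s => g s - g 1) =O[nhdsWithin 1 (Iic 1)] fun s => ‖s - 1‖ ^ 2 := by
      refine Asymptotics.IsBigO.of_bound (C * volume.real K * d) ?_
      have : Ioi (0 : ℝ) ∈ nhdsWithin 1 (Iic 1) := nhdsWithin_le_nhds (Ioi_mem_nhds one_pos)
      filter_upwards [this, self_mem_nhdsWithin] with s h0 h1
      rw [Real.norm_eq_abs, norm_pow, norm_norm, Real.norm_eq_abs, sq_abs]
      rcases eq_or_lt_of_le (show s ≤ 1 from h1) with rfl | h1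
      · simp
      · exact hest s ⟨h0, h1⟩
    have h9 := (hO.hasFDerivWithinAt (by simp) one_lt_two).hasDerivWithinAt
    have h10 := h9.add_const (g 1)
    simpa using h10
  -- The quadratic estimate is available only for `s ≤ 1`; the left derivative already determines
  -- the derivative.
  exact (uniqueDiffWithinAt_Iic 1).eq_deriv _ hder.hasDerivWithinAt hzero

end Cone

/-- The flux of a test function through a face, computed from either side. -/
theorem average_flux_eq {b b' : AffineBasis ι ℝ (E d)} {i : ι} (h : ∀ j, j ≠ i → b j = b' j)
    {ψ : E d → ℝ} (hψ : ContDiff ℝ ∞ ψ) (hc : HasCompactSupport ψ) :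
    ⨍ x in hull b, (d * ψ x + fderiv ℝ ψ x (x - b i))
      = ⨍ x in hull b', (d * ψ x + fderiv ℝ ψ x (x - b' i)) := by
  classical
  set A := baryMap b b' with hA
  have hAi : A (b i) = b' i := by
    rw [hA, baryMap, Finset.sum_eq_single i]
    · rw [b.coord_apply_eq, one_smul]
    · intro j _ hj
      rw [b.coord_apply_ne hj, zero_smul]
    · simp
  -- `A` moves `x` by a multiple of its `i`-th coordinate, so it fixes the common face pointwise.
  have hAx : ∀ x, A x - x = b.coord i x • (b' i - b i) := fun x => by
    conv_lhs => rw [← b.linear_combination_coord_eq_self x]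
    rw [hA, b.linear_combination_coord_eq_self x]
    conv_lhs => enter [2]; rw [← b.linear_combination_coord_eq_self x]
    rw [baryMap, ← Finset.sum_sub_distrib, Finset.sum_eq_single i]
    · rw [smul_sub]
    · intro j _ hj
      rw [h j hj, sub_self]
    · simp
  have hψd : Differentiable ℝ ψ := hψ.differentiable (by simp)
  have hηc : ContDiff ℝ ∞ fun x => ψ (A x) := hψ.comp (contDiff_baryMap b b')
  -- `A` is affine and sends `b i` to `b' i`, so the radial derivative of `ψ ∘ A` about `b i` is
  -- that of `ψ` about `b' i`.
  have hD : ∀ x, fderiv ℝ (fun x => ψ (A x)) x (x - b i) = fderiv ℝ ψ (A x) (A x - b' i) :=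
    fun x => by
    have := ((hψd (A x)).hasFDerivAt.comp x (hasFDerivAt_baryMap b b' x)).fderiv
    change (fderiv ℝ (ψ ∘ A) x) (x - b i) = _
    rw [this, ContinuousLinearMap.comp_apply, baryDeriv_sub, ← hA, hAi]
  obtain ⟨L, hL⟩ := hψ.lipschitzWith_of_hasCompactSupport hc (by simp)
  -- `ψ` is Lipschitz, so `ψ ∘ A - ψ` is bounded by a multiple of the `i`-th coordinate and carries
  -- no flux.
  have hcone := integral_cone_eq_zero (b := b) (i := i) (hηc.sub hψ)
    (C := L * ‖b' i - b i‖) fun x hx => by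
      have h1 := hL.dist_le_mul (A x) x
      rw [dist_eq_norm, dist_eq_norm, hAx, norm_smul, Real.norm_eq_abs, Real.norm_eq_abs,
        abs_of_nonneg (mem_hull.1 hx i)] at h1
      refine h1.trans_eq ?_
      ring
  have hfd : ∀ x, fderiv ℝ (fun x => ψ (A x) - ψ x) x
      = fderiv ℝ (fun x => ψ (A x)) x - fderiv ℝ ψ x := fun x =>
    fderiv_fun_sub (hηc.differentiable (by simp) x) (hψd x)
  rw [average_hull_eq b b', setAverage_eq, setAverage_eq]
  congr 1
  rw [eq_comm, ← sub_eq_zero, ← integral_sub]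
  · rw [← hcone]
    refine integral_congr_ae (Filter.Eventually.of_forall fun x => ?_)
    simp only [hfd, sub_apply, hD]
    ring
  · refine integrableOn_of_continuous (isCompact_hull b) ?_
    have hAc : Continuous A := (contDiff_baryMap b b').continuous
    have := hψ.continuous
    exact (continuous_const.mul (this.comp hAc)).add
      (((hψ.continuous_fderiv (by simp)).comp hAc).clm_apply (hAc.sub continuous_const))
  · refine integrableOn_of_continuous (isCompact_hull b) ?_
    exact (continuous_const.mul hψ.continuous).add
      ((hψ.continuous_fderiv (by simp)).clm_apply (continuous_id.sub continuous_const))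

end RTInfSup


namespace RTInfSup
open MvPolynomial

variable {d : ℕ}

/-! ### Divergences of interior fields in barycentric coordinates -/

/-- The divergence of `P (x - b i)` for a homogeneous polynomial `P` of degree `k` in the
barycentric coordinates. -/
noncomputable def coneDiv (d k : ℕ) (i : Fin (d + 1)) :
    MvPolynomial (Fin (d + 1)) ℝ →ₗ[ℝ] MvPolynomial (Fin (d + 1)) ℝ :=
  ((k : ℝ) + d) • LinearMap.id
    - (LinearMap.mulLeft ℝ (∑ j, X j)).comp (pderiv i).toLinearMap

theorem coneDiv_apply (k : ℕ) (i : Fin (d + 1)) (P : MvPolynomial (Fin (d + 1)) ℝ) :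
    coneDiv d k i P = ((k : ℝ) + d) • P - (∑ j, X j) * pderiv i P := rfl

/-- The divergence of `∑ i, P i (x - b i)`. -/
noncomputable def sumConeDiv (d k : ℕ) :
    (Fin (d + 1) → MvPolynomial (Fin (d + 1)) ℝ) →ₗ[ℝ] MvPolynomial (Fin (d + 1)) ℝ :=
  ∑ i, (coneDiv d k i).comp (LinearMap.proj i)

theorem sumConeDiv_apply (k : ℕ) (P : Fin (d + 1) → MvPolynomial (Fin (d + 1)) ℝ) :
    sumConeDiv d k P = ∑ i, coneDiv d k i (P i) := by
  simp [sumConeDiv]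

/-- The coefficients of fields `∑ i, P i (x - b i)` with vanishing normal trace: `P i` vanishes on
the face opposite to the vertex `b i`. -/
def interiorCoeffs (d k : ℕ) : Submodule ℝ (Fin (d + 1) → MvPolynomial (Fin (d + 1)) ℝ) where
  carrier := {P | ∀ i, (P i).IsHomogeneous k ∧ X i ∣ P i}
  add_mem' h h' i := ⟨(h i).1.add (h' i).1, (h i).2.add (h' i).2⟩
  zero_mem' i := ⟨isHomogeneous_zero _ _ _, dvd_zero _⟩
  smul_mem' c P h i := by
    refine ⟨(homogeneousSubmodule _ ℝ k).smul_mem c (h i).1, ?_⟩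
    rw [Pi.smul_apply, MvPolynomial.smul_eq_C_mul]
    exact (h i).2.mul_left _

theorem single_mem_interiorCoeffs {k : ℕ} {i : Fin (d + 1)} {P : MvPolynomial (Fin (d + 1)) ℝ}
    (h : P.IsHomogeneous k) (hX : X i ∣ P) : Pi.single i P ∈ interiorCoeffs d k := by
  intro j
  rcases eq_or_ne j i with rfl | hj
  · rw [Pi.single_eq_same]; exact ⟨h, hX⟩
  · rw [Pi.single_eq_of_ne hj]; exact ⟨isHomogeneous_zero _ _ _, dvd_zero _⟩

theorem sumConeDiv_single (k : ℕ) (i : Fin (d + 1)) (P : MvPolynomial (Fin (d + 1)) ℝ) :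
    sumConeDiv d k (Pi.single i P) = coneDiv d k i P := by
  rw [sumConeDiv_apply, Finset.sum_eq_single i]
  · rw [Pi.single_eq_same]
  · intro j _ hj
    rw [Pi.single_eq_of_ne hj, map_zero]
  · simp

/-- The normalisation by `β i + 1` makes the last term independent of `i`, so the difference of two
such divergences involves two monomials only. -/
theorem coneDiv_monomial (k : ℕ) (β : Fin (d + 1) →₀ ℕ) (i : Fin (d + 1)) :
    coneDiv d k i (monomial (β + Finsupp.single i 1) ((β i + 1 : ℝ)⁻¹))
      = ((k : ℝ) + d) • monomial (β + Finsupp.single i 1) ((β i + 1 : ℝ)⁻¹)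
        - (∑ j, X j) * monomial β 1 := by
  rw [coneDiv_apply, pderiv_monomial]
  congr 3
  · simp
  · have : (β i + 1 : ℝ) ≠ 0 := by positivity
    simp [inv_mul_cancel₀ this]

/-- Modulo divergences every monomial is a multiple of `X 0 ^ k`. -/
theorem exists_monomial_sub_mem (k : ℕ) (α : Fin (d + 1) →₀ ℕ) (hα : α.degree = k) :
    ∃ c : ℝ, monomial α 1 - c • monomial (Finsupp.single 0 k) 1
      ∈ (interiorCoeffs d k).map (sumConeDiv d k) := by
  set S := (interiorCoeffs d k).map (sumConeDiv d k) with hS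
  induction hn : k - α 0 using Nat.strong_induction_on generalizing α with
  | _ n ih =>
  by_cases h0 : ∃ a, a ≠ 0 ∧ α a ≠ 0
  · obtain ⟨a, ha, haα⟩ := h0
    -- One unit of exponent is moved from the index `a` to the index `0`; the induction is on the
    -- degree not yet carried by `X 0`.
    obtain ⟨β, rfl⟩ : ∃ β, α = β + Finsupp.single a 1 :=
      ⟨α - Finsupp.single a 1, (tsub_add_cancel_of_le (by
        rw [Finsupp.single_le_iff]; omega)).symm⟩
    have hβ : β.degree + 1 = k := by
      rw [← hα, map_add, Finsupp.degree_single]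
    have hβ0 : β 0 ≤ β.degree := Finsupp.le_degree 0 β
    have hα' : (β + Finsupp.single 0 1).degree = k := by
      rw [map_add, Finsupp.degree_single, hβ]
    obtain ⟨c, hc⟩ := ih (k - (β + Finsupp.single 0 1 : Fin (d + 1) →₀ ℕ) 0) (by
      rw [← hn]; simp only [Finsupp.add_apply, Finsupp.single_eq_same,
        Finsupp.single_eq_of_ne ha.symm]; omega) _ hα' rfl
    have hkd : ((k : ℝ) + d) ≠ 0 := by
      have : 0 < k := by omega
      positivity
    have hmem : ∀ i, ((k : ℝ) + d) • monomial (β + Finsupp.single i 1) ((β i + 1 : ℝ)⁻¹)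
        - (∑ j, X j) * monomial β 1 ∈ S := fun i => by
      rw [← coneDiv_monomial, ← sumConeDiv_single]
      refine Submodule.mem_map_of_mem (single_mem_interiorCoeffs ?_ ?_)
      · refine isHomogeneous_monomial _ ?_
        rw [map_add, Finsupp.degree_single, hβ]
      · rw [← mul_one ((β i + 1 : ℝ)⁻¹), ← monomial_mul]
        exact Dvd.intro_left _ rfl
    -- The common term cancels, leaving a combination of the old and the new monomial; the scaling
    -- by `(β a + 1) / (k + d)` gives the old one coefficient `1`.
    have hdiff := S.sub_mem (hmem a) (hmem 0)
    rw [sub_sub_sub_cancel_right, ← smul_sub] at hdiff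
    have hdiff' := S.smul_mem ((β a + 1 : ℝ) * ((k : ℝ) + d)⁻¹) hdiff
    have hc' := S.smul_mem ((β a + 1 : ℝ) * (β 0 + 1 : ℝ)⁻¹) hc
    refine ⟨(β a + 1 : ℝ) * (β 0 + 1 : ℝ)⁻¹ * c, ?_⟩
    convert S.add_mem hdiff' hc' using 1
    have h1 : (β a + 1 : ℝ) ≠ 0 := by positivity
    have e1 : ∀ γ (r : ℝ), monomial γ r = r • (monomial γ 1 : MvPolynomial (Fin (d + 1)) ℝ) :=
      fun γ r => by rw [smul_monomial, smul_eq_mul, mul_one]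
    rw [e1 _ ((β a + 1 : ℝ)⁻¹), e1 _ ((β 0 + 1 : ℝ)⁻¹)]
    simp only [smul_sub, smul_smul]
    have e2 : (β a + 1 : ℝ) * ((k : ℝ) + d)⁻¹ * ((k : ℝ) + d) * (β a + 1 : ℝ)⁻¹ = 1 := by
      field_simp
    have e3 : (β a + 1 : ℝ) * ((k : ℝ) + d)⁻¹ * ((k : ℝ) + d) * (β 0 + 1 : ℝ)⁻¹
        = (β a + 1 : ℝ) * (β 0 + 1 : ℝ)⁻¹ := by field_simp
    simp only [← mul_assoc]
    rw [e2, e3, one_smul]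
    abel
  · push Not at h0
    have : α = Finsupp.single 0 k := by
      have h1 : α = Finsupp.single 0 (α 0) := by
        ext j
        rcases eq_or_ne j 0 with rfl | hj
        · simp
        · rw [h0 j hj, Finsupp.single_eq_of_ne hj]
      rw [h1, Finsupp.degree_single] at hα
      rw [h1, hα]
    refine ⟨1, ?_⟩
    rw [this, one_smul, sub_self]
    exact S.zero_mem

/-- The value at `x` of a polynomial in the barycentric coordinates. -/
noncomputable def baryVal (b : AffineBasis (Fin (d + 1)) ℝ (E d))
    (P : MvPolynomial (Fin (d + 1)) ℝ) (x : E d) : ℝ := eval (fun j => b.coord j x) P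

section BaryVal
variable (b : AffineBasis (Fin (d + 1)) ℝ (E d))

theorem contDiff_baryVal (P : MvPolynomial (Fin (d + 1)) ℝ) : ContDiff ℝ ∞ (baryVal b P) := by
  unfold baryVal
  induction P using MvPolynomial.induction_on with
  | C a => simp only [eval_C]; exact contDiff_const
  | add p q hp hq => simp only [map_add]; exact hp.add hq
  | mul_X p i hp => simp only [map_mul, eval_X]; exact hp.mul (contDiff_coord b i)

theorem hasFDerivAt_baryVal (P : MvPolynomial (Fin (d + 1)) ℝ) (x : E d) :
    HasFDerivAt (baryVal b P) (∑ j, baryVal b (pderiv j P) x • coordDeriv b j) x := by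
  unfold baryVal
  induction P using MvPolynomial.induction_on with
  | C a =>
    simp only [eval_C, pderiv_C, map_zero, zero_smul, Finset.sum_const_zero]
    exact hasFDerivAt_const a x
  | add p q hp hq =>
    simp only [map_add, add_smul, Finset.sum_add_distrib]
    exact hp.add hq
  | mul_X p i hp =>
    simp only [map_mul, eval_X]
    have e : ∑ j, eval (fun j => b.coord j x) (pderiv j (p * X i)) • coordDeriv b j
        = eval (fun j => b.coord j x) p • coordDeriv b i + b.coord i x •
          ∑ j, eval (fun j => b.coord j x) (pderiv j p) • coordDeriv b j := by
      simp only [Derivation.leibniz, smul_eq_mul, map_add, map_mul, eval_X, add_smul,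
        Finset.sum_add_distrib, pderiv_X]
      congr 1
      · rw [Finset.sum_eq_single i]
        · simp
        · intro j _ hj
          simp [Pi.single_eq_of_ne hj.symm]
        · simp
      · rw [Finset.smul_sum]
        exact Finset.sum_congr rfl fun j _ => by rw [smul_smul]
    rw [e]
    exact hp.mul (hasFDerivAt_coord b i x)

theorem baryVal_sum_X (x : E d) : baryVal b (∑ j, X j) x = 1 := by
  simp only [baryVal, map_sum, eval_X]
  exact b.sum_coord_apply_eq_one x

/-- Along `x - b i` the coordinate `λ j` has derivative `λ j x - δ i j`, so by Euler's identity `P`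
has derivative `k P - ∂ᵢ P`. The factor `∑ j, X j`, which takes the value `1`, only keeps `coneDiv`
homogeneous. -/
theorem baryVal_coneDiv {k : ℕ} {P : MvPolynomial (Fin (d + 1)) ℝ} (hP : P.IsHomogeneous k)
    (i : Fin (d + 1)) (x : E d) :
    baryVal b (coneDiv d k i P) x
      = d * baryVal b P x + fderiv ℝ (baryVal b P) x (x - b i) := by
  have hE : ∑ j, b.coord j x * baryVal b (pderiv j P) x = k * baryVal b P x := by
    have := congrArg (fun Q => baryVal b Q x) hP.sum_X_mul_pderiv
    simpa [baryVal] using this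
  have h1 : ∑ j, baryVal b (pderiv j P) x * b.coord j (b i) = baryVal b (pderiv i P) x := by
    rw [Finset.sum_eq_single i]
    · rw [b.coord_apply_eq, mul_one]
    · intro j _ hj
      rw [b.coord_apply_ne hj, mul_zero]
    · simp
  have hs := baryVal_sum_X b x
  rw [(hasFDerivAt_baryVal b P x).fderiv]
  simp only [sum_apply, smul_apply, coordDeriv_sub, smul_eq_mul, mul_sub,
    Finset.sum_sub_distrib]
  rw [h1, coneDiv_apply]
  simp_rw [mul_comm (baryVal b _ x)]
  rw [hE]
  simp only [baryVal, map_sub, smul_eval, map_mul] at hs ⊢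
  rw [hs]
  ring

/-- Divisibility by `X i` bounds `P ψ` by a multiple of the `i`-th coordinate, which is the
hypothesis of `integral_cone_eq_zero`. -/
theorem integral_coneDiv {k : ℕ} {P : MvPolynomial (Fin (d + 1)) ℝ} (hP : P.IsHomogeneous k)
    {i : Fin (d + 1)} (hX : X i ∣ P) {ψ : E d → ℝ} (hψ : ContDiff ℝ ∞ ψ) :
    ∫ x in hull b, (fderiv ℝ ψ x (baryVal b P x • (x - b i))
      + baryVal b (coneDiv d k i P) x * ψ x) = 0 := by
  obtain ⟨W, rfl⟩ := hX
  have hP1 := contDiff_baryVal b (X i * W)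
  obtain ⟨M, hM⟩ := (isCompact_hull b).exists_bound_of_continuousOn
    ((contDiff_baryVal b W).continuous.mul hψ.continuous).continuousOn
  rw [← integral_cone_eq_zero (b := b) (i := i) (hP1.mul hψ) (C := M) fun x hx => by
    have h1 := hM x hx
    have h2 := mem_hull.1 hx i
    have : baryVal b (X i * W) x * ψ x = b.coord i x * (baryVal b W x * ψ x) := by
      simp only [baryVal, map_mul, eval_X]; ring
    rw [this, abs_mul, abs_of_nonneg h2, mul_comm]
    gcongr
    exact h1]
  refine integral_congr_ae (Filter.Eventually.of_forall fun x => ?_)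
  simp only
  rw [baryVal_coneDiv b hP, fderiv_fun_mul (hP1.differentiable (by simp) x)
    (hψ.differentiable (by simp) x)]
  simp only [add_apply, smul_apply, smul_eq_mul, map_smul]
  ring

end BaryVal

end RTInfSup


/-! ### A right inverse of the divergence with simplex-independent constants -/

namespace RTInfSup
open MvPolynomial

variable {d : ℕ}

/-- The exponents of the monomials of degree `k` in the barycentric coordinates. -/
def baryExps (d k : ℕ) : Finset (Fin (d + 1) →₀ ℕ) := Finset.univ.finsuppAntidiag k

theorem mem_baryExps {k : ℕ} {α : Fin (d + 1) →₀ ℕ} : α ∈ baryExps d k ↔ α.degree = k := by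
  rw [baryExps, Finset.mem_finsuppAntidiag, Finsupp.degree_eq_sum]
  simp

/-- The polynomial with given coefficients. -/
noncomputable def ofCoeffs {k : ℕ} (w : baryExps d k → ℝ) : MvPolynomial (Fin (d + 1)) ℝ :=
  ∑ α, w α • monomial α.1 1

theorem isHomogeneous_ofCoeffs {k : ℕ} (w : baryExps d k → ℝ) : (ofCoeffs w).IsHomogeneous k :=
  (homogeneousSubmodule _ ℝ k).sum_mem fun α _ => (homogeneousSubmodule _ ℝ k).smul_mem _
    (isHomogeneous_monomial _ (mem_baryExps.1 α.2))

theorem coeff_ofCoeffs {k : ℕ} (w : baryExps d k → ℝ) (α : baryExps d k) :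
    coeff α.1 (ofCoeffs w) = w α := by
  classical
  rw [ofCoeffs, coeff_sum, Finset.sum_eq_single α]
  · simp
  · intro β _ hβ
    rw [coeff_smul, coeff_monomial, if_neg fun h => hβ (Subtype.ext h), smul_zero]
  · simp

theorem ofCoeffs_coeff {k : ℕ} {Q : MvPolynomial (Fin (d + 1)) ℝ} (hQ : Q.IsHomogeneous k) :
    ofCoeffs (fun α : baryExps d k => coeff α.1 Q) = Q := by
  rw [ofCoeffs, Finset.sum_coe_sort (baryExps d k) (fun α => coeff α Q • monomial α (1 : ℝ))]
  conv_rhs => rw [Q.as_sum]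
  have e : ∀ α, coeff α Q • monomial α (1 : ℝ) = monomial α (coeff α Q) := fun α => by
    rw [smul_monomial, smul_eq_mul, mul_one]
  simp_rw [e]
  refine (Finset.sum_subset (fun α hα => ?_) fun α _ hα => ?_).symm
  · rw [mem_baryExps, Finsupp.degree_eq_weight_one]
    exact hQ (mem_support_iff.1 hα)
  · rw [notMem_support_iff.1 hα, monomial_zero]

section
variable (b : AffineBasis (Fin (d + 1)) ℝ (E d))

theorem eval_smul_of_isHomogeneous {k : ℕ} {Q : MvPolynomial (Fin (d + 1)) ℝ}
    (hQ : Q.IsHomogeneous k) (t : ℝ) (y : Fin (d + 1) → ℝ) :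
    eval (t • y) Q = t ^ k * eval y Q := by
  rw [eval_eq', eval_eq', Finset.mul_sum]
  refine Finset.sum_congr rfl fun α hα => ?_
  have h : α.degree = k := by
    rw [Finsupp.degree_eq_weight_one]
    exact hQ (mem_support_iff.1 hα)
  rw [Finsupp.degree_eq_sum] at h
  simp only [Pi.smul_apply, smul_eq_mul, mul_pow, Finset.prod_mul_distrib]
  rw [Finset.prod_pow_eq_pow_sum, h]
  ring

/-- Barycentric coordinates only reach points with sum `1`. Homogeneity rescales any positive vector
to such a point, so `Q` vanishes on the positive orthant. -/
theorem eq_zero_of_baryVal_eq_zero {k : ℕ} {Q : MvPolynomial (Fin (d + 1)) ℝ}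
    (hQ : Q.IsHomogeneous k) (h : ∀ x ∈ interior (hull b), baryVal b Q x = 0) : Q = 0 := by
  refine MvPolynomial.funext_set (fun _ => Ioi (0 : ℝ)) (fun _ => Ioi_infinite 0) fun y hy => ?_
  have hy' : ∀ j, 0 < y j := fun j => hy j (mem_univ j)
  set t := ∑ j, y j with ht
  have ht0 : 0 < t := Finset.sum_pos (fun j _ => hy' j) Finset.univ_nonempty
  have hw : ∑ j, y j / t = 1 := by rw [← Finset.sum_div, div_self ht0.ne']
  have hmem : ∑ j, (y j / t) • b j ∈ interior (hull b) := by
    rw [hull, b.interior_convexHull]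
    intro j
    rw [coord_sum_smul b hw]
    exact div_pos (hy' j) ht0
  have h1 := h _ hmem
  simp only [baryVal, coord_sum_smul b hw] at h1
  have h2 : y = t • fun j => y j / t := by
    ext j; simp only [Pi.smul_apply, smul_eq_mul]; field_simp
  rw [h2, eval_smul_of_isHomogeneous hQ, h1, mul_zero, map_zero]

theorem average_baryVal_sq_eq (b' : AffineBasis (Fin (d + 1)) ℝ (E d))
    (Q : MvPolynomial (Fin (d + 1)) ℝ) :
    ⨍ x in hull b', baryVal b' Q x ^ 2 = ⨍ x in hull b, baryVal b Q x ^ 2 := by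
  rw [average_hull_eq b b']
  simp only [baryVal, coord_baryMap]

end

/-- Equivalence of norms for homogeneous polynomials on a simplex, uniformly in the simplex. -/
theorem exists_coeff_bound (d k : ℕ) : ∃ C : ℝ, 0 ≤ C ∧
    ∀ (b : AffineBasis (Fin (d + 1)) ℝ (E d)) (w : baryExps d k → ℝ),
      ‖w‖ ^ 2 ≤ C * ⨍ x in hull b, baryVal b (ofCoeffs w) x ^ 2 := by
  -- The comparison is made on one reference simplex; averages of functions of barycentric
  -- coordinates are the same on every simplex.
  obtain ⟨b₀⟩ : Nonempty (AffineBasis (Fin (d + 1)) ℝ (E d)) :=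
    AffineBasis.exists_affineBasis_of_finiteDimensional (by simp)
  set K := hull b₀ with hK
  have hKc := isCompact_hull b₀
  set q : (baryExps d k → ℝ) → ℝ := fun w => ∫ x in K, baryVal b₀ (ofCoeffs w) x ^ 2 with hq
  have hval : ∀ w x, baryVal b₀ (ofCoeffs w) x = ∑ α : baryExps d k, w α * baryVal b₀ (monomial α.1 1) x :=
    fun w x => by simp only [baryVal, ofCoeffs, map_sum, smul_eval]
  have hqc : Continuous q := by
    refine continuous_parametric_integral_of_continuous (μ := volume) ?_ hKc
    simp only [Function.uncurry_def, hval]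
    have : ∀ α : baryExps d k, Continuous (baryVal b₀ (monomial α.1 1)) := fun α =>
      (contDiff_baryVal b₀ _).continuous
    fun_prop
  have hqpos : ∀ w, w ≠ 0 → 0 < q w := fun w hw => by
    have hc : Continuous (baryVal b₀ (ofCoeffs w)) := (contDiff_baryVal b₀ _).continuous
    refine lt_of_le_of_ne (integral_nonneg fun x => sq_nonneg _) fun h0 => hw ?_
    rw [eq_comm, hq, setIntegral_eq_zero_iff_of_nonneg_ae
      (Filter.Eventually.of_forall fun x => sq_nonneg _)
      (integrableOn_of_continuous hKc (hc.pow 2))] at h0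
    have h1 : (fun x => baryVal b₀ (ofCoeffs w) x ^ 2) =ᵐ[volume.restrict (interior K)] 0 :=
      ae_mono (Measure.restrict_mono interior_subset le_rfl) h0
    have h2 := Measure.eqOn_open_of_ae_eq h1 isOpen_interior (hc.pow 2).continuousOn
      continuousOn_const
    have h3 := eq_zero_of_baryVal_eq_zero b₀ (isHomogeneous_ofCoeffs w) fun x hx =>
      pow_eq_zero_iff two_ne_zero |>.1 (h2 hx)
    ext α
    rw [← coeff_ofCoeffs w α, h3, coeff_zero]; rfl
  have hqhom : ∀ (c : ℝ) w, q (c • w) = c ^ 2 * q w := fun c w => by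
    simp only [hq]
    rw [← integral_const_mul]
    refine integral_congr_ae (Filter.Eventually.of_forall fun x => ?_)
    simp only [hval, Pi.smul_apply, smul_eq_mul, mul_assoc, ← Finset.mul_sum, mul_pow]
  have hvol := volume_hull_pos b₀
  -- The positive definite quadratic form `q` attains a positive minimum on the unit sphere; the
  -- sphere is empty only if there are no nonzero coefficient vectors.
  obtain ⟨m, hm, hmq⟩ : ∃ m : ℝ, 0 < m ∧ ∀ w, m * ‖w‖ ^ 2 ≤ q w := by
    rcases (Metric.sphere (0 : baryExps d k → ℝ) 1).eq_empty_or_nonempty with he | hne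
    · refine ⟨1, one_pos, fun w => ?_⟩
      have : w = 0 := by
        by_contra hw
        have : ‖w‖⁻¹ • w ∈ Metric.sphere (0 : baryExps d k → ℝ) 1 := by
          simp [norm_smul, hw]
        rw [he] at this
        exact this
      rw [this]; simp only [norm_zero]
      have : 0 ≤ q 0 := integral_nonneg fun x => sq_nonneg _
      linarith
    · obtain ⟨w₀, hw₀, hmin⟩ := (isCompact_sphere (0 : baryExps d k → ℝ) 1).exists_isMinOn hne
        hqc.continuousOn
      have hw₀' : w₀ ≠ 0 := fun h => by simp [h] at hw₀
      refine ⟨q w₀, hqpos w₀ hw₀', fun w => ?_⟩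
      by_cases hw : w = 0
      · rw [hw]
        have : 0 ≤ q 0 := integral_nonneg fun x => sq_nonneg _
        simpa using this
      · have h1 : ‖w‖⁻¹ • w ∈ Metric.sphere (0 : baryExps d k → ℝ) 1 := by
          simp [norm_smul, hw]
        have h2 : q w₀ ≤ q (‖w‖⁻¹ • w) := hmin h1
        rw [hqhom, inv_pow, inv_mul_eq_div, le_div_iff₀ (by positivity)] at h2
        exact h2
  refine ⟨volume.real K / m, by positivity, fun b w => ?_⟩
  rw [average_baryVal_sq_eq b₀ b, setAverage_eq, smul_eq_mul, div_mul_eq_mul_div, le_div_iff₀ hm,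
    ← mul_assoc, mul_inv_cancel₀ hvol.ne', one_mul, mul_comm]
  exact hmq w

theorem integral_sumConeDiv (b : AffineBasis (Fin (d + 1)) ℝ (E d)) {k : ℕ}
    {P : Fin (d + 1) → MvPolynomial (Fin (d + 1)) ℝ} (hP : P ∈ interiorCoeffs d k) {ψ : E d → ℝ}
    (hψ : ContDiff ℝ ∞ ψ) :
    ∫ x in hull b, (fderiv ℝ ψ x (∑ i, baryVal b (P i) x • (x - b i))
      + baryVal b (sumConeDiv d k P) x * ψ x) = 0 := by
  have e : ∀ x, fderiv ℝ ψ x (∑ i, baryVal b (P i) x • (x - b i))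
      + baryVal b (sumConeDiv d k P) x * ψ x
      = ∑ i, (fderiv ℝ ψ x (baryVal b (P i) x • (x - b i))
        + baryVal b (coneDiv d k i (P i)) x * ψ x) := fun x => by
    rw [Finset.sum_add_distrib, map_sum, sumConeDiv_apply, ← Finset.sum_mul]
    simp only [baryVal, map_sum]
  simp_rw [e]
  rw [integral_finsetSum]
  · exact Finset.sum_eq_zero fun i _ => integral_coneDiv b (hP i).1 (hP i).2 hψ
  · intro i _
    refine integrableOn_of_continuous (isCompact_hull b) ?_
    have h1 := (contDiff_baryVal b (P i)).continuous
    have h2 := (contDiff_baryVal b (coneDiv d k i (P i))).continuous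
    exact ((hψ.continuous_fderiv (by simp)).clm_apply
      (h1.smul (continuous_id.sub continuous_const))).add (h2.mul hψ.continuous)

theorem abs_baryVal_sum_smul_le (b : AffineBasis (Fin (d + 1)) ℝ (E d)) {κ : Type*} [Fintype κ]
    (w : κ → ℝ) (p : κ → MvPolynomial (Fin (d + 1)) ℝ) {M : ℝ} {x : E d}
    (h : ∀ α, |baryVal b (p α) x| ≤ M) :
    |baryVal b (∑ α, w α • p α) x| ≤ Fintype.card κ * M * ‖w‖ := by
  have e : baryVal b (∑ α, w α • p α) x = ∑ α, w α * baryVal b (p α) x := by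
    simp only [baryVal, map_sum, smul_eval]
  rw [e]
  refine (Finset.abs_sum_le_sum_abs _ _).trans ?_
  refine (Finset.sum_le_card_nsmul _ _ (‖w‖ * M) fun α _ => ?_).trans_eq ?_
  · rw [abs_mul]
    have h1 : |w α| ≤ ‖w‖ := norm_le_pi_norm w α
    exact mul_le_mul h1 (h α) (abs_nonneg _) (norm_nonneg _)
  · rw [nsmul_eq_mul, Finset.card_univ]; ring

theorem integral_X_pow_pos (b : AffineBasis (Fin (d + 1)) ℝ (E d)) (k : ℕ) :
    0 < ∫ x in hull b, baryVal b (monomial (Finsupp.single 0 k) 1) x := by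
  have hval : ∀ x, baryVal b (monomial (Finsupp.single 0 k) 1) x = b.coord 0 x ^ k := fun x => by
    rw [baryVal, eval_monomial]; simp
  simp_rw [hval]
  have hc : Continuous fun x => b.coord 0 x ^ k := (continuous_coord b 0).pow k
  rw [setIntegral_pos_iff_support_of_nonneg_ae]
  · have hint : interior (hull b) ⊆ (Function.support fun x => b.coord 0 x ^ k) ∩ hull b := by
      intro x hx
      refine ⟨?_, interior_subset hx⟩
      rw [hull, b.interior_convexHull] at hx
      exact (pow_pos (hx 0) k).ne'
    refine lt_of_lt_of_le ?_ (measure_mono hint)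
    refine isOpen_interior.measure_pos volume ?_
    rw [hull, interior_convexHull_nonempty_iff_affineSpan_eq_top]
    exact b.tot
  · exact (ae_restrict_iff' (measurableSet_hull b)).2 (Filter.Eventually.of_forall fun x hx =>
      pow_nonneg (mem_hull.1 hx 0) k)
  · exact integrableOn_of_continuous (isCompact_hull b) hc

/-- The field for each monomial is chosen once, independently of any simplex. There are finitely
many, so one bound `M` holds on the unit cube, which contains the barycentric coordinates of all
points of a simplex. -/
theorem exists_monomial_data (d k : ℕ) : ∃ (c : baryExps d k → ℝ)
    (P : baryExps d k → Fin (d + 1) → MvPolynomial (Fin (d + 1)) ℝ) (M : ℝ), 0 ≤ M ∧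
    (∀ α, P α ∈ interiorCoeffs d k) ∧
    (∀ α, sumConeDiv d k (P α) = monomial α.1 1 - c α • monomial (Finsupp.single 0 k) 1) ∧
    ∀ α i, ∀ y ∈ Icc (0 : Fin (d + 1) → ℝ) 1, |eval y (P α i)| ≤ M := by
  have hex : ∀ α : baryExps d k, ∃ c : ℝ, ∃ P ∈ interiorCoeffs d k,
      sumConeDiv d k P = monomial α.1 1 - c • monomial (Finsupp.single 0 k) 1 := fun α => by
    obtain ⟨c, P, hP, h⟩ := exists_monomial_sub_mem k α.1 (mem_baryExps.1 α.2)
    exact ⟨c, P, hP, h⟩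
  choose c P hP hdiv using hex
  have : ∀ α i, ∃ M : ℝ, ∀ y ∈ Icc (0 : Fin (d + 1) → ℝ) 1, |eval y (P α i)| ≤ M := fun α i =>
    isCompact_Icc.exists_bound_of_continuousOn (MvPolynomial.continuous_eval _).continuousOn
  choose M hM using this
  refine ⟨c, P, ∑ α, ∑ i, |M α i|, by positivity, hP, hdiv, fun α i y hy => (hM α i y hy).trans ?_⟩
  refine (le_abs_self _).trans ?_
  refine (Finset.single_le_sum (f := fun i => |M α i|) (fun _ _ => abs_nonneg _)
    (Finset.mem_univ i)).trans ?_
  exact Finset.single_le_sum (f := fun α => ∑ i, |M α i|) (fun _ _ => by positivity)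
    (Finset.mem_univ α)

theorem coord_mem_Icc (b : AffineBasis (Fin (d + 1)) ℝ (E d)) {x : E d} (hx : x ∈ hull b) :
    (fun j => b.coord j x) ∈ Icc (0 : Fin (d + 1) → ℝ) 1 := by
  refine ⟨fun j => mem_hull.1 hx j, fun j => ?_⟩
  rw [Pi.one_apply, ← b.sum_coord_apply_eq_one x]
  exact Finset.single_le_sum (f := fun j => b.coord j x) (fun j _ => mem_hull.1 hx j)
    (Finset.mem_univ j)

/-- Testing with `ψ = 1`, the divergence of an interior field has integral zero, as has `Q`, while
`X 0 ^ k` has positive integral. So the mean is the only obstruction to being such a divergence. -/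
theorem eq_zero_of_sumConeDiv_eq (b : AffineBasis (Fin (d + 1)) ℝ (E d)) {k : ℕ}
    {P : Fin (d + 1) → MvPolynomial (Fin (d + 1)) ℝ} (hP : P ∈ interiorCoeffs d k)
    {Q : MvPolynomial (Fin (d + 1)) ℝ} (h0 : ∫ x in hull b, baryVal b Q x = 0) {s : ℝ}
    (hD : sumConeDiv d k P = Q - s • monomial (Finsupp.single 0 k) 1) : s = 0 := by
  have h1 := integral_sumConeDiv b hP (ψ := fun _ => 1) contDiff_const
  simp only [fderiv_fun_const, Pi.zero_apply, zero_apply, zero_add, mul_one, hD] at h1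
  have h2 : ∀ x, baryVal b (Q - s • monomial (Finsupp.single 0 k) 1) x
      = baryVal b Q x - s * baryVal b (monomial (Finsupp.single 0 k) 1) x := fun x => by
    simp only [baryVal, map_sub, smul_eval]
  simp_rw [h2] at h1
  rw [integral_sub, h0, integral_const_mul, zero_sub, neg_eq_zero, mul_eq_zero] at h1
  · exact h1.resolve_right (integral_X_pow_pos b k).ne'
  · exact integrableOn_of_continuous (isCompact_hull b) (contDiff_baryVal b _).continuous
  · exact integrableOn_of_continuous (isCompact_hull b)
      (continuous_const.mul (contDiff_baryVal b _).continuous)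

theorem sumConeDiv_sum_smul {k : ℕ} {κ : Type*} [Fintype κ] (w c : κ → ℝ)
    (P : κ → Fin (d + 1) → MvPolynomial (Fin (d + 1)) ℝ) (m : κ → MvPolynomial (Fin (d + 1)) ℝ)
    (m₀ : MvPolynomial (Fin (d + 1)) ℝ) (h : ∀ α, sumConeDiv d k (P α) = m α - c α • m₀) :
    sumConeDiv d k (∑ α, w α • P α) = (∑ α, w α • m α) - (∑ α, w α * c α) • m₀ := by
  rw [map_sum, Finset.sum_smul, ← Finset.sum_sub_distrib]
  refine Finset.sum_congr rfl fun α _ => ?_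
  rw [map_smul, h, smul_sub, smul_smul]

theorem baryVal_sum_sq_le (b : AffineBasis (Fin (d + 1)) ℝ (E d)) {κ : Type*} [Fintype κ]
    (w : κ → ℝ) (P : κ → Fin (d + 1) → MvPolynomial (Fin (d + 1)) ℝ) {M : ℝ}
    (hM : ∀ α i, ∀ y ∈ Icc (0 : Fin (d + 1) → ℝ) 1, |eval y (P α i)| ≤ M)
    (i : Fin (d + 1)) {x : E d} (hx : x ∈ hull b) :
    baryVal b ((∑ α, w α • P α) i) x ^ 2 ≤ (Fintype.card κ * M) ^ 2 * ‖w‖ ^ 2 := by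
  have e : (∑ α, w α • P α) i = ∑ α, w α • P α i := by
    rw [Finset.sum_apply]
    rfl
  have h := abs_baryVal_sum_smul_le b w (fun α => P α i) (M := M)
    fun α => hM α i _ (coord_mem_Icc b hx)
  rw [e, ← sq_abs, ← mul_pow]
  exact pow_le_pow_left₀ (abs_nonneg _) h 2

/-- A right inverse of the divergence from interior fields onto mean-zero polynomials, bounded
uniformly in the simplex. -/
theorem exists_interiorCoeffs (d k : ℕ) : ∃ C : ℝ, 0 ≤ C ∧
    ∀ (b : AffineBasis (Fin (d + 1)) ℝ (E d)) (Q : MvPolynomial (Fin (d + 1)) ℝ),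
      Q.IsHomogeneous k → ∫ x in hull b, baryVal b Q x = 0 →
      ∃ P ∈ interiorCoeffs d k, sumConeDiv d k P = Q ∧
        ∀ i, ∀ x ∈ hull b, baryVal b (P i) x ^ 2 ≤ C * ⨍ x in hull b, baryVal b Q x ^ 2 := by
  obtain ⟨C, hC, hCb⟩ := exists_coeff_bound d k
  obtain ⟨c, P, M, hM0, hP, hdiv, hM⟩ := exists_monomial_data d k
  refine ⟨(Fintype.card (baryExps d k) * M) ^ 2 * C, by positivity, fun b Q hQ h0 => ?_⟩
  obtain ⟨w, hQw⟩ : ∃ w : baryExps d k → ℝ, ofCoeffs w = Q := ⟨_, ofCoeffs_coeff hQ⟩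
  have hmem : ∑ α, w α • P α ∈ interiorCoeffs d k :=
    (interiorCoeffs d k).sum_mem fun α _ => (interiorCoeffs d k).smul_mem _ (hP α)
  have hD := sumConeDiv_sum_smul w c P _ _ hdiv
  rw [← ofCoeffs, hQw] at hD
  -- The monomial fields produce `Q` up to a multiple of `X 0 ^ k`, and the zero mean of `Q` removes
  -- this multiple.
  have hs := eq_zero_of_sumConeDiv_eq b hmem h0 hD
  rw [hs, zero_smul, sub_zero] at hD
  refine ⟨∑ α, w α • P α, hmem, hD, fun i x hx => ?_⟩
  have hb2 := hCb b w
  rw [hQw] at hb2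
  refine (baryVal_sum_sq_le b w P hM i hx).trans ?_
  rw [mul_assoc]
  exact mul_le_mul_of_nonneg_left hb2 (sq_nonneg _)

end RTInfSup


/-! ### From barycentric polynomials to local Raviart–Thomas fields -/

namespace RTInfSup
open MvPolynomial

variable {d : ℕ}

section
variable (b : AffineBasis (Fin (d + 1)) ℝ (E d))

theorem sum_coord_mul_apply (x : E d) (i : Fin d) : ∑ j, b.coord j x * b j i = x i := by
  have h : (∑ j, b.coord j x • b j) i = x i := by rw [b.linear_combination_coord_eq_self x]
  rw [← h, WithLp.ofLp_sum, Finset.sum_apply]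
  rfl

theorem coordDeriv_apply (j : Fin (d + 1)) (x : E d) :
    b.coord j x = b.coord j 0 + ∑ i, coordDeriv b j (EuclideanSpace.single i 1) * x i := by
  have h := coordDeriv_sub b j x 0
  rw [sub_zero] at h
  have hx : x = ∑ i, x i • EuclideanSpace.single i (1 : ℝ) := by
    ext j
    simp [Pi.single_apply]
  have h2 : coordDeriv b j x = ∑ i, coordDeriv b j (EuclideanSpace.single i 1) * x i := by
    conv_lhs => rw [hx]
    rw [map_sum]
    refine Finset.sum_congr rfl fun i _ => ?_
    rw [map_smul, smul_eq_mul, mul_comm]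
  rw [← h2, h]; ring

/-- Polynomials in the Cartesian coordinates are homogeneous in the barycentric ones. -/
theorem exists_isHomogeneous_baryVal {k : ℕ} {p : MvPolynomial (Fin d) ℝ}
    (hp : p.totalDegree ≤ k) : ∃ Q : MvPolynomial (Fin (d + 1)) ℝ, Q.IsHomogeneous k ∧
      ∀ x, baryVal b Q x = polyVal p x := by
  -- Homogenisation: `x i` becomes `∑ j, b j i • X j`, and the missing degree is filled by powers of
  -- `∑ j, X j`, which evaluates to `1`.
  refine ⟨∑ α ∈ p.support, coeff α p • ((∏ i, (∑ j, b j i • X j) ^ α i)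
    * (∑ j, X j) ^ (k - α.degree)), ?_, fun x => ?_⟩
  · refine (homogeneousSubmodule _ ℝ k).sum_mem fun α hα =>
      (homogeneousSubmodule _ ℝ k).smul_mem _ ?_
    have hdeg : α.degree ≤ k := by
      have := le_totalDegree hα
      rw [Finsupp.degree_eq_sum]
      rw [Finsupp.sum_fintype _ _ fun _ => rfl] at this
      exact this.trans hp
    have h1 : (∏ i, (∑ j, b j i • (X j : MvPolynomial (Fin (d + 1)) ℝ)) ^ α i).IsHomogeneous
        (∑ i, 1 * α i) := by
      refine IsHomogeneous.prod _ _ _ fun i _ => IsHomogeneous.pow ?_ _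
      exact (homogeneousSubmodule _ ℝ 1).sum_mem fun j _ =>
        (homogeneousSubmodule _ ℝ 1).smul_mem _ (isHomogeneous_X ℝ j)
    have h2 : ((∑ j, (X j : MvPolynomial (Fin (d + 1)) ℝ)) ^ (k - α.degree)).IsHomogeneous
        (1 * (k - α.degree)) :=
      IsHomogeneous.pow ((homogeneousSubmodule _ ℝ 1).sum_mem fun j _ => isHomogeneous_X ℝ j) _
    have h3 := h1.mul h2
    have e : ∑ i, 1 * α i + 1 * (k - α.degree) = k := by
      simp only [one_mul]
      rw [← Finsupp.degree_eq_sum]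
      omega
    rwa [e] at h3
  · rw [polyVal, eval_eq', baryVal, map_sum]
    refine Finset.sum_congr rfl fun α _ => ?_
    have h1 : ∑ j, b.coord j x = 1 := b.sum_coord_apply_eq_one x
    simp only [smul_eval, map_mul, map_prod, map_pow, map_sum, eval_X, h1, one_pow, mul_one]
    congr 1
    refine Finset.prod_congr rfl fun i _ => ?_
    rw [← sum_coord_mul_apply b x i]
    simp_rw [mul_comm]

/-- Homogeneous polynomials in the barycentric coordinates are polynomials in the Cartesian
ones. -/
theorem exists_polyVal_eq {k : ℕ} {Q : MvPolynomial (Fin (d + 1)) ℝ} (hQ : Q.IsHomogeneous k) :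
    ∃ p : MvPolynomial (Fin d) ℝ, p.totalDegree ≤ k ∧ ∀ x, polyVal p x = baryVal b Q x := by
  have hL : ∀ j, (C (b.coord j 0) + ∑ i, C (coordDeriv b j (EuclideanSpace.single i 1)) * X i :
      MvPolynomial (Fin d) ℝ).totalDegree ≤ 1 := fun j => by
    refine (totalDegree_add _ _).trans (max_le (by simp) ?_)
    refine totalDegree_finsetSum_le fun i _ => (totalDegree_mul _ _).trans ?_
    simp
  refine ⟨aeval (fun j => C (b.coord j 0)
    + ∑ i, C (coordDeriv b j (EuclideanSpace.single i 1)) * X i) Q, ?_, fun x => ?_⟩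
  · rw [aeval_def, eval₂_eq']
    refine totalDegree_finsetSum_le fun α hα => (totalDegree_mul _ _).trans ?_
    have h : α.degree = k := by
      rw [Finsupp.degree_eq_weight_one]
      exact hQ (mem_support_iff.1 hα)
    rw [Finsupp.degree_eq_sum] at h
    rw [algebraMap_eq, totalDegree_C, zero_add, ← h]
    refine (totalDegree_finsetProd _ _).trans (Finset.sum_le_sum fun j _ => ?_)
    refine (totalDegree_pow _ _).trans ?_
    exact (Nat.mul_le_mul_left _ (hL j)).trans_eq (mul_one _)
  · rw [polyVal, baryVal, eval_eq' _ Q, aeval_def, eval₂_eq', map_sum]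
    refine Finset.sum_congr rfl fun α _ => ?_
    simp only [map_mul, map_prod, map_pow, map_add, map_sum, algebraMap_eq, eval_C, eval_X]
    simp_rw [← coordDeriv_apply b]

end

theorem continuous_polyVal (p : MvPolynomial (Fin d) ℝ) : Continuous (polyVal p) :=
  (MvPolynomial.continuous_eval p).comp (by fun_prop)

/-- A right inverse of the divergence on a simplex, with values in Raviart–Thomas fields that have
vanishing normal trace. -/
theorem exists_local_field (d k : ℕ) : ∃ C : ℝ, 0 ≤ C ∧
    ∀ (b : AffineBasis (Fin (d + 1)) ℝ (E d)) (D : ℝ) (p : MvPolynomial (Fin d) ℝ),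
      p.totalDegree ≤ k → (∀ x ∈ hull b, ∀ y ∈ hull b, dist x y ≤ D) →
      ∫ x in hull b, polyVal p x = 0 →
      ∃ (w : E d → E d) (P : Fin d → MvPolynomial (Fin d) ℝ) (r : MvPolynomial (Fin d) ℝ),
        Continuous w ∧ (∀ i, (P i).totalDegree ≤ k) ∧ r.totalDegree ≤ k ∧
        (∀ x i, w x i = polyVal (P i) x + x i * polyVal r x) ∧
        (∀ ψ : E d → ℝ, ContDiff ℝ ∞ ψ →
          ∫ x in hull b, (fderiv ℝ ψ x (w x) + polyVal p x * ψ x) = 0) ∧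
        ∫ x in hull b, ‖w x‖ ^ 2 ≤ C * D ^ 2 * ∫ x in hull b, polyVal p x ^ 2 := by
  obtain ⟨C, hC, h⟩ := exists_interiorCoeffs d k
  refine ⟨(d + 1) ^ 2 * C, by positivity, fun b D p hp hD h0 => ?_⟩
  obtain ⟨Q, hQ, hQp⟩ := exists_isHomogeneous_baryVal b hp
  obtain ⟨P, hP, hdiv, hbd⟩ := h b Q hQ (by simpa only [hQp] using h0)
  choose p' hp' hpp' using fun m => exists_polyVal_eq b (hP m).1
  have hwc : Continuous fun x => ∑ m, baryVal b (P m) x • (x - b m) :=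
    continuous_finsetSum _ fun m _ => ((contDiff_baryVal b (P m)).continuous).smul
      (continuous_id.sub continuous_const)
  -- Expanding `∑ P m (x - b m)` as `x ∑ P m - ∑ P m b m` exhibits the Raviart–Thomas form.
  refine ⟨fun x => ∑ m, baryVal b (P m) x • (x - b m), fun i => ∑ m, MvPolynomial.C (-(b m i)) * p' m,
    ∑ m, p' m, hwc, fun i => ?_, ?_, fun x i => ?_, fun ψ hψ => ?_, ?_⟩
  · refine totalDegree_finsetSum_le fun m _ => (totalDegree_mul _ _).trans ?_
    rw [totalDegree_C, zero_add]
    exact hp' m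
  · exact totalDegree_finsetSum_le fun m _ => hp' m
  · have e1 : polyVal (∑ m, MvPolynomial.C (-(b m i)) * p' m) x
        = ∑ m, -(b m i) * baryVal b (P m) x := by
      simp only [← hpp', polyVal, map_sum, map_mul, eval_C]
    have e2 : polyVal (∑ m, p' m) x = ∑ m, baryVal b (P m) x := by
      simp only [← hpp', polyVal, map_sum]
    rw [e1, e2]
    rw [Finset.mul_sum, ← Finset.sum_add_distrib]
    simp only [WithLp.ofLp_sum, Finset.sum_apply, PiLp.smul_apply, PiLp.sub_apply, smul_eq_mul]
    refine Finset.sum_congr rfl fun m _ => ?_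
    ring
  · have := integral_sumConeDiv b hP hψ
    rw [hdiv] at this
    simpa only [hQp] using this
  · have hvol := volume_hull_pos b
    have hA : 0 ≤ ⨍ x in hull b, baryVal b Q x ^ 2 := by
      rw [setAverage_eq]
      exact smul_nonneg (by positivity) (integral_nonneg fun x => sq_nonneg _)
    have hpt : ∀ x ∈ hull b, ‖∑ m, baryVal b (P m) x • (x - b m)‖ ^ 2
        ≤ (d + 1) ^ 2 * (C * ⨍ x in hull b, baryVal b Q x ^ 2) * D ^ 2 := fun x hx => by
      have hD0 : 0 ≤ D := dist_nonneg.trans (hD x hx x hx)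
      -- The coefficients are bounded by the scale-free average, and `‖x - b m‖ ≤ D` supplies the
      -- factor of length.
      have h1 : ‖∑ m, baryVal b (P m) x • (x - b m)‖
          ≤ (d + 1) * (√(C * ⨍ x in hull b, baryVal b Q x ^ 2) * D) := by
        refine (norm_sum_le _ _).trans ((Finset.sum_le_card_nsmul _ _ _ fun m _ => ?_).trans_eq
          (by rw [nsmul_eq_mul, Finset.card_univ, Fintype.card_fin]; push_cast; rfl))
        rw [norm_smul, ← dist_eq_norm]
        refine mul_le_mul (Real.abs_le_sqrt (hbd m x hx)) ?_ dist_nonneg (Real.sqrt_nonneg _)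
        exact hD x hx _ (subset_convexHull ℝ _ (mem_range_self m))
      calc _ ≤ ((d + 1) * (√(C * ⨍ x in hull b, baryVal b Q x ^ 2) * D)) ^ 2 :=
            pow_le_pow_left₀ (norm_nonneg _) h1 2
        _ = _ := by
          rw [mul_pow, mul_pow, Real.sq_sqrt (mul_nonneg hC hA)]; ring
    calc ∫ x in hull b, ‖∑ m, baryVal b (P m) x • (x - b m)‖ ^ 2
        ≤ ∫ x in hull b, (d + 1) ^ 2 * (C * ⨍ x in hull b, baryVal b Q x ^ 2) * D ^ 2 := by
          refine setIntegral_mono_on ?_ ?_ (measurableSet_hull b) hpt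
          · exact integrableOn_of_continuous (isCompact_hull b) (hwc.norm.pow 2)
          · exact integrableOn_of_continuous (isCompact_hull b) continuous_const
      _ = _ := by
          rw [setIntegral_const, setAverage_eq]
          simp only [hQp, smul_eq_mul]
          field_simp

end RTInfSup


namespace RTInfSup
variable {d : ℕ} {Ω : Set (E d)}

/-! ### Piecewise functions -/

namespace Mesh
variable {𝒯 : Mesh Ω}

/-- The function that equals `w T` on the cell `T`. -/
noncomputable def glue {F : Type*} [AddCommMonoid F] (𝒯 : Mesh Ω) (w : Finset (E d) → E d → F)
    (x : E d) : F := ∑ T ∈ 𝒯.cells, (simplex T).indicator (w T) x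

theorem ae_unique (𝒯 : Mesh Ω) : ∀ᵐ x ∂(volume : Measure (E d)), ∀ T ∈ 𝒯.cells, ∀ T' ∈ 𝒯.cells,
    x ∈ simplex T → x ∈ simplex T' → T = T' := by
  rw [Filter.eventually_all_finset]
  intro T hT
  rw [Filter.eventually_all_finset]
  intro T' hT'
  by_cases h : T = T'
  · exact Filter.Eventually.of_forall fun _ _ _ => h
  · have := aedisjoint hT hT' h
    rw [AEDisjoint, ← compl_mem_ae_iff] at this
    filter_upwards [this] with x hx h1 h2
    exact absurd ⟨h1, h2⟩ hx

theorem glue_ae_eq {F : Type*} [AddCommMonoid F] (𝒯 : Mesh Ω) (w : Finset (E d) → E d → F) :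
    ∀ᵐ x ∂(volume : Measure (E d)), ∀ T ∈ 𝒯.cells, x ∈ simplex T → 𝒯.glue w x = w T x := by
  filter_upwards [𝒯.ae_unique] with x hx T hT hxT
  rw [glue, Finset.sum_eq_single_of_mem T hT, indicator_of_mem hxT]
  intro T' hT' hne
  exact indicator_of_notMem (fun h => hne (hx T' hT' T hT h hxT)) _

theorem glue_ae_eq_restrict {F : Type*} [AddCommMonoid F] (w : Finset (E d) → E d → F)
    {T : Finset (E d)} (hT : T ∈ 𝒯.cells) :
    ∀ᵐ x ∂(volume.restrict (simplex T)), 𝒯.glue w x = w T x := by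
  rw [ae_restrict_iff' (measurableSet_simplex T)]
  filter_upwards [𝒯.glue_ae_eq w] with x hx
  exact hx T hT

theorem memLp_glue {F : Type*} [NormedAddCommGroup F] [NormedSpace ℝ F]
    (hb : Bornology.IsBounded Ω) {w : Finset (E d) → E d → F} (hw : ∀ T, Continuous (w T)) :
    MemLp (𝒯.glue w) 2 (volume.restrict Ω) :=
  memLp_finsetSum _ fun T _ => (memLp_of_continuous hb (hw T)).indicator (measurableSet_simplex T)

theorem exists_mem_simplex (𝒯 : Mesh Ω) {x : E d} (hx : x ∈ closure Ω) :
    ∃ T ∈ 𝒯.cells, x ∈ simplex T := by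
  rw [← 𝒯.cover, mem_iUnion₂] at hx
  obtain ⟨T, hT, h⟩ := hx
  exact ⟨T, hT, h⟩

/-! ### Segments and chains of neighbouring cells -/

/-- The pairs of cells with a common face. -/
noncomputable def facePairs (𝒯 : Mesh Ω) : Finset (Finset (E d) × Finset (E d)) :=
  (𝒯.cells ×ˢ 𝒯.cells).filter fun e => e.1 ≠ e.2 ∧ (e.1 ∩ e.2).card = d

theorem mem_facePairs {T T' : Finset (E d)} : (T, T') ∈ 𝒯.facePairs ↔
    T ∈ 𝒯.cells ∧ T' ∈ 𝒯.cells ∧ T ≠ T' ∧ (T ∩ T').card = d := by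
  rw [facePairs, Finset.mem_filter, Finset.mem_product, and_assoc]

theorem swap_mem_facePairs {T T' : Finset (E d)} (h : (T, T') ∈ 𝒯.facePairs) :
    (T', T) ∈ 𝒯.facePairs := by
  rw [mem_facePairs] at h ⊢
  exact ⟨h.2.1, h.1, h.2.2.1.symm, by rw [Finset.inter_comm]; exact h.2.2.2⟩

/-- The set avoids all intersections of cells of codimension at least two. -/
def Avoids (𝒯 : Mesh Ω) (S : Set (E d)) : Prop :=
  ∀ T ∈ 𝒯.cells, ∀ T' ∈ 𝒯.cells, T ≠ T' → (∃ x ∈ S, x ∈ simplex T ∧ x ∈ simplex T') →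
    (T, T') ∈ 𝒯.facePairs

/-- The cells satisfying `P` and those violating it form two closed sets that cover the connected
`S`, so they meet in `S`. As `S` avoids higher codimension, the two cells at such a point share a
face. -/
theorem exists_crossing {S : Set (E d)} (hS : IsPreconnected S) (hSΩ : S ⊆ closure Ω)
    (hav : 𝒯.Avoids S) (P : Finset (E d) → Prop) {a c : Finset (E d)} (ha : a ∈ 𝒯.meeting S)
    (hc : c ∈ 𝒯.meeting S) (hPa : P a) (hPc : ¬ P c) :
    ∃ e ∈ 𝒯.facePairs, e.1 ∈ 𝒯.meeting S ∧ e.2 ∈ 𝒯.meeting S ∧ P e.1 ∧ ¬ P e.2 := by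
  classical
  have hcl : ∀ s : Finset (Finset (E d)), IsClosed (⋃ T ∈ s, simplex T) := fun s =>
    isClosed_biUnion_finset fun T _ => (isCompact_simplex T).isClosed
  obtain ⟨z, hzS, hz1, hz2⟩ := isPreconnected_closed_iff.1 hS _ _
    (hcl (𝒯.cells.filter P)) (hcl (𝒯.cells.filter fun T => ¬ P T))
    (fun x hx => by
      obtain ⟨T, hT, hxT⟩ := 𝒯.exists_mem_simplex (hSΩ hx)
      by_cases hP : P T
      · exact Or.inl (mem_iUnion₂.2 ⟨T, Finset.mem_filter.2 ⟨hT, hP⟩, hxT⟩)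
      · exact Or.inr (mem_iUnion₂.2 ⟨T, Finset.mem_filter.2 ⟨hT, hP⟩, hxT⟩))
    (by
      obtain ⟨hac, x, hx, hxS⟩ := mem_meeting.1 ha
      exact ⟨x, hxS, mem_iUnion₂.2 ⟨a, Finset.mem_filter.2 ⟨hac, hPa⟩, hx⟩⟩)
    (by
      obtain ⟨hcc, x, hx, hxS⟩ := mem_meeting.1 hc
      exact ⟨x, hxS, mem_iUnion₂.2 ⟨c, Finset.mem_filter.2 ⟨hcc, hPc⟩, hx⟩⟩)
  obtain ⟨T, hT, hzT⟩ := mem_iUnion₂.1 hz1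
  obtain ⟨T', hT', hzT'⟩ := mem_iUnion₂.1 hz2
  rw [Finset.mem_filter] at hT hT'
  refine ⟨(T, T'), hav T hT.1 T' hT'.1 (fun h => hT'.2 (h ▸ hT.2)) ⟨z, hzS, hzT, hzT'⟩,
    mem_meeting.2 ⟨hT.1, z, hzT, hzS⟩, mem_meeting.2 ⟨hT'.1, z, hzT', hzS⟩, hT.2, hT'.2⟩

-- Each level `t` between `p a` and `p c` is crossed by a face pair met by `S`, by `exists_crossing`
-- for the predicate `p T ≤ t`. So the intervals of the jumps cover `[p a, p c)`, and comparing
-- lengths gives the bound without ordering the cells along `S`.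
open Classical in
theorem sub_le_sum_facePairs {S : Set (E d)} (hS : IsPreconnected S) (hSΩ : S ⊆ closure Ω)
    (hav : 𝒯.Avoids S) (p : Finset (E d) → ℝ) {a c : Finset (E d)} (ha : a ∈ 𝒯.meeting S)
    (hc : c ∈ 𝒯.meeting S) : p c - p a ≤
      ∑ e ∈ 𝒯.facePairs with e.1 ∈ 𝒯.meeting S ∧ e.2 ∈ 𝒯.meeting S, |p e.1 - p e.2| := by
  set s := {e ∈ 𝒯.facePairs | e.1 ∈ 𝒯.meeting S ∧ e.2 ∈ 𝒯.meeting S}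
  have hsub : Ico (p a) (p c) ⊆ ⋃ e ∈ s, Ico (p e.1) (p e.2) := fun t ht => by
    obtain ⟨e, he, h1, h2, h3, h4⟩ := exists_crossing hS hSΩ hav (fun T => p T ≤ t) ha hc ht.1
      (not_le.2 ht.2)
    exact mem_iUnion₂.2 ⟨e, Finset.mem_filter.2 ⟨he, h1, h2⟩, h3, not_le.1 h4⟩
  have h1 : volume (Ico (p a) (p c)) ≤ ∑ e ∈ s, volume (Ico (p e.1) (p e.2)) :=
    (measure_mono hsub).trans (measure_biUnion_finset_le _ _)
  simp_rw [Real.volume_Ico] at h1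
  rw [← ENNReal.ofReal_le_ofReal_iff (Finset.sum_nonneg fun _ _ => abs_nonneg _),
    ENNReal.ofReal_sum_of_nonneg fun _ _ => abs_nonneg _]
  refine h1.trans (Finset.sum_le_sum fun e _ => ENNReal.ofReal_le_ofReal ?_)
  rw [abs_sub_comm]
  exact le_abs_self _

open Classical in
theorem sq_sub_le_sum_facePairs (hd : 0 < d) (hn : Ω.Nonempty) {γqu γsr : ℝ} (hγ : 0 < γqu)
    (hqu : 𝒯.QuasiUniform γqu) (hsr : 𝒯.ShapeRegular γsr) {S : Set (E d)} (hS : IsPreconnected S)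
    (hSΩ : S ⊆ closure Ω) {x : E d} (hSx : S ⊆ Metric.closedBall x 𝒯.size)
    (hav : 𝒯.Avoids S) (p : Finset (E d) → ℝ) {a c : Finset (E d)} (ha : a ∈ 𝒯.meeting S)
    (hc : c ∈ 𝒯.meeting S) : (p c - p a) ^ 2 ≤ cardConst d γqu γsr ^ 2 *
      ∑ e ∈ 𝒯.facePairs with e.1 ∈ 𝒯.meeting S, (p e.1 - p e.2) ^ 2 := by
  have habs : |p c - p a| ≤
      ∑ e ∈ 𝒯.facePairs with e.1 ∈ 𝒯.meeting S ∧ e.2 ∈ 𝒯.meeting S, |p e.1 - p e.2| :=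
    abs_le'.2 ⟨sub_le_sum_facePairs hS hSΩ hav p ha hc, by
      rw [neg_sub]; exact sub_le_sum_facePairs hS hSΩ hav p hc ha⟩
  have hcard := card_meeting_le hd hn hγ hqu hsr hSx
  have hcard2 : (({e ∈ 𝒯.facePairs | e.1 ∈ 𝒯.meeting S ∧ e.2 ∈ 𝒯.meeting S}.card : ℕ) : ℝ)
      ≤ cardConst d γqu γsr ^ 2 := by
    have h1 : {e ∈ 𝒯.facePairs | e.1 ∈ 𝒯.meeting S ∧ e.2 ∈ 𝒯.meeting S}
        ⊆ 𝒯.meeting S ×ˢ 𝒯.meeting S := fun e he =>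
      Finset.mem_product.2 (Finset.mem_filter.1 he).2
    have h2 := Finset.card_le_card h1
    rw [Finset.card_product] at h2
    calc _ ≤ (((𝒯.meeting S).card * (𝒯.meeting S).card : ℕ) : ℝ) := Nat.cast_le.2 h2
      _ = ((𝒯.meeting S).card : ℝ) ^ 2 := by push_cast; ring
      _ ≤ _ := pow_le_pow_left₀ (Nat.cast_nonneg _) hcard 2
  rw [← sq_abs]
  refine (pow_le_pow_left₀ (abs_nonneg _) habs 2).trans (sq_sum_le_card_mul_sum_sq.trans ?_)
  refine mul_le_mul hcard2 ?_ (Finset.sum_nonneg fun _ _ => sq_nonneg _) (sq_nonneg _)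
  simp_rw [sq_abs]
  exact Finset.sum_le_sum_of_subset_of_nonneg
    (Finset.monotone_filter_right _ fun e _ he => he.1) fun _ _ _ => sq_nonneg _

/-! ### Generic segments -/

/-- Such an `x` lies in the affine span of `S` and `s + h` for a vertex `s` of `S`, since this span
contains the direction `h`. It is spanned by at most `d` points, hence null. -/
theorem volume_segment_meets_eq_zero {S : Finset (E d)} (hS : S.card < d) (h : E d) :
    volume {x | ∃ y ∈ segment ℝ x (x + h), y ∈ simplex S} = 0 := by
  classical
  rcases S.eq_empty_or_nonempty with rfl | ⟨s, hs⟩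
  · simp [simplex]
  · refine measure_mono_null (fun x hx => ?_)
      (volume_affineSpan_eq_zero (S := insert (s + h) S) ((Finset.card_insert_le _ _).trans hS))
    obtain ⟨y, hy, hyS⟩ := hx
    rw [segment_eq_image'] at hy
    obtain ⟨t, -, rfl⟩ := hy
    have h1 := convexHull_subset_affineSpan (𝕜 := ℝ) _ hyS
    have h2 := affineSpan_mono ℝ (Finset.coe_subset.2 (Finset.subset_insert (s + h) S)) h1
    have h3 : s + h ∈ affineSpan ℝ ((insert (s + h) S : Finset (E d)) : Set (E d)) :=
      subset_affineSpan ℝ _ (Finset.mem_coe.2 (Finset.mem_insert_self _ _))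
    have h4 : s ∈ affineSpan ℝ ((insert (s + h) S : Finset (E d)) : Set (E d)) :=
      subset_affineSpan ℝ _ (Finset.mem_coe.2 (Finset.mem_insert_of_mem hs))
    have h5 := AffineSubspace.vsub_mem_direction h3 h4
    have h6 := AffineSubspace.vadd_mem_of_mem_direction (Submodule.smul_mem _ (-t) h5) h2
    have e : (-t) • (s + h -ᵥ s) +ᵥ (x + t • (x + h - x)) = x := by
      simp only [vsub_eq_sub, vadd_eq_add, add_sub_cancel_left]
      module
    rwa [e] at h6

theorem ae_avoids (𝒯 : Mesh Ω) (h : E d) : ∀ᵐ x ∂(volume : Measure (E d)),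
    𝒯.Avoids (segment ℝ x (x + h)) := by
  classical
  unfold Avoids
  rw [Filter.eventually_all_finset]
  intro T hT
  rw [Filter.eventually_all_finset]
  intro T' hT'
  by_cases hne : T = T'
  · exact Filter.Eventually.of_forall fun _ h => absurd hne h
  by_cases hcard : (T ∩ T').card = d
  · exact Filter.Eventually.of_forall fun _ _ _ => mem_facePairs.2 ⟨hT, hT', hne, hcard⟩
  · have hlt := lt_of_le_of_ne (card_inter_le hT hT' hne) hcard
    have h0 := volume_segment_meets_eq_zero hlt h
    rw [← compl_mem_ae_iff] at h0
    filter_upwards [h0] with x hx _ hy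
    obtain ⟨y, hy, h1, h2⟩ := hy
    exact absurd ⟨y, hy, by rw [← simplex_inter hT hT']; exact ⟨h1, h2⟩⟩ hx

end Mesh

end RTInfSup


namespace RTInfSup
variable {d : ℕ} {Ω : Set (E d)}

/-! ### A Poincaré inequality for piecewise constant functions -/

namespace Mesh
variable {𝒯 : Mesh Ω}

theorem segment_subset_closedBall {δ : ℝ} {x h : E d} (hh : ‖h‖ ≤ δ) :
    segment ℝ x (x + h) ⊆ Metric.closedBall x δ :=
  (convex_closedBall x δ).segment_subset
    (Metric.mem_closedBall_self ((norm_nonneg h).trans hh)) (by simpa using hh)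

theorem measurable_glue_const (p : Finset (E d) → ℝ) : Measurable (𝒯.glue fun T _ => p T) := by
  unfold glue
  exact Finset.measurable_fun_sum _ fun T _ => measurable_const.indicator (measurableSet_simplex T)

/-- A face pair contributes only if its first cell meets the segment, which forces `x` to lie within
twice the mesh size of a fixed point. The indicator records this, so that each jump is integrated
over a set of volume of order `𝒯.size ^ d`. -/
theorem ae_sq_sub_le (hd : 0 < d) (hn : Ω.Nonempty) {γqu γsr : ℝ} (hγ : 0 < γqu)
    (hqu : 𝒯.QuasiUniform γqu) (hsr : 𝒯.ShapeRegular γsr) (p : Finset (E d) → ℝ)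
    {v : Finset (E d) → E d} (hv : ∀ T ∈ 𝒯.cells, simplex T ⊆ Metric.closedBall (v T) 𝒯.size)
    {h : E d} (hh : ‖h‖ ≤ 𝒯.size) :
    ∀ᵐ x ∂(volume : Measure (E d)), segment ℝ x (x + h) ⊆ Ω →
      (𝒯.glue (fun T _ => p T) (x + h) - 𝒯.glue (fun T _ => p T) x) ^ 2 ≤
      ∑ e ∈ 𝒯.facePairs, cardConst d γqu γsr ^ 2 * (p e.1 - p e.2) ^ 2 *
        (Metric.closedBall (v e.1) (2 * 𝒯.size)).indicator 1 x := by
  classical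
  have hq := (measurePreserving_add_right (volume : Measure (E d)) h).quasiMeasurePreserving.ae
    (𝒯.glue_ae_eq fun T _ => p T)
  filter_upwards [𝒯.ae_avoids h, 𝒯.glue_ae_eq fun T _ => p T, hq] with x hav h1 h2 hseg
  have hsegc := hseg.trans subset_closure
  have hx := left_mem_segment ℝ x (x + h)
  have hxh := right_mem_segment ℝ x (x + h)
  obtain ⟨a, ha, hxa⟩ := 𝒯.exists_mem_simplex (hsegc hx)
  obtain ⟨c, hc, hxc⟩ := 𝒯.exists_mem_simplex (hsegc hxh)
  rw [h1 a ha hxa, h2 c hc hxc]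
  refine (sq_sub_le_sum_facePairs hd hn hγ hqu hsr (convex_segment x (x + h)).isPreconnected hsegc
    (segment_subset_closedBall hh) hav p (mem_meeting.2 ⟨ha, x, hxa, hx⟩)
    (mem_meeting.2 ⟨hc, x + h, hxc, hxh⟩)).trans ?_
  rw [Finset.mul_sum, Finset.sum_filter]
  refine Finset.sum_le_sum fun e _ => ?_
  split_ifs with he
  · obtain ⟨heT, y, hyT, hy⟩ := mem_meeting.1 he
    rw [indicator_of_mem, Pi.one_apply, mul_one]
    have h3 : dist y (v e.1) ≤ 𝒯.size := hv _ heT hyT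
    have h4 : dist y x ≤ 𝒯.size := segment_subset_closedBall hh hy
    have h5 := dist_triangle_left x (v e.1) y
    rw [Metric.mem_closedBall]
    linarith
  · exact mul_nonneg (by positivity) (indicator_nonneg (fun _ _ => zero_le_one) _)

theorem shiftInt_glue_le (hd : 0 < d) (hΩ : IsOpen Ω) (hn : Ω.Nonempty) {γqu γsr : ℝ}
    (hγ : 0 < γqu) (hqu : 𝒯.QuasiUniform γqu) (hsr : 𝒯.ShapeRegular γsr) (p : Finset (E d) → ℝ)
    {δ : ℝ} (hδ : δ ≤ 𝒯.size) :
    shiftInt Ω δ (𝒯.glue fun T _ => p T) ≤ ENNReal.ofReal (cardConst d γqu γsr ^ 2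
      * ((2 * 𝒯.size) ^ d * volume.real (Metric.ball (0 : E d) 1))
      * (𝒯.size ^ d * volume.real (Metric.ball (0 : E d) 1))
      * ∑ e ∈ 𝒯.facePairs, (p e.1 - p e.2) ^ 2) := by
  have hH := (size_pos (𝒯 := 𝒯) hd hn).le
  have hvol : ∀ (x : E d) {r : ℝ}, 0 ≤ r → volume (Metric.closedBall x r)
      = ENNReal.ofReal (r ^ d * volume.real (Metric.ball (0 : E d) 1)) := fun x r hr => by
    rw [← volume_real_closedBall x hr, Measure.real, ENNReal.ofReal_toReal]
    exact Metric.isBounded_closedBall.measure_lt_top.ne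
  have hex : ∀ T, ∃ x, T ∈ 𝒯.cells → simplex T ⊆ Metric.closedBall x 𝒯.size := fun T => by
    by_cases hT : T ∈ 𝒯.cells
    · obtain ⟨x, hx⟩ := simplex_subset_closedBall hT
      exact ⟨x, fun _ => hx⟩
    · exact ⟨0, fun h => absurd h hT⟩
  choose v hv using hex
  set N := cardConst d γqu γsr
  set V := volume.real (Metric.ball (0 : E d) 1)
  have hinner : ∀ h ∈ Metric.closedBall (0 : E d) δ,
      ∫⁻ x in {x | segment ℝ x (x + h) ⊆ Ω},
        ‖𝒯.glue (fun T _ => p T) (x + h) - 𝒯.glue (fun T _ => p T) x‖ₑ ^ 2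
      ≤ ENNReal.ofReal (N ^ 2 * ((2 * 𝒯.size) ^ d * V)
        * ∑ e ∈ 𝒯.facePairs, (p e.1 - p e.2) ^ 2) := fun h hh => by
    have hh' : ‖h‖ ≤ 𝒯.size := (mem_closedBall_zero_iff.1 hh).trans hδ
    calc ∫⁻ x in {x | segment ℝ x (x + h) ⊆ Ω},
          ‖𝒯.glue (fun T _ => p T) (x + h) - 𝒯.glue (fun T _ => p T) x‖ₑ ^ 2
        ≤ ∫⁻ x in {x | segment ℝ x (x + h) ⊆ Ω}, ∑ e ∈ 𝒯.facePairs,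
            ENNReal.ofReal (N ^ 2 * (p e.1 - p e.2) ^ 2) *
            (Metric.closedBall (v e.1) (2 * 𝒯.size)).indicator 1 x := by
          refine setLIntegral_mono_ae' (isOpen_setOf_segment_subset_right hΩ h).measurableSet ?_
          filter_upwards [ae_sq_sub_le hd hn hγ hqu hsr p hv hh'] with x hx hseg
          rw [enorm_sq_eq_ofReal]
          refine (ENNReal.ofReal_le_ofReal (hx hseg)).trans_eq ?_
          rw [ENNReal.ofReal_sum_of_nonneg]
          · refine Finset.sum_congr rfl fun e _ => ?_
            rw [ENNReal.ofReal_mul (by positivity)]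
            by_cases hx : x ∈ Metric.closedBall (v e.1) (2 * 𝒯.size)
            · rw [indicator_of_mem hx, indicator_of_mem hx, Pi.one_apply, Pi.one_apply,
                ENNReal.ofReal_one]
            · rw [indicator_of_notMem hx, indicator_of_notMem hx, ENNReal.ofReal_zero]
          · exact fun e _ => mul_nonneg (by positivity)
              (indicator_nonneg (fun _ _ => zero_le_one) _)
      _ ≤ ∫⁻ x, ∑ e ∈ 𝒯.facePairs, ENNReal.ofReal (N ^ 2 * (p e.1 - p e.2) ^ 2) *
            (Metric.closedBall (v e.1) (2 * 𝒯.size)).indicator 1 x := setLIntegral_le_lintegral _ _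
      _ = ∑ e ∈ 𝒯.facePairs, ENNReal.ofReal (N ^ 2 * (p e.1 - p e.2) ^ 2) *
            ENNReal.ofReal ((2 * 𝒯.size) ^ d * V) := by
          have hm : ∀ e : Finset (E d) × Finset (E d), Measurable
              ((Metric.closedBall (v e.1) (2 * 𝒯.size)).indicator (1 : E d → ENNReal)) := fun e =>
            measurable_one.indicator Metric.isClosed_closedBall.measurableSet
          rw [lintegral_finsetSum _ fun e _ => (hm e).const_mul _]
          refine Finset.sum_congr rfl fun e _ => ?_
          rw [lintegral_const_mul _ (hm e), lintegral_indicator_one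
            Metric.isClosed_closedBall.measurableSet, hvol _ (by positivity)]
      _ = _ := by
          simp_rw [← ENNReal.ofReal_mul (show 0 ≤ N ^ 2 * (p _ - p _) ^ 2 by positivity)]
          rw [← ENNReal.ofReal_sum_of_nonneg, Finset.mul_sum]
          · congr 1
            exact Finset.sum_congr rfl fun e _ => by ring
          · intro e _
            positivity
  unfold shiftInt
  calc _ ≤ ∫⁻ _ in Metric.closedBall (0 : E d) δ, ENNReal.ofReal (N ^ 2 * ((2 * 𝒯.size) ^ d * V)
        * ∑ e ∈ 𝒯.facePairs, (p e.1 - p e.2) ^ 2) :=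
        setLIntegral_mono' Metric.isClosed_closedBall.measurableSet hinner
    _ ≤ ENNReal.ofReal (N ^ 2 * ((2 * 𝒯.size) ^ d * V)
        * ∑ e ∈ 𝒯.facePairs, (p e.1 - p e.2) ^ 2) * volume (Metric.closedBall (0 : E d) 𝒯.size) := by
        rw [setLIntegral_const]
        gcongr
    _ = _ := by
        have hs : 0 ≤ ∑ e ∈ 𝒯.facePairs, (p e.1 - p e.2) ^ 2 :=
          Finset.sum_nonneg fun _ _ => sq_nonneg _
        rw [hvol _ hH, ← ENNReal.ofReal_mul (by positivity)]
        congr 1; ring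

/-- The nonlocal estimate at the scale of the mesh. Integrating over `x` and over `h` gives a factor
of order `H ^ d` each, and `m ^ (d + 2)` is of order `H ^ (-d - 2)`; in total `H ^ (d - 2)`, which
the factor `H ^ 2` on the left turns into `H ^ d`. -/
theorem exists_discrete_poincare (hd : 0 < d) (hΩ : IsLipschitzDomain Ω)
    (hpoly : HasPolygonalBoundary Ω) {γqu : ℝ} (γsr : ℝ) (hγ : 0 < γqu) :
    ∃ C : ℝ, 0 ≤ C ∧ ∀ 𝒯 : Mesh Ω, 𝒯.QuasiUniform γqu → 𝒯.ShapeRegular γsr →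
      ∀ p : Finset (E d) → ℝ, ∑ T ∈ 𝒯.cells, volume.real (simplex T) * p T = 0 →
        𝒯.size ^ 2 * ∑ T ∈ 𝒯.cells, volume.real (simplex T) * p T ^ 2
          ≤ C * 𝒯.size ^ d * ∑ e ∈ 𝒯.facePairs, (p e.1 - p e.2) ^ 2 := by
  obtain ⟨R, hR0, hR⟩ := exists_dist_le hΩ.isBounded
  obtain ⟨K, hK, hKm⟩ := linked_self hΩ.isOpen hΩ.isConnected.isPreconnected hΩ.isBounded hpoly hR
  have hn := hΩ.isConnected.nonempty
  have hfr := hpoly.volume_frontier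
  have hfin : volume Ω ≠ ⊤ := hΩ.isBounded.measure_lt_top.ne
  have hvol : 0 < volume.real Ω := ENNReal.toReal_pos (hΩ.isOpen.measure_pos volume hn).ne' hfin
  set N := cardConst d γqu γsr
  set V := volume.real (Metric.ball (0 : E d) 1)
  refine ⟨(volume.real Ω)⁻¹ * K.toReal * (2 * R) ^ (d + 2) * N ^ 2 * 2 ^ d * V ^ 2,
    by positivity, fun 𝒯 hqu hsr p h0 => ?_⟩
  have hH := size_pos (𝒯 := 𝒯) hd hn
  have hHR := size_le (𝒯 := 𝒯) hΩ.isBounded hR0.le hR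
  have hs : 0 ≤ ∑ e ∈ 𝒯.facePairs, (p e.1 - p e.2) ^ 2 :=
    Finset.sum_nonneg fun _ _ => sq_nonneg _
  have hmem : MemLp (𝒯.glue fun T _ => p T) 2 (volume.restrict Ω) :=
    memLp_glue hΩ.isBounded fun _ => continuous_const
  have := isFiniteMeasure_restrict hΩ.isBounded
  have hi0 : ∫ x in Ω, 𝒯.glue (fun T _ => p T) x = 0 := by
    rw [integral_eq_sum (𝒯 := 𝒯) hfr (hmem.integrable (by norm_num)), ← h0]
    refine Finset.sum_congr rfl fun T hT => ?_
    rw [integral_congr_ae (glue_ae_eq_restrict _ hT), setIntegral_const, smul_eq_mul]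
  have hi2 : ∫ x in Ω, 𝒯.glue (fun T _ => p T) x ^ 2
      = ∑ T ∈ 𝒯.cells, volume.real (simplex T) * p T ^ 2 := by
    rw [integral_eq_sum (𝒯 := 𝒯) hfr hmem.integrable_sq]
    refine Finset.sum_congr rfl fun T hT => ?_
    rw [integral_congr_ae (g := fun _ => p T ^ 2)
      ((glue_ae_eq_restrict (fun T _ => p T) hT).mono fun x hx => by simp only [hx]),
      setIntegral_const, smul_eq_mul]
  -- This subdivision makes the steps no longer than the mesh size, while `m ≤ 2 R / H` because `H ≤
  -- R`.
  set m := ⌈R / 𝒯.size⌉₊ with hm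
  have hm0 : 0 < m := Nat.ceil_pos.2 (by positivity)
  have hm1 : R / m ≤ 𝒯.size := by
    rw [div_le_iff₀ (by positivity), mul_comm, ← div_le_iff₀ hH]
    exact Nat.le_ceil _
  have hm2 : (m : ℝ) ≤ 2 * R / 𝒯.size := by
    have h1 := (Nat.ceil_lt_add_one (show 0 ≤ R / 𝒯.size by positivity)).le
    have h2 : 1 ≤ R / 𝒯.size := (one_le_div hH).2 hHR
    calc (m : ℝ) ≤ R / 𝒯.size + 1 := h1
      _ ≤ R / 𝒯.size + R / 𝒯.size := by linarith
      _ = _ := by ring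
  have key := (volume_mul_lintegral_sq_le_oscInt hfin hmem hi0).trans
    ((hKm m hm0 _ (measurable_glue_const p)).trans (mul_le_mul' le_rfl (mul_le_mul' le_rfl
      (shiftInt_glue_le hd hΩ.isOpen hn hγ hqu hsr p hm1))))
  simp_rw [enorm_sq_eq_ofReal] at key
  rw [← ofReal_integral_eq_lintegral_ofReal hmem.integrable_sq
    (Filter.Eventually.of_forall fun _ => sq_nonneg _), hi2] at key
  have hS : 0 ≤ ∑ T ∈ 𝒯.cells, volume.real (simplex T) * p T ^ 2 :=
    Finset.sum_nonneg fun _ _ => by positivity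
  have key2 := ENNReal.toReal_mono (by finiteness) key
  simp only [ENNReal.toReal_mul, ENNReal.toReal_pow, ENNReal.toReal_natCast,
    ENNReal.toReal_ofReal hS] at key2
  rw [ENNReal.toReal_ofReal (by positivity)] at key2
  change volume.real Ω * _ ≤ _ at key2
  set J := ∑ e ∈ 𝒯.facePairs, (p e.1 - p e.2) ^ 2
  set S := ∑ T ∈ 𝒯.cells, volume.real (simplex T) * p T ^ 2
  set H := 𝒯.size
  have h3 : (m : ℝ) ^ (d + 2) ≤ (2 * R / H) ^ (d + 2) := pow_le_pow_left₀ (by positivity) hm2 _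
  calc H ^ 2 * S = H ^ 2 * ((volume.real Ω)⁻¹ * (volume.real Ω * S)) := by field_simp
    _ ≤ H ^ 2 * ((volume.real Ω)⁻¹ * (K.toReal * ((2 * R / H) ^ (d + 2) *
          (N ^ 2 * ((2 * H) ^ d * V) * (H ^ d * V) * J)))) := by
        refine mul_le_mul_of_nonneg_left (mul_le_mul_of_nonneg_left (key2.trans ?_)
          (by positivity)) (by positivity)
        exact mul_le_mul_of_nonneg_left (mul_le_mul_of_nonneg_right h3 (by positivity))
          (by positivity)
    _ = _ := by
        rw [div_pow, mul_pow 2 H]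
        field_simp
        ring

end Mesh

end RTInfSup


namespace RTInfSup
variable {d : ℕ} {Ω : Set (E d)}

/-! ### Lowest-order fields with prescribed fluxes through the faces -/

namespace Mesh
variable {𝒯 : Mesh Ω}

/-- Dual to the discrete Poincaré inequality: the pairing with the mean-zero `m` is bounded by the
jumps of `p`, so it is represented by weights on the face pairs. Antisymmetrised, these are the
fluxes. -/
theorem exists_fluxes (hd : 0 < d) (hΩ : IsLipschitzDomain Ω)
    (hpoly : HasPolygonalBoundary Ω) {γqu : ℝ} (γsr : ℝ) (hγ : 0 < γqu) :
    ∃ C : ℝ, 0 ≤ C ∧ ∀ 𝒯 : Mesh Ω, 𝒯.QuasiUniform γqu → 𝒯.ShapeRegular γsr →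
      ∀ m : Finset (E d) → ℝ, ∑ T ∈ 𝒯.cells, volume.real (simplex T) * m T = 0 →
        ∃ F : Finset (E d) × Finset (E d) → ℝ, (∀ e, F e.swap = -F e) ∧
          (∀ T ∈ 𝒯.cells, ∑ e ∈ 𝒯.facePairs with e.1 = T, F e = volume.real (simplex T) * m T) ∧
          𝒯.size ^ 2 * ∑ e ∈ 𝒯.facePairs, F e ^ 2
            ≤ C * 𝒯.size ^ d * ∑ T ∈ 𝒯.cells, volume.real (simplex T) * m T ^ 2 := by
  obtain ⟨C, hC, hCp⟩ := exists_discrete_poincare hd hΩ hpoly γsr hγ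
  refine ⟨4 * C, by positivity, fun 𝒯 hqu hsr m hm => ?_⟩
  have hn := hΩ.isConnected.nonempty
  have hH := size_pos (𝒯 := 𝒯) hd hn
  obtain ⟨T₀, hT₀⟩ := cells_nonempty (𝒯 := 𝒯) hn
  set vol : Finset (E d) → ℝ := fun T => volume.real (simplex T) with hvol
  have hvpos : ∀ T ∈ 𝒯.cells, 0 < vol T := fun T hT => volume_simplex_pos hT
  set V := ∑ T ∈ 𝒯.cells, vol T with hV
  have hVpos : 0 < V := Finset.sum_pos hvpos ⟨T₀, hT₀⟩
  set M := ∑ T ∈ 𝒯.cells, vol T * m T ^ 2 with hM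
  have hM0 : 0 ≤ M := Finset.sum_nonneg fun T hT => mul_nonneg (hvpos T hT).le (sq_nonneg _)
  let A : (Finset (E d) → ℝ) →ₗ[ℝ] EuclideanSpace ℝ 𝒯.facePairs :=
    { toFun := fun p => WithLp.toLp 2 fun e => p e.1.1 - p e.1.2
      map_add' := fun p q => by ext e; simp; ring
      map_smul' := fun c p => by ext e; simp; ring }
  let l : (Finset (E d) → ℝ) →ₗ[ℝ] ℝ :=
    { toFun := fun p => ∑ T ∈ 𝒯.cells, vol T * m T * p T
      map_add' := fun p q => by simp only [Pi.add_apply, mul_add, Finset.sum_add_distrib]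
      map_smul' := fun c p => by
        simp only [Pi.smul_apply, smul_eq_mul, RingHom.id_apply, Finset.mul_sum]
        exact Finset.sum_congr rfl fun T _ => by ring }
  have hA : ∀ p, ‖A p‖ ^ 2 = ∑ e ∈ 𝒯.facePairs, (p e.1 - p e.2) ^ 2 := fun p => by
    rw [EuclideanSpace.norm_sq_eq, ← Finset.sum_coe_sort 𝒯.facePairs]
    refine Finset.sum_congr rfl fun e _ => ?_
    rw [Real.norm_eq_abs, sq_abs]; rfl
  have hbound : ∀ p, l p ^ 2 ≤ M * (C * 𝒯.size ^ d / 𝒯.size ^ 2) * ‖A p‖ ^ 2 := fun p => by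
    -- Subtracting the weighted mean of `p` changes neither the jumps nor the pairing with `m`.
    set c := (∑ T ∈ 𝒯.cells, vol T * p T) / V with hc
    have h1 : ∑ T ∈ 𝒯.cells, vol T * (p T - c) = 0 := by
      simp_rw [mul_sub]
      rw [Finset.sum_sub_distrib, ← Finset.sum_mul, ← hV, hc]
      field_simp
      ring
    have h2 := hCp 𝒯 hqu hsr (fun T => p T - c) h1
    have h3 : l p = ∑ T ∈ 𝒯.cells, (√(vol T) * m T) * (√(vol T) * (p T - c)) := by
      have e : ∀ T ∈ 𝒯.cells, (√(vol T) * m T) * (√(vol T) * (p T - c))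
          = vol T * m T * p T - vol T * m T * c := fun T hT => by
        have := Real.mul_self_sqrt (hvpos T hT).le
        linear_combination (m T * (p T - c)) * this
      rw [Finset.sum_congr rfl e, Finset.sum_sub_distrib, ← Finset.sum_mul, hm, zero_mul, sub_zero]
      rfl
    have h4 := Finset.sum_mul_sq_le_sq_mul_sq 𝒯.cells (fun T => √(vol T) * m T)
      (fun T => √(vol T) * (p T - c))
    have h5 : ∀ g : Finset (E d) → ℝ, ∑ T ∈ 𝒯.cells, (√(vol T) * g T) ^ 2
        = ∑ T ∈ 𝒯.cells, vol T * g T ^ 2 := fun g =>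
      Finset.sum_congr rfl fun T hT => by rw [mul_pow, Real.sq_sqrt (hvpos T hT).le]
    rw [← h3, h5, h5] at h4
    refine h4.trans ?_
    rw [mul_assoc]
    refine mul_le_mul_of_nonneg_left ?_ hM0
    rw [div_mul_eq_mul_div, le_div_iff₀ (by positivity), mul_comm, hA]
    simpa only [sub_sub_sub_cancel_right] using h2
  set B := M * (C * 𝒯.size ^ d / 𝒯.size ^ 2) with hB
  have hB0 : 0 ≤ B := by positivity
  obtain ⟨y, hy, hyl⟩ := exists_inner_eq_of_abs_le A l (Real.sqrt_nonneg B) fun p => by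
    refine abs_le_of_sq_le_sq ?_ (mul_nonneg (Real.sqrt_nonneg _) (norm_nonneg _))
    rw [mul_pow, Real.sq_sqrt hB0]
    exact hbound p
  set Y : Finset (E d) × Finset (E d) → ℝ := fun e => if h : e ∈ 𝒯.facePairs then y ⟨e, h⟩ else 0
    with hY
  have hY2 : ∑ e ∈ 𝒯.facePairs, Y e ^ 2 ≤ B := by
    calc ∑ e ∈ 𝒯.facePairs, Y e ^ 2 = ‖y‖ ^ 2 := by
          rw [EuclideanSpace.norm_sq_eq, ← Finset.sum_coe_sort 𝒯.facePairs]
          refine Finset.sum_congr rfl fun e _ => ?_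
          rw [Real.norm_eq_abs, sq_abs, hY]
          simp
      _ ≤ √B ^ 2 := pow_le_pow_left₀ (norm_nonneg _) hy 2
      _ = B := Real.sq_sqrt hB0
  have hYl : ∀ p : Finset (E d) → ℝ, ∑ e ∈ 𝒯.facePairs, Y e * (p e.1 - p e.2)
      = ∑ T ∈ 𝒯.cells, vol T * m T * p T := fun p => by
    refine Eq.trans ?_ (hyl p)
    rw [PiLp.inner_apply, ← Finset.sum_coe_sort 𝒯.facePairs]
    refine Finset.sum_congr rfl fun e _ => ?_
    have : Y e = y e := by rw [hY]; simp
    rw [this]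
    change _ = (p e.1.1 - p e.1.2) * y e
    ring
  have hswap : ∀ f : Finset (E d) × Finset (E d) → ℝ,
      ∑ e ∈ 𝒯.facePairs, f e.swap = ∑ e ∈ 𝒯.facePairs, f e := fun f =>
    Finset.sum_nbij' Prod.swap Prod.swap (fun e he => swap_mem_facePairs he)
      (fun e he => swap_mem_facePairs he) (fun _ _ => rfl) (fun _ _ => rfl) fun _ _ => rfl
  refine ⟨fun e => Y e - Y e.swap, fun e => by simp only [Prod.swap_swap]; ring, fun T hT => ?_, ?_⟩
  -- Testing with the indicator of the cell `T` yields the balance of fluxes on `T`.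
  · have h1 := hYl (fun S => if S = T then 1 else 0)
    simp only [mul_sub, mul_ite, mul_one, mul_zero, Finset.sum_sub_distrib,
      Finset.sum_ite_eq', if_pos hT] at h1
    rw [Finset.sum_filter, ← h1, ← hswap fun e => if e.2 = T then Y e else 0,
      ← Finset.sum_sub_distrib]
    refine Finset.sum_congr rfl fun e _ => ?_
    simp only [Prod.snd_swap]
    split_ifs <;> ring
  · have h1 : ∑ e ∈ 𝒯.facePairs, (Y e - Y e.swap) ^ 2 ≤ 4 * B := by
      calc ∑ e ∈ 𝒯.facePairs, (Y e - Y e.swap) ^ 2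
          ≤ ∑ e ∈ 𝒯.facePairs, (2 * Y e ^ 2 + 2 * Y e.swap ^ 2) :=
            Finset.sum_le_sum fun e _ => by nlinarith [sq_nonneg (Y e + Y e.swap)]
        _ = 4 * ∑ e ∈ 𝒯.facePairs, Y e ^ 2 := by
            rw [Finset.sum_add_distrib, hswap fun e => 2 * Y e ^ 2, ← Finset.mul_sum]; ring
        _ ≤ 4 * B := by linarith
    calc 𝒯.size ^ 2 * ∑ e ∈ 𝒯.facePairs, (Y e - Y e.swap) ^ 2 ≤ 𝒯.size ^ 2 * (4 * B) :=
          mul_le_mul_of_nonneg_left h1 (sq_nonneg _)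
      _ = _ := by rw [hB]; field_simp

/-- The vertex of `T` that is not a vertex of the neighbour `T'`. -/
noncomputable def apex (T T' : Finset (E d)) : E d :=
  if h : (T \ T').Nonempty then h.choose else 0

theorem apex_mem {T T' : Finset (E d)} (h : (T, T') ∈ 𝒯.facePairs) :
    apex T T' ∈ T ∧ apex T T' ∉ T' ∧ ∀ x ∈ T, x ≠ apex T T' → x ∈ T' := by
  obtain ⟨hT, -, -, hc⟩ := mem_facePairs.1 h
  have h1 : (T \ T').card = 1 := by
    have := Finset.card_sdiff_add_card_inter T T'
    rw [hc, 𝒯.card_cell T hT] at this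
    omega
  have hne : (T \ T').Nonempty := Finset.card_pos.1 (by omega)
  have hmem : apex T T' ∈ T \ T' := by
    rw [apex, dif_pos hne]
    exact hne.choose_spec
  obtain ⟨h2, h3⟩ := Finset.mem_sdiff.1 hmem
  refine ⟨h2, h3, fun x hx hxa => ?_⟩
  by_contra hxT'
  exact hxa (Finset.card_le_one.1 h1.le x (Finset.mem_sdiff.2 ⟨hx, hxT'⟩) _ hmem)

/-- The flux of `ψ` through the common face of two cells, as a volume average. -/
noncomputable def faceFlux (ψ : E d → ℝ) (e : Finset (E d) × Finset (E d)) : ℝ :=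
  ⨍ x in simplex e.1, (d * ψ x + fderiv ℝ ψ x (x - apex e.1 e.2))

theorem hull_basis {T : Finset (E d)} (hT : T ∈ 𝒯.cells) : hull (𝒯.basis hT) = simplex T := by
  rw [hull, range_basis, simplex]

/-- Exchanging the two apices matches the vertices of the cells, so their affine bases differ at one
index only and `average_flux_eq` applies. -/
theorem faceFlux_swap {ψ : E d → ℝ} (hψ : ContDiff ℝ ∞ ψ) (hc : HasCompactSupport ψ)
    {e : Finset (E d) × Finset (E d)} (he : e ∈ 𝒯.facePairs) :
    faceFlux ψ e.swap = faceFlux ψ e := by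
  obtain ⟨T, T'⟩ := e
  obtain ⟨hT, hT', -, -⟩ := mem_facePairs.1 he
  obtain ⟨h1, h2, h3⟩ := apex_mem he
  obtain ⟨h1', h2', h3'⟩ := apex_mem (swap_mem_facePairs he)
  set a := apex T T' with ha
  set a' := apex T' T with ha'
  have hiff : ∀ x, x ∈ T' ↔ Equiv.swap a a' x ∈ T := fun x => by
    by_cases hxa : x = a
    · subst hxa
      rw [Equiv.swap_apply_left]
      exact ⟨fun h => absurd h h2, fun h => absurd h h2'⟩
    by_cases hxa' : x = a'
    · subst hxa'
      rw [Equiv.swap_apply_right]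
      exact ⟨fun _ => h1, fun _ => h1'⟩
    rw [Equiv.swap_apply_of_ne_of_ne hxa hxa']
    exact ⟨fun h => h3' x h hxa', fun h => h3 x h hxa⟩
  set f : T' ≃ T := (Equiv.swap a a').subtypeEquiv hiff with hf
  have hval : ∀ j : T, ((𝒯.basis hT').reindex f) j = Equiv.swap a a' j := fun j => by
    rw [AffineBasis.reindex_apply]
    change ((f.symm j : T') : E d) = _
    rw [hf, Equiv.subtypeEquiv_symm]
    simp
  have hb : ∀ j : T, 𝒯.basis hT j = (j : E d) := fun j => rfl
  have key := average_flux_eq (b := 𝒯.basis hT) (b' := (𝒯.basis hT').reindex f) (i := ⟨a, h1⟩)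
    (fun j hj => by
      have hja : (j : E d) ≠ a := fun h => hj (Subtype.ext h)
      have hja' : (j : E d) ≠ a' := fun h => h2' (h ▸ j.2)
      rw [hval, hb, Equiv.swap_apply_of_ne_of_ne hja hja']) hψ hc
  rw [hval, hb, Equiv.swap_apply_left, hull_basis] at key
  have hh : hull ((𝒯.basis hT').reindex f) = simplex T' := by
    rw [← hull_basis hT', hull, hull, AffineBasis.coe_reindex, f.symm.surjective.range_comp]
  rw [hh] at key
  exact key.symm

end Mesh

end RTInfSup


/-! ### Cellwise Raviart–Thomas fields and their estimates -/

namespace RTInfSup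
open MvPolynomial

variable {d : ℕ} {Ω : Set (E d)}

theorem integrableOn_simplex {F : Type*} [NormedAddCommGroup F] (T : Finset (E d)) {f : E d → F}
    (hf : Continuous f) : IntegrableOn f (simplex T) :=
  integrableOn_of_continuous (isCompact_simplex T) hf

namespace Mesh
variable {𝒯 : Mesh Ω}

/-- The lowest-order Raviart–Thomas field on the cell `T` whose flux through the face shared with
`T'` is `F (T, T')`. -/
noncomputable def cellField (𝒯 : Mesh Ω) (F : Finset (E d) × Finset (E d) → ℝ) (T : Finset (E d))
    (x : E d) : E d :=
  ∑ e ∈ 𝒯.facePairs with e.1 = T, (F e / (d * volume.real (simplex T))) • (x - apex e.1 e.2)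

theorem continuous_cellField (F : Finset (E d) × Finset (E d) → ℝ) (T : Finset (E d)) :
    Continuous (𝒯.cellField F T) := by
  unfold cellField
  fun_prop

/-- Since `x - a` has divergence `d`, the summand for `e` has divergence `F e / |T|`, and these add
up to `m`; what remains are the averages that define `faceFlux`. -/
theorem integral_cellField (hd : 0 < d) (F : Finset (E d) × Finset (E d) → ℝ)
    {T : Finset (E d)} (hT : T ∈ 𝒯.cells) {m : ℝ}
    (hF : ∑ e ∈ 𝒯.facePairs with e.1 = T, F e = volume.real (simplex T) * m) {ψ : E d → ℝ}
    (hψ : ContDiff ℝ ∞ ψ) :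
    ∫ x in simplex T, (fderiv ℝ ψ x (𝒯.cellField F T x) + m * ψ x)
      = ∑ e ∈ 𝒯.facePairs with e.1 = T, F e / d * faceFlux ψ e := by
  have hv := volume_simplex_pos hT
  have hd' : (0 : ℝ) < d := Nat.cast_pos.2 hd
  have hm : m = ∑ e ∈ 𝒯.facePairs with e.1 = T, F e / volume.real (simplex T) := by
    rw [← Finset.sum_div, hF]; field_simp
  have e1 : ∀ x, fderiv ℝ ψ x (𝒯.cellField F T x) + m * ψ x
      = ∑ e ∈ 𝒯.facePairs with e.1 = T, F e / (d * volume.real (simplex T))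
        * (d * ψ x + fderiv ℝ ψ x (x - apex e.1 e.2)) := fun x => by
    rw [cellField, map_sum, hm, Finset.sum_mul, ← Finset.sum_add_distrib]
    refine Finset.sum_congr rfl fun e _ => ?_
    rw [map_smul, smul_eq_mul]
    field_simp
    ring
  simp_rw [e1]
  rw [integral_finsetSum]
  · refine Finset.sum_congr rfl fun e he => ?_
    rw [integral_const_mul, faceFlux, (Finset.mem_filter.1 he).2, setAverage_eq, smul_eq_mul]
    field_simp
  · intro e _
    refine integrableOn_simplex T (continuous_const.mul ?_)
    exact (continuous_const.mul hψ.continuous).add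
      ((hψ.continuous_fderiv (by simp)).clm_apply (continuous_id.sub continuous_const))

/-- `F` is antisymmetric and `faceFlux` symmetric, so the contributions from the two sides of a face
cancel. Boundary faces carry no flux at all, which gives the zero normal trace even though `ψ` need
not vanish on the boundary. -/
theorem sum_faceFlux_eq_zero {F : Finset (E d) × Finset (E d) → ℝ} (hF : ∀ e, F e.swap = -F e)
    {ψ : E d → ℝ} (hψ : ContDiff ℝ ∞ ψ) (hc : HasCompactSupport ψ) :
    ∑ T ∈ 𝒯.cells, ∑ e ∈ 𝒯.facePairs with e.1 = T, F e / d * faceFlux ψ e = 0 := by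
  rw [Finset.sum_fiberwise_of_maps_to fun e he => (mem_facePairs.1 he).1]
  have h : ∑ e ∈ 𝒯.facePairs, F e / d * faceFlux ψ e
      = ∑ e ∈ 𝒯.facePairs, -(F e / d * faceFlux ψ e) := by
    refine Finset.sum_nbij' Prod.swap Prod.swap (fun e he => swap_mem_facePairs he)
      (fun e he => swap_mem_facePairs he) (fun _ _ => rfl) (fun _ _ => rfl) fun e he => ?_
    rw [faceFlux_swap hψ hc he, hF]
    ring
  rw [Finset.sum_neg_distrib] at h
  linarith

theorem card_facePairs_le (hd : 0 < d) (hn : Ω.Nonempty) {γqu γsr : ℝ} (hγ : 0 < γqu)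
    (hqu : 𝒯.QuasiUniform γqu) (hsr : 𝒯.ShapeRegular γsr) {T : Finset (E d)} (hT : T ∈ 𝒯.cells) :
    (({e ∈ 𝒯.facePairs | e.1 = T}.card : ℕ) : ℝ) ≤ cardConst d γqu γsr := by
  obtain ⟨x, hx⟩ := simplex_subset_closedBall hT
  refine le_trans (Nat.cast_le.2 (Finset.card_le_card_of_injOn Prod.snd (fun e he => ?_) ?_))
    (card_meeting_le hd hn hγ hqu hsr hx)
  · obtain ⟨hef, heT⟩ := Finset.mem_filter.1 he
    subst heT
    obtain ⟨-, hT', -, hc⟩ := mem_facePairs.1 hef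
    obtain ⟨y, hy⟩ := Finset.card_pos.1 (hc.symm ▸ hd)
    rw [Finset.mem_inter] at hy
    exact mem_meeting.2 ⟨hT', y, subset_simplex _ hy.2, subset_simplex _ hy.1⟩
  · intro e he e' he' h
    exact Prod.ext ((Finset.mem_filter.1 he).2.trans (Finset.mem_filter.1 he').2.symm) h

/-- Pointwise, each term is at most `|F e| H / |T|`. Cauchy–Schwarz over the bounded number of faces
and `|T| ≥ volConst * H ^ d` give the scaling. -/
theorem integral_norm_sq_cellField_le (hd : 0 < d) (hn : Ω.Nonempty) {γqu γsr : ℝ} (hγ : 0 < γqu)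
    (hqu : 𝒯.QuasiUniform γqu) (hsr : 𝒯.ShapeRegular γsr)
    (F : Finset (E d) × Finset (E d) → ℝ) {T : Finset (E d)} (hT : T ∈ 𝒯.cells) :
    ∫ x in simplex T, ‖𝒯.cellField F T x‖ ^ 2 ≤
      cardConst d γqu γsr / volConst d γqu γsr * (𝒯.size ^ 2 / 𝒯.size ^ d)
        * ∑ e ∈ 𝒯.facePairs with e.1 = T, F e ^ 2 := by
  have hv := volume_simplex_pos hT
  have hd' : (1 : ℝ) ≤ d := Nat.one_le_cast.2 hd
  have hc := volConst_pos (d := d) (γsr := γsr) hγ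
  have hN := cardConst_pos (d := d) (γsr := γsr) hγ
  have hH := size_pos (𝒯 := 𝒯) hd hn
  have hvc := volConst_mul_le hd hn hγ hqu hsr hT
  have hcard := card_facePairs_le hd hn hγ hqu hsr hT
  set J := ∑ e ∈ 𝒯.facePairs with e.1 = T, F e ^ 2 with hJ
  have hJ0 : 0 ≤ J := Finset.sum_nonneg fun _ _ => sq_nonneg _
  set v := volume.real (simplex T)
  set N := cardConst d γqu γsr
  have hpt : ∀ x ∈ simplex T, ‖𝒯.cellField F T x‖ ^ 2 ≤ N * (𝒯.size ^ 2 / v ^ 2 * J) := fun x hx => by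
    have h1 : ‖𝒯.cellField F T x‖ ≤ ∑ e ∈ 𝒯.facePairs with e.1 = T, |F e| * (𝒯.size / v) := by
      refine (norm_sum_le _ _).trans (Finset.sum_le_sum fun e he => ?_)
      obtain ⟨he, heT⟩ := Finset.mem_filter.1 he
      have ha : apex e.1 e.2 ∈ simplex T := heT ▸ subset_simplex _ (apex_mem he).1
      have h2 := dist_le_size hT hx ha
      rw [norm_smul, ← dist_eq_norm, norm_div, Real.norm_eq_abs, Real.norm_eq_abs,
        abs_of_pos (show 0 < d * v by positivity), mul_div_assoc', div_mul_eq_mul_div]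
      refine div_le_div₀ (by positivity) (mul_le_mul_of_nonneg_left h2 (abs_nonneg _)) hv ?_
      exact le_mul_of_one_le_left hv.le hd'
    refine (pow_le_pow_left₀ (norm_nonneg _) h1 2).trans (sq_sum_le_card_mul_sum_sq.trans ?_)
    have h3 : ∑ e ∈ 𝒯.facePairs with e.1 = T, (|F e| * (𝒯.size / v)) ^ 2
        = 𝒯.size ^ 2 / v ^ 2 * J := by
      rw [hJ, Finset.mul_sum]
      exact Finset.sum_congr rfl fun e _ => by rw [mul_pow, sq_abs, div_pow]; ring
    rw [h3]
    exact mul_le_mul_of_nonneg_right hcard (by positivity)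
  calc ∫ x in simplex T, ‖𝒯.cellField F T x‖ ^ 2
      ≤ ∫ x in simplex T, N * (𝒯.size ^ 2 / v ^ 2 * J) :=
        setIntegral_mono_on (integrableOn_simplex T ((continuous_cellField F T).norm.pow 2))
          (integrableOn_simplex T continuous_const) (measurableSet_simplex T) hpt
    _ = N * (𝒯.size ^ 2 / v) * J := by
        rw [setIntegral_const, smul_eq_mul]
        change v * _ = _
        field_simp
    _ ≤ N * (𝒯.size ^ 2 / (volConst d γqu γsr * 𝒯.size ^ d)) * J := by
        gcongr
    _ = _ := by field_simp

theorem exists_basis (𝒯 : Mesh Ω) {T : Finset (E d)} (hT : T ∈ 𝒯.cells) :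
    ∃ b : AffineBasis (Fin (d + 1)) ℝ (E d), hull b = simplex T := by
  have e : T ≃ Fin (d + 1) := T.equivFinOfCardEq (𝒯.card_cell T hT)
  refine ⟨(𝒯.basis hT).reindex e, ?_⟩
  rw [← hull_basis hT, hull, hull, AffineBasis.coe_reindex, e.symm.surjective.range_comp]

/-- A Raviart–Thomas field on the cell `T` is given by these polynomials. -/
def IsRTField (k : ℕ) (w : E d → E d) : Prop :=
  ∃ (P : Fin d → MvPolynomial (Fin d) ℝ) (r : MvPolynomial (Fin d) ℝ),
    (∀ i, (P i).totalDegree ≤ k) ∧ r.totalDegree ≤ k ∧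
    ∀ x i, w x i = polyVal (P i) x + x i * polyVal r x

theorem IsRTField.add {k : ℕ} {w w' : E d → E d} (h : IsRTField k w) (h' : IsRTField k w') :
    IsRTField k fun x => w x + w' x := by
  obtain ⟨P, r, hP, hr, hw⟩ := h
  obtain ⟨P', r', hP', hr', hw'⟩ := h'
  refine ⟨fun i => P i + P' i, r + r', fun i => (totalDegree_add _ _).trans (max_le (hP i) (hP' i)),
    (totalDegree_add _ _).trans (max_le hr hr'), fun x i => ?_⟩
  rw [PiLp.add_apply, hw, hw']
  simp only [polyVal, map_add]
  ring

theorem IsRTField.sum {k : ℕ} {ι : Type*} (s : Finset ι) {w : ι → E d → E d}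
    (h : ∀ i ∈ s, IsRTField k (w i)) : IsRTField k fun x => ∑ i ∈ s, w i x := by
  classical
  induction s using Finset.induction_on with
  | empty => exact ⟨0, 0, fun i => by simp, by simp, fun x i => by simp [polyVal]⟩
  | insert a s ha ih =>
    simp_rw [Finset.sum_insert ha]
    exact (h a (Finset.mem_insert_self _ _)).add
      (ih fun i hi => h i (Finset.mem_insert_of_mem hi))

theorem isRTField_smul_sub (k : ℕ) (c : ℝ) (a : E d) : IsRTField k fun x => c • (x - a) := by
  refine ⟨fun i => MvPolynomial.C (-(c * a i)), MvPolynomial.C c,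
    fun i => (totalDegree_C _).trans_le (zero_le), (totalDegree_C _).trans_le (zero_le),
    fun x i => ?_⟩
  simp only [polyVal, eval_C, PiLp.smul_apply, PiLp.sub_apply, smul_eq_mul]
  ring

theorem isRTField_cellField (k : ℕ) (F : Finset (E d) × Finset (E d) → ℝ) (T : Finset (E d)) :
    IsRTField k (𝒯.cellField F T) :=
  IsRTField.sum _ fun _ _ => isRTField_smul_sub k _ _

/-- The local correction: it removes the deviation of the divergence from its mean. -/
theorem exists_correction (d k : ℕ) : ∃ C : ℝ, 0 ≤ C ∧ ∀ {Ω : Set (E d)} (𝒯 : Mesh Ω),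
    ∀ T ∈ 𝒯.cells, ∀ p : MvPolynomial (Fin d) ℝ, p.totalDegree ≤ k →
      ∃ w : E d → E d, Continuous w ∧ IsRTField k w ∧
        (∀ ψ : E d → ℝ, ContDiff ℝ ∞ ψ → ∫ x in simplex T,
          (fderiv ℝ ψ x (w x) + (polyVal p x - ⨍ y in simplex T, polyVal p y) * ψ x) = 0) ∧
        ∫ x in simplex T, ‖w x‖ ^ 2 ≤ C * 𝒯.size ^ 2 * ∫ x in simplex T, polyVal p x ^ 2 := by
  obtain ⟨C, hC, h⟩ := exists_local_field d k
  refine ⟨C, hC, fun {Ω} 𝒯 T hT p hp => ?_⟩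
  obtain ⟨b, hb⟩ := 𝒯.exists_basis hT
  have hv := volume_simplex_pos hT
  set m := ⨍ y in simplex T, polyVal p y with hm
  have hm' : ∫ x in simplex T, polyVal p x = m * volume.real (simplex T) := by
    rw [hm, setAverage_eq, smul_eq_mul]; field_simp
  have hpc := continuous_polyVal p
  have hval : ∀ x, polyVal (p - MvPolynomial.C m) x = polyVal p x - m := fun x => by
    simp only [polyVal, map_sub, eval_C]
  obtain ⟨w, P, r, hw, hP, hr, hwP, hdiv, hbd⟩ := h b 𝒯.size (p - MvPolynomial.C m)
    ((totalDegree_sub_C_le _ _).trans hp)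
    (fun x hx y hy => dist_le_size hT (hb ▸ hx) (hb ▸ hy)) (by
      simp_rw [hval]
      rw [hb, integral_sub (integrableOn_simplex T hpc) (integrableOn_simplex T continuous_const),
        hm', setIntegral_const, smul_eq_mul]
      ring)
  simp only [hval, hb] at hdiv hbd
  refine ⟨w, hw, ⟨P, r, hP, hr, hwP⟩, hdiv, hbd.trans (mul_le_mul_of_nonneg_left ?_ (by positivity))⟩
  -- Subtracting the mean does not increase the `L²` norm.
  have e : ∀ x, (polyVal p x - m) ^ 2 = polyVal p x ^ 2 - (2 * m * polyVal p x - m ^ 2) :=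
    fun x => by ring
  simp_rw [e]
  have hp2 : Continuous fun x => polyVal p x ^ 2 := hpc.pow 2
  rw [integral_sub (integrableOn_simplex T hp2) (integrableOn_simplex T (by fun_prop)),
    integral_sub (integrableOn_simplex T (by fun_prop)) (integrableOn_simplex T continuous_const),
    integral_const_mul, hm', setIntegral_const, smul_eq_mul]
  nlinarith [mul_nonneg (sq_nonneg m) hv.le]

end Mesh

end RTInfSup


namespace RTInfSup
variable {d : ℕ} {Ω : Set (E d)}

/-! ### The uniform inf-sup constant -/

theorem sq_average_mul_volume_le {S : Set (E d)} (hS : 0 < volume.real S) {f : E d → ℝ}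
    (hf : IntegrableOn f S) (hf2 : IntegrableOn (fun x => f x ^ 2) S) :
    volume.real S * (⨍ x in S, f x) ^ 2 ≤ ∫ x in S, f x ^ 2 := by
  set m := ⨍ x in S, f x with hm
  have hfin : IsFiniteMeasure (volume.restrict S) :=
    ⟨by
      rw [Measure.restrict_apply_univ, lt_top_iff_ne_top]
      intro h
      rw [Measure.real, h, ENNReal.toReal_top] at hS
      exact hS.false⟩
  have h1 : ∫ x in S, f x = m * volume.real S := by
    rw [hm, setAverage_eq, smul_eq_mul]; field_simp
  have h2 : 0 ≤ ∫ x in S, (f x ^ 2 - (2 * m * f x - m ^ 2)) := by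
    refine integral_nonneg fun x => ?_
    change 0 ≤ f x ^ 2 - (2 * m * f x - m ^ 2)
    nlinarith [sq_nonneg (f x - m)]
  have h3 : IntegrableOn (fun x => 2 * m * f x) S := hf.const_mul _
  have h4 : IntegrableOn (fun x => 2 * m * f x - m ^ 2) S := h3.sub (integrable_const _)
  rw [integral_sub hf2 h4, integral_sub h3 (integrable_const _),
    integral_const_mul, h1, setIntegral_const, smul_eq_mul] at h2
  nlinarith

/-- On each cell `q` is split into its mean and a mean-zero rest. The means are realised by
`cellField` with the dual fluxes, the rest by local corrections without normal trace, and the glued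
field has divergence `q`. -/
theorem exists_field (hd : 0 < d) (hΩ : IsLipschitzDomain Ω) (hpoly : HasPolygonalBoundary Ω)
    (k : ℕ) {γqu : ℝ} (γsr : ℝ) (hγ : 0 < γqu) :
    ∃ c : ℝ, 0 ≤ c ∧ ∀ 𝒯 : Mesh Ω, 𝒯.QuasiUniform γqu → 𝒯.ShapeRegular γsr →
      ∀ q ∈ QH 𝒯 k ∩ L20 Ω, ∃ v ∈ VH 𝒯 k, weakDiv Ω v = q ∧ ‖v‖ ^ 2 ≤ c * ‖q‖ ^ 2 := by
  obtain ⟨R, hR0, hR⟩ := exists_dist_le hΩ.isBounded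
  obtain ⟨C₁, hC₁, hflux⟩ := Mesh.exists_fluxes hd hΩ hpoly γsr hγ
  obtain ⟨C₂, hC₂, hcorr⟩ := Mesh.exists_correction d k
  have hn := hΩ.isConnected.nonempty
  have hfr := hpoly.volume_frontier
  have hb := hΩ.isBounded
  set N := Mesh.cardConst d γqu γsr
  set V := Mesh.volConst d γqu γsr
  have hN : 0 < N := Mesh.cardConst_pos hγ
  have hV : 0 < V := Mesh.volConst_pos hγ
  -- The `2` comes from `‖a + b‖² ≤ 2 ‖a‖² + 2 ‖b‖²`; the two terms bound the flux part and the
  -- corrections, with `H ≤ R`.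
  refine ⟨2 * (N / V * C₁ + C₂ * R ^ 2), by positivity, fun 𝒯 hqu hsr q hq => ?_⟩
  have hH := Mesh.size_pos (𝒯 := 𝒯) hd hn
  have hHR := Mesh.size_le (𝒯 := 𝒯) hb hR0.le hR
  have hae : ∀ {P : E d → Prop}, (∀ᵐ x ∂(volume.restrict Ω), P x) → ∀ T ∈ 𝒯.cells,
      ∀ᵐ x ∂(volume.restrict (simplex T)), P x := fun {P} h T hT =>
    ae_mono (by
      rw [Mesh.restrict_eq_sum (𝒯 := 𝒯) hfr]
      exact Finset.single_le_sum (f := fun T => volume.restrict (simplex T))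
        (fun _ _ => Measure.zero_le _) hT) h
  have hp : ∀ T, ∃ p : MvPolynomial (Fin d) ℝ, p.totalDegree ≤ k ∧ (T ∈ 𝒯.cells →
      ∀ᵐ x ∂(volume.restrict (simplex T)), q x = polyVal p x) := fun T => by
    by_cases hT : T ∈ 𝒯.cells
    · obtain ⟨p, hp, h⟩ := hq.1 T hT
      refine ⟨p, hp, fun _ => ?_⟩
      filter_upwards [hae h T hT, ae_restrict_mem (measurableSet_simplex T)] with x h1 h2
      exact h1 h2
    · exact ⟨0, by simp, fun h => absurd h hT⟩
  choose p hpk hpq using hp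
  have hint : ∀ T, IntegrableOn (polyVal (p T)) (simplex T) := fun T =>
    integrableOn_simplex T (continuous_polyVal _)
  have hint2 : ∀ T, IntegrableOn (fun x => polyVal (p T) x ^ 2) (simplex T) := fun T =>
    integrableOn_simplex T ((continuous_polyVal (p T)).pow 2)
  set m : Finset (E d) → ℝ := fun T => ⨍ x in simplex T, polyVal (p T) x with hm
  have hfm := isFiniteMeasure_restrict hb
  have hq2 : ∑ T ∈ 𝒯.cells, ∫ x in simplex T, polyVal (p T) x ^ 2 = ‖q‖ ^ 2 := by
    rw [← integral_norm_sq_eq, Mesh.integral_eq_sum (𝒯 := 𝒯) hfr (integrable_norm_sq q)]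
    refine Finset.sum_congr rfl fun T hT => integral_congr_ae ((hpq T hT).mono fun x hx => ?_)
    simp only [hx, Real.norm_eq_abs, sq_abs]
  have hm0 : ∑ T ∈ 𝒯.cells, volume.real (simplex T) * m T = 0 := by
    have h0 : ∫ x in Ω, q x = 0 := hq.2
    rw [Mesh.integral_eq_sum (𝒯 := 𝒯) hfr ((Lp.memLp q).integrable (by norm_num))] at h0
    rw [← h0]
    refine Finset.sum_congr rfl fun T hT => ?_
    have hv := Mesh.volume_simplex_pos hT
    rw [integral_congr_ae (hpq T hT), hm]
    simp only [setAverage_eq, smul_eq_mul]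
    field_simp
  have hm2 : ∑ T ∈ 𝒯.cells, volume.real (simplex T) * m T ^ 2 ≤ ‖q‖ ^ 2 := by
    rw [← hq2]
    exact Finset.sum_le_sum fun T hT =>
      sq_average_mul_volume_le (Mesh.volume_simplex_pos hT) (hint T) (hint2 T)
  obtain ⟨F, hFs, hFm, hFb⟩ := hflux 𝒯 hqu hsr m hm0
  have hw : ∀ T, ∃ w : E d → E d, Continuous w ∧ Mesh.IsRTField k w ∧ (T ∈ 𝒯.cells →
      (∀ ψ : E d → ℝ, ContDiff ℝ ∞ ψ →
        ∫ x in simplex T, (fderiv ℝ ψ x (w x) + (polyVal (p T) x - m T) * ψ x) = 0) ∧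
      ∫ x in simplex T, ‖w x‖ ^ 2 ≤ C₂ * 𝒯.size ^ 2 * ∫ x in simplex T, polyVal (p T) x ^ 2) :=
    fun T => by
      by_cases hT : T ∈ 𝒯.cells
      · obtain ⟨w, h1, h2, h3, h4⟩ := hcorr 𝒯 T hT (p T) (hpk T)
        exact ⟨w, h1, h2, fun _ => ⟨h3, h4⟩⟩
      · exact ⟨fun _ => 0, continuous_const, by simpa using Mesh.isRTField_smul_sub k 0 (0 : E d),
          fun h => absurd h hT⟩
  choose w hwc hwRT hw using hw
  set u : Finset (E d) → E d → E d := fun T x => 𝒯.cellField F T x + w T x with hu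
  have huc : ∀ T, Continuous (u T) := fun T => (Mesh.continuous_cellField F T).add (hwc T)
  have hmem := Mesh.memLp_glue (𝒯 := 𝒯) hb huc
  set v : L2V Ω := hmem.toLp _ with hv
  have hvu : ∀ T ∈ 𝒯.cells, ∀ᵐ x ∂(volume.restrict (simplex T)), v x = u T x := fun T hT => by
    filter_upwards [hae hmem.coeFn_toLp T hT, Mesh.glue_ae_eq_restrict u hT] with x h1 h2
    rw [hv, h1, h2]
  have hRT : v ∈ RT 𝒯 k := fun T hT => by
    obtain ⟨P, r, hP, hr, h⟩ := (Mesh.isRTField_cellField k F T).add (hwRT T)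
    refine ⟨P, r, hP, hr, ?_⟩
    filter_upwards [hmem.coeFn_toLp, ae_restrict_of_ae (𝒯.glue_ae_eq u)] with x h1 h2 hxT i
    rw [hv, h1, h2 T hT hxT]
    exact h x i
  have hdiv : v ∈ H0div Ω ∧ weakDiv Ω v = q := by
    refine mem_H0div_of_forall hΩ.isOpen fun ψ hψ hc => ?_
    have hDc := hψ.continuous_fderiv (by simp)
    have hi1 : Integrable (fun x => fderiv ℝ ψ x (v x)) (volume.restrict Ω) := by
      obtain ⟨M, hM⟩ := hDc.bounded_above_of_compact_support (hc.fderiv ℝ)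
      refine (((Lp.memLp v).integrable (by norm_num)).norm.const_mul M).mono'
        ((ContinuousLinearMap.id ℝ (E d →L[ℝ] ℝ)).aestronglyMeasurable_comp₂
          hDc.aestronglyMeasurable (Lp.aestronglyMeasurable v))
        (Filter.Eventually.of_forall fun x => ?_)
      exact (ContinuousLinearMap.le_opNorm _ _).trans
        (mul_le_mul_of_nonneg_right (hM x) (norm_nonneg _))
    have hi2 : Integrable (fun x => q x * ψ x) (volume.restrict Ω) :=
      (Lp.memLp q).integrable_mul (memLp_of_continuous hb hψ.continuous)
    -- Both sides are compared cell by cell; the total of the face fluxes, which vanishes, stands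
    -- for the right-hand zero.
    rw [eq_neg_iff_add_eq_zero, Mesh.integral_eq_sum (𝒯 := 𝒯) hfr hi1,
      Mesh.integral_eq_sum (𝒯 := 𝒯) hfr hi2, ← Finset.sum_add_distrib,
      ← Mesh.sum_faceFlux_eq_zero (𝒯 := 𝒯) hFs hψ hc]
    refine Finset.sum_congr rfl fun T hT => ?_
    have e1 : ∫ x in simplex T, fderiv ℝ ψ x (v x) = ∫ x in simplex T, fderiv ℝ ψ x (u T x) :=
      integral_congr_ae ((hvu T hT).mono fun x hx => by simp only [hx])
    have e2 : ∫ x in simplex T, q x * ψ x = ∫ x in simplex T, polyVal (p T) x * ψ x :=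
      integral_congr_ae ((hpq T hT).mono fun x hx => by simp only [hx])
    rw [← Mesh.integral_cellField hd F hT (hFm T hT) hψ, e1, e2]
    have hcf := Mesh.continuous_cellField (𝒯 := 𝒯) F T
    have hpc := continuous_polyVal (p T)
    have hψc := hψ.continuous
    have hwcT := hwc T
    have huT := huc T
    have key := (hw T hT).1 ψ hψ
    -- The integrands differ by the identity for the correction `w T`, whose integral over the cell
    -- is zero.
    have e : ∀ x, fderiv ℝ ψ x (𝒯.cellField F T x) + m T * ψ x
        = (fderiv ℝ ψ x (u T x) + polyVal (p T) x * ψ x)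
          - (fderiv ℝ ψ x (w T x) + (polyVal (p T) x - m T) * ψ x) := fun x => by
      rw [hu, map_add]; ring
    simp_rw [e]
    have c1 : Continuous fun x => fderiv ℝ ψ x (u T x) := hDc.clm_apply huT
    have c2 : Continuous fun x => polyVal (p T) x * ψ x := hpc.mul hψc
    have c12 : Continuous fun x => fderiv ℝ ψ x (u T x) + polyVal (p T) x * ψ x := c1.add c2
    have c3 : Continuous fun x => fderiv ℝ ψ x (w T x) + (polyVal (p T) x - m T) * ψ x :=
      (hDc.clm_apply hwcT).add ((hpc.sub continuous_const).mul hψc)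
    rw [integral_sub (integrableOn_simplex T c12) (integrableOn_simplex T c3), key,
      sub_zero, integral_add (integrableOn_simplex T c1) (integrableOn_simplex T c2)]
  refine ⟨v, ⟨hRT, hdiv.1⟩, hdiv.2, ?_⟩
  have hcell : ∀ T ∈ 𝒯.cells, ∫ x in simplex T, ‖v x‖ ^ 2
      ≤ 2 * (N / V * (𝒯.size ^ 2 / 𝒯.size ^ d) * ∑ e ∈ 𝒯.facePairs with e.1 = T, F e ^ 2)
        + 2 * (C₂ * 𝒯.size ^ 2 * ∫ x in simplex T, polyVal (p T) x ^ 2) := fun T hT => by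
    have h1 := Mesh.integral_norm_sq_cellField_le hd hn hγ hqu hsr F hT
    have h2 := (hw T hT).2
    have hcf := Mesh.continuous_cellField (𝒯 := 𝒯) F T
    have hwcT := hwc T
    have i1 : IntegrableOn (fun x => 2 * ‖𝒯.cellField F T x‖ ^ 2) (simplex T) :=
      integrableOn_simplex T (by fun_prop)
    have i2 : IntegrableOn (fun x => 2 * ‖w T x‖ ^ 2) (simplex T) :=
      integrableOn_simplex T (by fun_prop)
    rw [integral_congr_ae (g := fun x => ‖u T x‖ ^ 2)
      ((hvu T hT).mono fun x hx => by simp only [hx])]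
    calc ∫ x in simplex T, ‖u T x‖ ^ 2
        ≤ ∫ x in simplex T, (2 * ‖𝒯.cellField F T x‖ ^ 2 + 2 * ‖w T x‖ ^ 2) := by
          refine integral_mono (integrableOn_simplex T ((huc T).norm.pow 2)) (i1.add i2) fun x => ?_
          have h3 := norm_add_le (𝒯.cellField F T x) (w T x)
          have h4 : ‖u T x‖ ^ 2 ≤ (‖𝒯.cellField F T x‖ + ‖w T x‖) ^ 2 :=
            pow_le_pow_left₀ (norm_nonneg _) h3 2
          nlinarith [sq_nonneg (‖𝒯.cellField F T x‖ - ‖w T x‖)]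
      _ = 2 * (∫ x in simplex T, ‖𝒯.cellField F T x‖ ^ 2)
          + 2 * ∫ x in simplex T, ‖w T x‖ ^ 2 := by
          rw [integral_add i1 i2, integral_const_mul, integral_const_mul]
      _ ≤ _ := by linarith
  have hsumF : ∑ T ∈ 𝒯.cells, ∑ e ∈ 𝒯.facePairs with e.1 = T, F e ^ 2
      = ∑ e ∈ 𝒯.facePairs, F e ^ 2 :=
    Finset.sum_fiberwise_of_maps_to (fun e he => (Mesh.mem_facePairs.1 he).1) _
  have hFb' : 𝒯.size ^ 2 / 𝒯.size ^ d * ∑ e ∈ 𝒯.facePairs, F e ^ 2 ≤ C₁ * ‖q‖ ^ 2 := by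
    rw [div_mul_eq_mul_div, div_le_iff₀ (by positivity)]
    refine hFb.trans ?_
    have := mul_le_mul_of_nonneg_left hm2 (show 0 ≤ C₁ * 𝒯.size ^ d by positivity)
    linarith
  have hHR2 : 𝒯.size ^ 2 ≤ R ^ 2 := pow_le_pow_left₀ hH.le hHR 2
  calc ‖v‖ ^ 2 = ∑ T ∈ 𝒯.cells, ∫ x in simplex T, ‖v x‖ ^ 2 := by
        rw [← integral_norm_sq_eq, Mesh.integral_eq_sum (𝒯 := 𝒯) hfr (integrable_norm_sq v)]
    _ ≤ ∑ T ∈ 𝒯.cells, _ := Finset.sum_le_sum hcell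
    _ = 2 * (N / V * (𝒯.size ^ 2 / 𝒯.size ^ d * ∑ e ∈ 𝒯.facePairs, F e ^ 2))
        + 2 * (C₂ * 𝒯.size ^ 2 * ‖q‖ ^ 2) := by
        rw [Finset.sum_add_distrib, ← Finset.mul_sum, ← Finset.mul_sum, ← Finset.mul_sum,
          ← Finset.mul_sum, hsumF, hq2]
        ring
    _ ≤ 2 * (N / V * (C₁ * ‖q‖ ^ 2)) + 2 * (C₂ * R ^ 2 * ‖q‖ ^ 2) := by gcongr
    _ = _ := by ring

theorem exists_le_infSup (hd : 0 < d) (hΩ : IsLipschitzDomain Ω) (hpoly : HasPolygonalBoundary Ω)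
    (k : ℕ) {γqu : ℝ} (γsr : ℝ) (hγ : 0 < γqu) :
    ∃ ρ : ℝ, 0 < ρ ∧ ∀ 𝒯 : Mesh Ω, 𝒯.QuasiUniform γqu → 𝒯.ShapeRegular γsr →
      (ρ : EReal) ≤ infSup 𝒯 k := by
  obtain ⟨c, hc, h⟩ := exists_field hd hΩ hpoly k γsr hγ
  exact ⟨(1 + c) ^ (-(1 / 2 : ℝ)), by positivity, fun 𝒯 hqu hsr =>
    le_infSup hΩ.isOpen 𝒯 k hc (h 𝒯 hqu hsr)⟩

end RTInfSup

end

theorem mainTheorem9 {d : ℕ} (hd : d = 2 ∨ d = 3) (Ω : Set (RTInfSup.E d))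
    (hΩ : RTInfSup.IsLipschitzDomain Ω) (hpoly : RTInfSup.HasPolygonalBoundary Ω)
    (k : ℕ) (γqu γsr : ℝ) (hγqu : 0 < γqu) :
    -- the optimal Poincaré–Wirtinger constant exists and is positive
    (0 < RTInfSup.poincareWirtingerConst Ω ∧
      IsLeast (RTInfSup.poincareWirtingerSet Ω) (RTInfSup.poincareWirtingerConst Ω)) ∧
    -- inf-sup stability, with a constant that is independent of the mesh size
    (∃ ρ : ℝ, 0 < ρ ∧ ∀ 𝒯 : RTInfSup.Mesh Ω, 𝒯.QuasiUniform γqu → 𝒯.ShapeRegular γsr →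
      (ρ : EReal) ≤ RTInfSup.infSup 𝒯 k) ∧
    -- the explicit constant, for every stable commuting projection
    (∀ (𝒯 : RTInfSup.Mesh Ω) (C : ℝ) (π : RTInfSup.H0div Ω → RTInfSup.H0div Ω),
      RTInfSup.IsStableCommutingProjection 𝒯 k C π →
      ∀ Cstab : ℝ, 0 < Cstab → RTInfSup.IsGloballyStable Cstab π →
        (((1 + Cstab * (1 + RTInfSup.poincareWirtingerConst Ω ^ 2)) ^ (-(1 / 2 : ℝ)) : ℝ) : EReal)
          ≤ RTInfSup.infSup 𝒯 k) ∧
    -- the global stability constant can be chosen independently of the mesh size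
    (∀ C : ℝ, 0 < C → ∃ Cstab : ℝ, 0 < Cstab ∧
      ∀ (𝒯 : RTInfSup.Mesh Ω) (π : RTInfSup.H0div Ω → RTInfSup.H0div Ω),
        𝒯.QuasiUniform γqu → 𝒯.ShapeRegular γsr →
        RTInfSup.IsStableCommutingProjection 𝒯 k C π → RTInfSup.IsGloballyStable Cstab π) := by
  have hd' : 0 < d := by omega
  exact ⟨⟨RTInfSup.poincareWirtingerConst_pos hd' hΩ hpoly,
    RTInfSup.isLeast_poincareWirtingerConst hΩ hpoly⟩,
    RTInfSup.exists_le_infSup hd' hΩ hpoly k γsr hγqu,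
    fun 𝒯 C π hπ Cstab h0 hs => RTInfSup.le_infSup_of_projection hΩ hpoly hπ h0 hs,
    fun C hC => RTInfSup.exists_isGloballyStable hd' hΩ hpoly k γsr hγqu hC⟩
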